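/- **Theorem 1.2.** Let $s\in(\tfrac34,1)$, $t\in(0,1)$, and for $\alpha\in(0,1)$ put $2_\alpha^*=\frac{6}{3-2\alpha}$. For $\varepsilon>0$ consider on $\mathbb R^3$ the system $$\begin{cases}\varepsilon^{2s}(-\Delta)^su+V(x)u+\phi u=K(x)f(u)+Q(x)|u|^{2_s^*-2}u,\\ \varepsilon^{2t}(-\Delta)^t\phi=u^2.\end{cases}\tag{1}$$ Assume: - $(f_0)$ $f\in C^1(\mathbb R)$, $f(\tau)=o(\tau^3)$ as $\tau\to0$, $f(\tau)\tau>0$ for $\tau>0$, and $f(\tau)=0$ for $\tau\le0$; - $(f_1)$ $\tau\mapsto f(\tau)/\tau^3$ is strictly increasing on $(0,\infty)$; - $(f_2)$ there are constants $c_0,c_1>0$ and $4<q<p<2_s^*$ such that $f(\tau)\ge c_0\tau^{q-1}$ for all $\tau>0$ and $|f'(\tau)|\le c_1(1+|\tau|^{p-2})$ for all $\tau\in\mathbb R$; - $V,K,Q:\mathbb R^3\to(0,\infty)$ are continuous and have limits $V_\infty,K_\infty,Q_\infty\in(0,\infty)$ as $|x|\to\infty$; moreover $V(x)\ge V_\infty$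 (so that $V_\infty=V_0:=\inf V$), $K(x)\le K_\infty$ and $Q(x)\le Q_\infty$ for all $x\in\mathbb R^3$, and at least one of these three inequalities is strict on a set of positive Lebesgue measure. *Notation.* For $\alpha\in(0,1)$ let $$\int_{\mathbb R^3}(-\Delta)^{\frac\alpha2}u\,(-\Delta)^{\frac\alpha2}v\,dx:=\frac{C_\alpha}{2}\iint_{\mathbb R^3\times\mathbb R^3}\frac{(u(x)-u(y))(v(x)-v(y))}{|x-y|^{3+2\alpha}}\,dx\,dy,\qquad C_\alpha=\Big(\int_{\mathbb R^3}\frac{1-\cos\zeta_1}{|\zeta|^{3+2\alpha}}\,d\zeta\Big)^{-1};$$ $H^\alpha(\mathbb R^3)$, respectively $\mathcal D^{\alpha,2}(\mathbb R^3)$, is the space of real functions in $L^2(\mathbb R^3)$, respectively in $L^{2_\alpha^*}(\mathbb R^3)$, for which this form is finite at $v=u$. For $u\in H^s(\mathbb R^3)$ let $\phi_u^t\in\mathcal D^{t,2}(\mathbb R^3)$ be the unique weak solution of $(-\Delta)^t\phi=u^2$, i.e. $\int(-\Delta)^{\frac t2}\phi_u^t(-\Delta)^{\frac t2}\psi=\int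 u^2\psi$ for all $\psi\in\mathcal D^{t,2}(\mathbb R^3)$, and let $F(\tau)=\int_0^\tau f$. Put $$I_\varepsilon(u)=\frac12\int\big(|(-\Delta)^{\frac s2}u|^2+V(\varepsilon x)u^2\big)+\frac14\int\phi_u^tu^2-\int K(\varepsilon x)F(u)-\frac1{2_s^*}\int Q(\varepsilon x)|u|^{2_s^*}$$ on $H_\varepsilon=\{u\in H^s(\mathbb R^3):\int V(\varepsilon x)u^2<\infty\}$, with norm $\|u\|_\varepsilon=\big(\int|(-\Delta)^{\frac s2}u|^2+V(\varepsilon x)u^2\big)^{1/2}$, and $$\mathcal N_\varepsilon=\{u\in H_\varepsilon\setminus\{0\}:\langle I_\varepsilon'(u),u\rangle=0\},\qquad m_\varepsilon=\inf_{\mathcal N_\varepsilon}I_\varepsilon,$$ $$c_\varepsilon=\inf_{\gamma}\max_{\tau\in[0,1]}I_\varepsilon(\gamma(\tau)),$$ the infimum being over all $\gamma\in C([0,1],H_\varepsilon)$ with $\gamma(0)=0$ and $I_\varepsilon(\gamma(1))<0$. Let $I_\infty$, $\mathcal N_\infty$ and $m_\infty=\inf_{\mathcal N_\infty}I_\infty$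 be the same objects with $V(\varepsilon x),K(\varepsilon x),Q(\varepsilon x)$ replaced by the constants $V_\infty,K_\infty,Q_\infty$. A pair $(u,\phi)$ with $u\in H^s(\mathbb R^3)$ and $\phi\in\mathcal D^{t,2}(\mathbb R^3)$ is a weak solution of (1) if both equations hold when tested with all $v\in H^s(\mathbb R^3)$, respectively all $\psi\in\mathcal D^{t,2}(\mathbb R^3)$. It is a *ground state solution* if moreover $u\ne0$ and the rescaled function $x\mapsto u(\varepsilon x)$ has the ground energy: $I_\varepsilon(u(\varepsilon\,\cdot))=c_\varepsilon$. *Conclusion.* For every $\varepsilon>0$: $c_\varepsilon=m_\varepsilon=m_\infty$; there is no $u\in\mathcal N_\varepsilon$ with $I_\varepsilon(u)=c_\varepsilon$; and the system (1) has no ground state solution. -/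

import Mathlib

open MeasureTheory Set Filter Topology Asymptotics

noncomputable section

namespace FracSP

/-- Three-dimensional Euclidean space. -/
abbrev R3 : Type := EuclideanSpace ℝ (Fin 3)

/-- The normalization constant `C_α = (∫ (1 - cos ζ₁) / |ζ|^(3+2α) dζ)⁻¹` of the fractional
Laplacian `(-Δ)^α v (x) = C_α P.V. ∫ (v x - v y) / |x - y|^(3+2α) dy`. -/
def fracConst (α : ℝ) : ℝ :=
  (∫ ζ : R3, (1 - Real.cos (ζ 0)) / ‖ζ‖ ^ (3 + 2 * α))⁻¹

/-- Finiteness of the Gagliardo seminorm of order `α`. -/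
def FiniteSeminorm (α : ℝ) (u : R3 → ℝ) : Prop :=
  Integrable (fun z : R3 × R3 => (u z.1 - u z.2) ^ 2 / ‖z.1 - z.2‖ ^ (3 + 2 * α))

/-- The bilinear form of `(-Δ)^α`, that is `∫ (-Δ)^(α/2) u (-Δ)^(α/2) v dx`, written in terms of
finite differences:
`(C_α / 2) ∬ (u x - u y) (v x - v y) / |x - y|^(3+2α) dx dy`. -/
def fracForm (α : ℝ) (u v : R3 → ℝ) : ℝ :=
  fracConst α / 2 *
    ∫ z : R3 × R3, (u z.1 - u z.2) * (v z.1 - v z.2) / ‖z.1 - z.2‖ ^ (3 + 2 * α)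

/-- The critical Sobolev exponent `2_α^* = 6 / (3 - 2α)` in dimension three. -/
def critExp (α : ℝ) : ℝ := 6 / (3 - 2 * α)

/-- Membership in the fractional Sobolev space `H^α(ℝ³)`. -/
def MemH (α : ℝ) (u : R3 → ℝ) : Prop :=
  MemLp u 2 volume ∧ FiniteSeminorm α u

/-- Membership in the homogeneous fractional Sobolev space `D^{α,2}(ℝ³)`. -/
def MemD (α : ℝ) (u : R3 → ℝ) : Prop :=
  MemLp u (ENNReal.ofReal (critExp α)) volume ∧ FiniteSeminorm α u

/-- Membership in the weighted space `{u ∈ H^s(ℝ³) | ∫ V u² < ∞}`. -/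
def MemHV (s : ℝ) (V u : R3 → ℝ) : Prop :=
  MemH s u ∧ Integrable (fun x => V x * u x ^ 2)

/-- The norm `(∫ |(-Δ)^(s/2) u|² + V u²)^(1/2)` of the weighted space. -/
def normHV (s : ℝ) (V u : R3 → ℝ) : ℝ :=
  Real.sqrt (fracForm s u u + ∫ x, V x * u x ^ 2)

/-- `φ ∈ D^{t,2}(ℝ³)` is a weak solution of the fractional Poisson equation
`b (-Δ)^t φ = u²` in `ℝ³`. -/
def IsPoissonSolution (t b : ℝ) (u φ : R3 → ℝ) : Prop :=
  MemD t φ ∧ ∀ ψ : R3 → ℝ, MemD t ψ → b * fracForm t φ ψ = ∫ x, u x ^ 2 * ψ x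

open Classical in
/-- The potential `φ_u^t`: the weak solution in `D^{t,2}(ℝ³)` of `(-Δ)^t φ = u²`, which is unique
as an element of `D^{t,2}(ℝ³)`, i.e. up to a null set. It exists for all `u ∈ H^s(ℝ³)` when
`4 s + 2 t ≥ 3`, in particular when `s > 3/4`; the value `0` in the other case is never used. -/
def phi (t : ℝ) (u : R3 → ℝ) : R3 → ℝ :=
  if h : ∃ φ : R3 → ℝ, IsPoissonSolution t 1 u φ then h.choose else 0

/-- The primitive `F(τ) = ∫₀^τ f`. -/
def primitive (f : ℝ → ℝ) (τ : ℝ) : ℝ := ∫ r in (0 : ℝ)..τ, f r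

/-- The energy functional of
`(-Δ)^s u + V u + φ_u^t u = K f(u) + Q |u|^(2_s^* - 2) u`:
`I(u) = ½ ∫ (|(-Δ)^(s/2) u|² + V u²) + ¼ ∫ φ_u^t u² - ∫ K F(u) - (1/2_s^*) ∫ Q |u|^(2_s^*)`. -/
def energy (s t : ℝ) (V K Q : R3 → ℝ) (f : ℝ → ℝ) (u : R3 → ℝ) : ℝ :=
  1 / 2 * (fracForm s u u + ∫ x, V x * u x ^ 2)
    + 1 / 4 * (∫ x, phi t u x * u x ^ 2)
    - (∫ x, K x * primitive f (u x))
    - 1 / critExp s * ∫ x, Q x * |u x| ^ critExp s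

/-- `G(u) = ⟨I'(u), u⟩`, the functional that defines the Nehari manifold. -/
def nehariFunctional (s t : ℝ) (V K Q : R3 → ℝ) (f : ℝ → ℝ) (u : R3 → ℝ) : ℝ :=
  (fracForm s u u + ∫ x, V x * u x ^ 2)
    + (∫ x, phi t u x * u x ^ 2)
    - (∫ x, K x * (f (u x) * u x))
    - ∫ x, Q x * |u x| ^ critExp s

/-- The Nehari manifold: the nonzero `u` in the weighted space with `G(u) = 0`. -/
def nehari (s t : ℝ) (V K Q : R3 → ℝ) (f : ℝ → ℝ) : Set (R3 → ℝ) :=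
  {u | MemHV s V u ∧ ¬ (u =ᵐ[volume] 0) ∧ nehariFunctional s t V K Q f u = 0}

/-- The least energy level `m = inf_{u ∈ 𝒩} I(u)`, as an extended real number. -/
def leastEnergy (s t : ℝ) (V K Q : R3 → ℝ) (f : ℝ → ℝ) : EReal :=
  ⨅ u ∈ nehari s t V K Q f, (energy s t V K Q f u : EReal)

/-- The admissible paths: `γ : [0,1] → H` continuous for the norm of the weighted space `H`, with
`γ(0) = 0` and `I(γ(1)) < 0`. (Only the values of `γ` on `[0,1]` matter.) -/
def mountainPaths (s t : ℝ) (V K Q : R3 → ℝ) (f : ℝ → ℝ) : Set (ℝ → R3 → ℝ) :=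
  {γ | (∀ τ ∈ Icc (0 : ℝ) 1, MemHV s V (γ τ)) ∧
    (∀ τ ∈ Icc (0 : ℝ) 1,
      Tendsto (fun r => normHV s V (γ r - γ τ)) (𝓝[Icc (0 : ℝ) 1] τ) (𝓝 0)) ∧
    γ 0 =ᵐ[volume] 0 ∧ energy s t V K Q f (γ 1) < 0}

/-- The mountain pass level `c = inf_γ max_{τ ∈ [0,1]} I(γ(τ))`, as an extended real number. -/
def mountainPassLevel (s t : ℝ) (V K Q : R3 → ℝ) (f : ℝ → ℝ) : EReal :=
  ⨅ γ ∈ mountainPaths s t V K Q f, ⨆ τ ∈ Icc (0 : ℝ) 1, (energy s t V K Q f (γ τ) : EReal)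

/-- The dilated function `x ↦ g (ε x)`. -/
def dilate (ε : ℝ) (g : R3 → ℝ) : R3 → ℝ := fun x => g (ε • x)

/-- The ground energy `c_ε`: the mountain pass level of the functional `I_ε`, whose coefficients
are `V(ε x)`, `K(ε x)`, `Q(ε x)`. -/
def groundEnergy (s t ε : ℝ) (V K Q : R3 → ℝ) (f : ℝ → ℝ) : EReal :=
  mountainPassLevel s t (dilate ε V) (dilate ε K) (dilate ε Q) f

/-- `(u, φ)` is a weak solution of the fractional Schrödinger–Poisson system
`ε^(2s) (-Δ)^s u + V u + φ u = K f(u) + Q |u|^(2_s^* - 2) u`, `ε^(2t) (-Δ)^t φ = u²` in `ℝ³`. -/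
def IsWeakSolution (s t ε : ℝ) (V K Q : R3 → ℝ) (f : ℝ → ℝ) (u φ : R3 → ℝ) : Prop :=
  MemHV s V u ∧
  (∀ v : R3 → ℝ, MemHV s V v →
    ε ^ (2 * s) * fracForm s u v + (∫ x, V x * u x * v x) + (∫ x, φ x * u x * v x)
      = (∫ x, K x * f (u x) * v x) + ∫ x, Q x * (|u x| ^ (critExp s - 2) * u x) * v x) ∧
  IsPoissonSolution t (ε ^ (2 * t)) u φ

/-- `(u, φ)` is a ground state solution of the system: a weak solution with `u ≠ 0` such that the
rescaled function `x ↦ u (ε x)` has energy `I_ε` equal to the ground energy `c_ε`. -/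
def IsGroundState (s t ε : ℝ) (V K Q : R3 → ℝ) (f : ℝ → ℝ) (u φ : R3 → ℝ) : Prop :=
  IsWeakSolution s t ε V K Q f u φ ∧ ¬ (u =ᵐ[volume] 0) ∧
  (energy s t (dilate ε V) (dilate ε K) (dilate ε Q) f (dilate ε u) : EReal)
    = groundEnergy s t ε V K Q f

/-- The hypotheses on the nonlinearity `f`. -/
structure IsAdmissible (s : ℝ) (f : ℝ → ℝ) : Prop where
  contDiff : ContDiff ℝ 1 f
  isLittleO : f =o[𝓝 0] fun τ : ℝ => τ ^ 3
  pos : ∀ τ : ℝ, 0 < τ → 0 < f τ * τ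
  zero : ∀ τ : ℝ, τ ≤ 0 → f τ = 0
  strictMono : StrictMonoOn (fun τ : ℝ => f τ / τ ^ 3) (Ioi 0)
  growth : ∃ c₀ c₁ p q : ℝ, 0 < c₀ ∧ 0 < c₁ ∧ 4 < q ∧ q < p ∧ p < critExp s ∧
    (∀ τ : ℝ, 0 < τ → c₀ * τ ^ (q - 1) ≤ f τ) ∧
    (∀ τ : ℝ, |deriv f τ| ≤ c₁ * (1 + |τ| ^ (p - 2)))

end FracSP

end

/-! Everything is compared with the limit problem, whose energy `I_∞` lies below `I_ε` because of
the one-sided inequalities on the coefficients. The levels are squeezed in the cycle `m_∞ ≤ m_ε ≤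
c_ε ≤ m_∞`.

The first inequality (`leastEnergy_mono`) projects a point of `𝒩_ε` along its ray to `𝒩_∞`. It rests
on `energy_smul_le_of_mem_nehari`: on the ray through a Nehari point the energy is largest at that
point. The Coulomb term has degree four, so this is where the monotonicity of `f(τ)/τ³` and `2_s^* >
4`, that is `s > 3/4`, are needed. The second inequality holds because every admissible path crosses
the Nehari manifold (`exists_mem_nehari_of_mountainPath`, an intermediate value argument). For the
third (`mountainPassLevel_le_leastEnergy`), a point of `𝒩_∞` is translated towards infinity, where
the coefficients are close to their limits, and the segment through the translate is used as a path.

If `u ∈ 𝒩_ε` attained the common level, its projection `w` to `𝒩_∞` would minimize `I_∞`, and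
`I_ε(w) = I_∞(w)` would force `w` to vanish almost everywhere on the open set where some coefficient
differs from its limit (`not_exists_minimizer`). A minimizer of `I_∞` cannot vanish on a ball
(`not_ae_eq_zero_of_minimizer`). It is nonnegative, and adding `δ v` with a cone `v` supported in
the ball changes the Gagliardo form at first order by a multiple of `fracForm s w v`, which is
negative by nonlocality; every other change is favourable or of order `δ²`. This comparison needs no
Euler–Lagrange equation and no maximum principle. Finally, a nontrivial weak solution tested with
itself lies, after rescaling, on `𝒩_ε`, so a ground state solution would attain the level.

The analytic basis consists of the fractional Sobolev inequality (`sobolev_inequality`), the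
solution of the Poisson equation by Riesz representation (`exists_weak_solution`), and the
continuity of all terms of the Nehari functional (`tendsto_integral_of_two_scale`,
`tendsto_coulomb`). -/

noncomputable section

namespace FracSP

/-! ### Integrability of the truncated kernel -/

/-- In polar coordinates the integrand is `y^(1-2α)` near the origin and `y^(-1-2α)` at infinity, so
`0 < α < 1` is what both ends require. The kernel dominates the integrand defining `fracConst` and
the difference quotients of cones. -/
lemma integrable_truncated_kernel {α : ℝ} (hα : α ∈ Ioo (0 : ℝ) 1) :
    Integrable (fun h : R3 => min 1 (‖h‖ ^ 2) / ‖h‖ ^ (3 + 2 * α)) := by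
  have h := integrable_fun_norm_addHaar (volume : Measure R3)
    (f := fun y : ℝ => min 1 (y ^ 2) / y ^ (3 + 2 * α))
  rw [h, finrank_euclideanSpace_fin, ← Ioc_union_Ioi_eq_Ioi (zero_le_one' ℝ)]
  refine IntegrableOn.union ?_ ?_
  · have h1 : IntegrableOn (fun y : ℝ => y ^ (1 - 2 * α)) (Ioc 0 1) :=
      (intervalIntegrable_iff_integrableOn_Ioc_of_le zero_le_one).1
        (intervalIntegral.intervalIntegrable_rpow' (by linarith [hα.2]))
    refine h1.congr_fun (fun y hy => ?_) measurableSet_Ioc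
    have hy0 := hy.1
    have : min 1 (y ^ 2) = y ^ 2 := min_eq_right (pow_le_one₀ hy0.le hy.2)
    simp only [this, smul_eq_mul]
    rw [show 3 - 1 = 2 from rfl, show y ^ 2 = y ^ (2 : ℝ) by norm_num,
      ← mul_div_assoc, ← Real.rpow_add hy0, ← Real.rpow_sub hy0]
    congr 1; ring
  · have h1 : IntegrableOn (fun y : ℝ => y ^ (-1 - 2 * α)) (Ioi 1) :=
      integrableOn_Ioi_rpow_of_lt (by linarith [hα.1]) zero_lt_one
    refine h1.congr_fun (fun y hy => ?_) measurableSet_Ioi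
    have hy1 : 1 < y := hy
    have hy0 : 0 < y := by linarith
    have : min 1 (y ^ 2) = 1 := min_eq_left (one_le_pow₀ hy1.le)
    simp only [this, smul_eq_mul]
    rw [show y ^ (3 - 1) = y ^ (2 : ℝ) by norm_num,
      ← mul_div_assoc, mul_one, ← Real.rpow_sub hy0]
    congr 1; ring

/-- Convergence matters as much as positivity of the integrand: a divergent integral would have the
default value `0`, and so would its inverse. -/
lemma fracConst_pos {α : ℝ} (hα : α ∈ Ioo (0 : ℝ) 1) : 0 < fracConst α := by
  refine inv_pos.2 ?_
  have hcoord : Continuous fun ζ : R3 => ζ 0 := by fun_prop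
  have hnn : ∀ ζ : R3, 0 ≤ (1 - Real.cos (ζ 0)) / ‖ζ‖ ^ (3 + 2 * α) := fun ζ =>
    div_nonneg (by linarith [Real.cos_le_one (ζ 0)]) (by positivity)
  have hmeas : Measurable fun ζ : R3 => (1 - Real.cos (ζ 0)) / ‖ζ‖ ^ (3 + 2 * α) :=
    ((measurable_const.sub (Real.continuous_cos.comp hcoord).measurable)).div
      (measurable_norm.pow_const _)
  have hint : Integrable fun ζ : R3 => (1 - Real.cos (ζ 0)) / ‖ζ‖ ^ (3 + 2 * α) := by
    refine ((integrable_truncated_kernel hα).const_mul 2).mono' hmeas.aestronglyMeasurable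
      (ae_of_all _ fun ζ => ?_)
    rw [Real.norm_of_nonneg (hnn ζ), ← mul_div_assoc]
    refine div_le_div_of_nonneg_right ?_ (by positivity)
    have h1 : (ζ 0) ^ 2 ≤ ‖ζ‖ ^ 2 := by
      have := PiLp.norm_apply_le ζ 0
      rw [← sq_abs, ← Real.norm_eq_abs]
      gcongr
    have h2 := Real.one_sub_sq_div_two_le_cos (x := ζ 0)
    rcases min_cases 1 (‖ζ‖ ^ 2) with h | h <;> rw [h.1]
    · linarith [Real.neg_one_le_cos (ζ 0)]
    · nlinarith
  rw [integral_pos_iff_support_of_nonneg hnn hint]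
  let U : Set R3 := {ζ | Real.cos (ζ 0) < 1}
  have hU : IsOpen U := isOpen_lt (Real.continuous_cos.comp hcoord) continuous_const
  have hne : U.Nonempty :=
    ⟨EuclideanSpace.single 0 Real.pi, by simp [U]⟩
  refine (hU.measure_pos volume hne).trans_le (measure_mono fun ζ hζ => ?_)
  have hζ' : Real.cos (ζ 0) < 1 := hζ
  have hζ0 : ζ ≠ 0 := by rintro rfl; simp at hζ'
  have : 0 < ‖ζ‖ := norm_pos_iff.2 hζ0
  exact (div_pos (by linarith) (by positivity)).ne'

/-! ### The difference quotient and the quadratic form -/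

/-- The difference quotient whose `L²` norm is the Gagliardo seminorm. -/
def diffQuot (α : ℝ) (u : R3 → ℝ) (z : R3 × R3) : ℝ :=
  (u z.1 - u z.2) / ‖z.1 - z.2‖ ^ ((3 + 2 * α) / 2)

/-- Measurable functions with finite Gagliardo seminorm. -/
def MemG (α : ℝ) (u : R3 → ℝ) : Prop :=
  AEStronglyMeasurable u volume ∧ MemLp (diffQuot α u) 2 volume

lemma diffQuot_mul (α : ℝ) (u v : R3 → ℝ) (z : R3 × R3) :
    diffQuot α u z * diffQuot α v z
      = (u z.1 - u z.2) * (v z.1 - v z.2) / ‖z.1 - z.2‖ ^ (3 + 2 * α) := by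
  unfold diffQuot
  rw [div_mul_div_comm, ← Real.sqrt_sq (Real.rpow_nonneg (norm_nonneg (z.1 - z.2)) (3 + 2 * α)),
    div_eq_mul_one_div (3 + 2 * α) 2, Real.rpow_mul (norm_nonneg _), ← Real.sqrt_eq_rpow,
    Real.mul_self_sqrt (by positivity), Real.sqrt_sq (by positivity)]

lemma diffQuot_sq (α : ℝ) (u : R3 → ℝ) (z : R3 × R3) :
    diffQuot α u z ^ 2 = (u z.1 - u z.2) ^ 2 / ‖z.1 - z.2‖ ^ (3 + 2 * α) := by
  rw [sq, diffQuot_mul, sq]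

lemma aestronglyMeasurable_diffQuot (α : ℝ) {u : R3 → ℝ}
    (hu : AEStronglyMeasurable u volume) : AEStronglyMeasurable (diffQuot α u) volume := by
  have h1 : AEStronglyMeasurable (fun z : R3 × R3 => u z.1) volume := hu.comp_fst
  have h2 : AEStronglyMeasurable (fun z : R3 × R3 => u z.2) volume := hu.comp_snd
  have h3 : Measurable fun z : R3 × R3 => ‖z.1 - z.2‖ ^ ((3 + 2 * α) / 2) :=
    ((measurable_fst.sub measurable_snd).norm).pow_const _
  exact ((h1.sub h2).aemeasurable.div h3.aemeasurable).aestronglyMeasurable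

lemma finiteSeminorm_iff {α : ℝ} {u : R3 → ℝ} (hu : AEStronglyMeasurable u volume) :
    FiniteSeminorm α u ↔ MemLp (diffQuot α u) 2 volume := by
  rw [memLp_two_iff_integrable_sq (aestronglyMeasurable_diffQuot α hu)]
  simp only [diffQuot_sq]
  rfl

lemma MemH.memG {α : ℝ} {u : R3 → ℝ} (h : MemH α u) : MemG α u :=
  ⟨h.1.1, (finiteSeminorm_iff h.1.1).1 h.2⟩

lemma MemD.memG {α : ℝ} {u : R3 → ℝ} (h : MemD α u) : MemG α u :=
  ⟨h.1.1, (finiteSeminorm_iff h.1.1).1 h.2⟩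

lemma MemG.finiteSeminorm {α : ℝ} {u : R3 → ℝ} (h : MemG α u) : FiniteSeminorm α u :=
  (finiteSeminorm_iff h.1).2 h.2

lemma diffQuot_add (α : ℝ) (u v : R3 → ℝ) :
    diffQuot α (u + v) = diffQuot α u + diffQuot α v := by
  ext z; simp only [diffQuot, Pi.add_apply]; ring

lemma diffQuot_smul (α c : ℝ) (u : R3 → ℝ) : diffQuot α (c • u) = c • diffQuot α u := by
  ext z; simp only [diffQuot, Pi.smul_apply, smul_eq_mul]; ring

lemma diffQuot_sub (α : ℝ) (u v : R3 → ℝ) :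
    diffQuot α (u - v) = diffQuot α u - diffQuot α v := by
  ext z; simp only [diffQuot, Pi.sub_apply]; ring

lemma MemG.add {α : ℝ} {u v : R3 → ℝ} (hu : MemG α u) (hv : MemG α v) : MemG α (u + v) :=
  ⟨hu.1.add hv.1, by rw [diffQuot_add]; exact hu.2.add hv.2⟩

lemma MemG.sub {α : ℝ} {u v : R3 → ℝ} (hu : MemG α u) (hv : MemG α v) : MemG α (u - v) :=
  ⟨hu.1.sub hv.1, by rw [diffQuot_sub]; exact hu.2.sub hv.2⟩

lemma MemG.smul {α : ℝ} {u : R3 → ℝ} (hu : MemG α u) (c : ℝ) : MemG α (c • u) :=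
  ⟨hu.1.const_smul c, by rw [diffQuot_smul]; exact hu.2.const_smul c⟩

/-- Composition with a contraction preserves finiteness of the seminorm. -/
lemma MemG.comp_contraction {α : ℝ} {u : R3 → ℝ} (hu : MemG α u) {g : ℝ → ℝ}
    (hg : LipschitzWith 1 g) : MemG α (g ∘ u) := by
  have hm := hg.continuous.comp_aestronglyMeasurable hu.1
  refine ⟨hm, hu.2.mono (aestronglyMeasurable_diffQuot α hm) (ae_of_all _ fun z => ?_)⟩
  simp only [diffQuot, norm_div]
  gcongr
  simpa [dist_eq_norm] using hg.dist_le_mul (u z.1) (u z.2)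

lemma ae_prod_of_ae {P : R3 → Prop} (h : ∀ᵐ x, P x) :
    ∀ᵐ z : R3 × R3, P z.1 ∧ P z.2 := by
  have h1 := (Measure.quasiMeasurePreserving_fst (μ := (volume : Measure R3))
    (ν := (volume : Measure R3))).ae h
  have h2 := (Measure.quasiMeasurePreserving_snd (μ := (volume : Measure R3))
    (ν := (volume : Measure R3))).ae h
  exact h1.and h2

lemma diffQuot_congr_ae (α : ℝ) {u v : R3 → ℝ} (h : u =ᵐ[volume] v) :
    diffQuot α u =ᵐ[volume] diffQuot α v := by
  filter_upwards [ae_prod_of_ae h] with z hz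
  simp [diffQuot, hz.1, hz.2]

lemma fracForm_eq (α : ℝ) (u v : R3 → ℝ) :
    fracForm α u v = fracConst α / 2 * ∫ z, diffQuot α u z * diffQuot α v z := by
  simp only [fracForm, diffQuot_mul]

lemma fracForm_self_eq (α : ℝ) (u : R3 → ℝ) :
    fracForm α u u = fracConst α / 2 * ∫ z, diffQuot α u z ^ 2 := by
  simp only [fracForm_eq, sq]

lemma fracForm_comm (α : ℝ) (u v : R3 → ℝ) : fracForm α u v = fracForm α v u := by
  simp only [fracForm_eq, mul_comm]

lemma fracForm_congr_ae (α : ℝ) {u u' v v' : R3 → ℝ} (hu : u =ᵐ[volume] u')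
    (hv : v =ᵐ[volume] v') : fracForm α u v = fracForm α u' v' := by
  rw [fracForm_eq, fracForm_eq]
  congr 1
  refine integral_congr_ae ?_
  filter_upwards [diffQuot_congr_ae α hu, diffQuot_congr_ae α hv] with z h1 h2
  rw [h1, h2]

lemma MemG.integrable_mul {α : ℝ} {u v : R3 → ℝ} (hu : MemG α u) (hv : MemG α v) :
    Integrable fun z => diffQuot α u z * diffQuot α v z :=
  MemLp.integrable_mul hu.2 hv.2

lemma fracForm_add_left {α : ℝ} {u v w : R3 → ℝ} (hu : MemG α u) (hv : MemG α v)
    (hw : MemG α w) : fracForm α (u + v) w = fracForm α u w + fracForm α v w := by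
  simp only [fracForm_eq, diffQuot_add, Pi.add_apply, add_mul]
  rw [integral_add (hu.integrable_mul hw) (hv.integrable_mul hw), mul_add]

lemma fracForm_smul_left (α c : ℝ) (u v : R3 → ℝ) :
    fracForm α (c • u) v = c * fracForm α u v := by
  simp only [fracForm_eq, diffQuot_smul, Pi.smul_apply, smul_eq_mul, mul_assoc]
  rw [integral_const_mul]; ring

lemma fracForm_smul_right (α c : ℝ) (u v : R3 → ℝ) :
    fracForm α u (c • v) = c * fracForm α u v := by
  rw [fracForm_comm, fracForm_smul_left, fracForm_comm]

lemma fracForm_smul_self (α c : ℝ) (u : R3 → ℝ) :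
    fracForm α (c • u) (c • u) = c ^ 2 * fracForm α u u := by
  rw [fracForm_smul_left, fracForm_smul_right]; ring

lemma fracForm_add_right {α : ℝ} {u v w : R3 → ℝ} (hu : MemG α u) (hv : MemG α v)
    (hw : MemG α w) : fracForm α w (u + v) = fracForm α w u + fracForm α w v := by
  rw [fracForm_comm, fracForm_add_left hu hv hw, fracForm_comm α u, fracForm_comm α v]

lemma fracForm_sub_left {α : ℝ} {u v w : R3 → ℝ} (hu : MemG α u) (hv : MemG α v)
    (hw : MemG α w) : fracForm α (u - v) w = fracForm α u w - fracForm α v w := by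
  have : u - v = u + (-1 : ℝ) • v := by simp [sub_eq_add_neg]
  rw [this, fracForm_add_left hu (hv.smul _) hw, fracForm_smul_left]; ring

lemma fracForm_add_smul_self {α : ℝ} {u v : R3 → ℝ} (hu : MemG α u) (hv : MemG α v) (c : ℝ) :
    fracForm α (u + c • v) (u + c • v)
      = fracForm α u u + 2 * c * fracForm α u v + c ^ 2 * fracForm α v v := by
  have hcv := hv.smul c
  rw [fracForm_add_left hu hcv (hu.add hcv), fracForm_add_right hu hcv hu,
    fracForm_add_right hu hcv hcv, fracForm_smul_self, fracForm_smul_left, fracForm_smul_right,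
    fracForm_comm α v u]
  ring

lemma fracForm_self_nonneg {α : ℝ} (hα : α ∈ Ioo (0 : ℝ) 1) (u : R3 → ℝ) :
    0 ≤ fracForm α u u := by
  rw [fracForm_self_eq]
  exact mul_nonneg (by linarith [fracConst_pos hα]) (integral_nonneg fun z => sq_nonneg _)

lemma fracForm_comp_contraction_le {α : ℝ} (hα : α ∈ Ioo (0 : ℝ) 1) {u : R3 → ℝ}
    (hu : MemG α u) {g : ℝ → ℝ} (hg : LipschitzWith 1 g) :
    fracForm α (g ∘ u) (g ∘ u) ≤ fracForm α u u := by
  have h := hu.comp_contraction hg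
  rw [fracForm_self_eq, fracForm_self_eq]
  refine mul_le_mul_of_nonneg_left ?_ (by linarith [fracConst_pos hα])
  refine integral_mono (by simpa only [sq] using h.integrable_mul h)
    (by simpa only [sq] using hu.integrable_mul hu) fun z => ?_
  simp only [diffQuot_sq, Function.comp_apply]
  refine div_le_div_of_nonneg_right ?_ (by positivity)
  exact sq_le_sq.2 (by simpa [Real.dist_eq] using hg.dist_le_mul (u z.1) (u z.2))

/-! ### Translations and dilations -/

/-- The translate `x ↦ u (x + a)`. -/
def translate (a : R3) (u : R3 → ℝ) : R3 → ℝ := fun x => u (x + a)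

lemma measurePreserving_translate (a : R3) :
    MeasurePreserving (fun x : R3 => x + a) volume volume :=
  measurePreserving_add_right volume a

lemma measurePreserving_translate_prod (a : R3) :
    MeasurePreserving (fun z : R3 × R3 => (z.1 + a, z.2 + a)) volume volume :=
  (measurePreserving_translate a).prod (measurePreserving_translate a)

lemma diffQuot_translate (α : ℝ) (a : R3) (u : R3 → ℝ) :
    diffQuot α (translate a u) = diffQuot α u ∘ fun z => (z.1 + a, z.2 + a) := by
  ext z; simp [diffQuot, translate]

lemma integral_translate (a : R3) (g : R3 → ℝ) : ∫ x, translate a g x = ∫ x, g x :=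
  integral_add_right_eq_self g a

lemma MemG.translate {α : ℝ} {u : R3 → ℝ} (hu : MemG α u) (a : R3) : MemG α (translate a u) :=
  ⟨hu.1.comp_measurePreserving (measurePreserving_translate a), by
    rw [diffQuot_translate]
    exact hu.2.comp_measurePreserving (measurePreserving_translate_prod a)⟩

lemma fracForm_translate (α : ℝ) (a : R3) (u v : R3 → ℝ) :
    fracForm α (translate a u) (translate a v) = fracForm α u v := by
  rw [fracForm_eq, fracForm_eq, diffQuot_translate, diffQuot_translate]
  congr 1
  have hE : MeasurableEmbedding fun z : R3 × R3 => (z.1 + a, z.2 + a) :=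
    ((Homeomorph.addRight a).prodCongr (Homeomorph.addRight a)).measurableEmbedding
  exact (measurePreserving_translate_prod a).integral_comp hE
    fun z => diffQuot α u z * diffQuot α v z

lemma MemLp.dilate {ε : ℝ} (hε : 0 < ε) {q : ENNReal} {u : R3 → ℝ} (hu : MemLp u q volume) :
    MemLp (FracSP.dilate ε u) q volume := by
  have hmap := Measure.map_addHaar_smul (volume : Measure R3) hε.ne'
  have hu' : MemLp u q (Measure.map (ε • · : R3 → R3) volume) := by
    rw [hmap]
    exact hu.smul_measure ENNReal.ofReal_ne_top
  exact hu'.comp_of_map (measurable_const_smul ε).aemeasurable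

lemma integral_dilate {ε : ℝ} (hε : 0 < ε) (g : R3 → ℝ) :
    ∫ x, dilate ε g x = (ε ^ 3)⁻¹ * ∫ x, g x := by
  have := Measure.integral_comp_smul_of_nonneg (volume : Measure R3) g ε (hR := hε.le)
  rwa [finrank_euclideanSpace_fin, smul_eq_mul] at this

/-- Makes the scaling formula for Haar measures available on the six-dimensional space of pairs. -/
instance : Measure.IsAddHaarMeasure (volume : Measure (R3 × R3)) :=
  inferInstanceAs (Measure.IsAddHaarMeasure ((volume : Measure R3).prod (volume : Measure R3)))

lemma diffQuot_dilate_mul (α : ℝ) {ε : ℝ} (hε : 0 < ε) (u v : R3 → ℝ) (z : R3 × R3) :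
    diffQuot α (dilate ε u) z * diffQuot α (dilate ε v) z
      = ε ^ (3 + 2 * α) * (diffQuot α u (ε • z) * diffQuot α v (ε • z)) := by
  rw [diffQuot_mul, diffQuot_mul]
  simp only [dilate, Prod.smul_fst, Prod.smul_snd, ← smul_sub, norm_smul, Real.norm_eq_abs,
    abs_of_pos hε, Real.mul_rpow hε.le (norm_nonneg _)]
  have : ε ^ (3 + 2 * α) ≠ 0 := (Real.rpow_pos_of_pos hε _).ne'
  rw [← mul_div_assoc, mul_div_mul_left _ _ this]

lemma MemG.dilate {α : ℝ} {ε : ℝ} (hε : 0 < ε) {u : R3 → ℝ} (hu : MemG α u) :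
    MemG α (FracSP.dilate ε u) := by
  have hm : AEStronglyMeasurable (FracSP.dilate ε u) volume :=
    hu.1.comp_quasiMeasurePreserving
      ⟨measurable_const_smul ε, by
        rw [Measure.map_addHaar_smul (volume : Measure R3) hε.ne']
        exact Measure.smul_absolutelyContinuous⟩
  refine ⟨hm, (memLp_two_iff_integrable_sq (aestronglyMeasurable_diffQuot α hm)).2 ?_⟩
  simp only [sq, diffQuot_dilate_mul α hε]
  exact ((hu.integrable_mul hu).comp_smul hε.ne').const_mul _

/-- The kernel contributes `ε^(3+2α)` and the change of variables in dimension six contributes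
`ε^(-6)`. -/
lemma fracForm_dilate (α : ℝ) {ε : ℝ} (hε : 0 < ε) (u v : R3 → ℝ) :
    fracForm α (dilate ε u) (dilate ε v) = ε ^ (2 * α) * (ε ^ 3)⁻¹ * fracForm α u v := by
  rw [fracForm_eq, fracForm_eq]
  simp only [diffQuot_dilate_mul α hε]
  have := Measure.integral_comp_smul_of_nonneg (volume : Measure (R3 × R3))
    (fun z => diffQuot α u z * diffQuot α v z) ε (hR := hε.le)
  rw [integral_const_mul, this, Module.finrank_prod, finrank_euclideanSpace_fin, smul_eq_mul,
    Real.rpow_add hε, show ε ^ (3 : ℝ) = ε ^ 3 by exact_mod_cast Real.rpow_natCast ε 3]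
  field_simp

/-! ### The fractional Sobolev inequality -/

lemma critExp_pos {α : ℝ} (hα : α ∈ Ioo (0 : ℝ) 1) : 0 < critExp α :=
  div_pos (by norm_num) (by linarith [hα.2])

lemma two_lt_critExp {α : ℝ} (hα : α ∈ Ioo (0 : ℝ) 1) : 2 < critExp α := by
  rw [critExp, lt_div_iff₀ (by linarith [hα.2])]; linarith [hα.1]

/-- With `θ = 2α/3` and `p = critExp α` this is the relation `(1 - θ) p = 2` that closes the Sobolev
inequality. -/
lemma critExp_eq_two_add {α : ℝ} (hα : α ∈ Ioo (0 : ℝ) 1) :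
    2 + critExp α * (2 * α / 3) = critExp α := by
  have : 3 - 2 * α ≠ 0 := by linarith [hα.2]
  rw [critExp]; field_simp; ring

lemma integrable_abs_rpow_iff {u : R3 → ℝ} (hu : AEStronglyMeasurable u volume) {q : ℝ}
    (hq : 0 < q) : MemLp u (ENNReal.ofReal q) volume ↔ Integrable fun x => |u x| ^ q := by
  have := integrable_norm_rpow_iff (p := ENNReal.ofReal q) hu (by simpa using hq)
    ENNReal.ofReal_ne_top
  rw [← this, ENNReal.toReal_ofReal hq.le]; rfl

lemma aemeasurable_diffQuot_section (α : ℝ) {u : R3 → ℝ} (hu : AEMeasurable u volume) (x : R3) :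
    AEMeasurable (fun y => diffQuot α u (x, y)) volume := by
  have h3 : Measurable fun y : R3 => ‖x - y‖ ^ ((3 + 2 * α) / 2) :=
    ((measurable_const.sub measurable_id).norm).pow_const _
  exact ((aemeasurable_const (b := u x)).sub hu).div h3.aemeasurable

/-- Pointwise bound behind the Sobolev inequality: Chebyshev's inequality bounds the set where `u`
is large, so that on half of a suitable ball around `x` the difference `u x - u y` is large. -/
lemma rpow_le_lintegral_diffQuot {α : ℝ} (hα : α ∈ Ioo (0 : ℝ) 1) :
    ∃ C : ℝ, 0 < C ∧ ∀ u : R3 → ℝ, AEMeasurable u volume → ∀ a : ℝ, 0 < a →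
      ∫⁻ x, ENNReal.ofReal (|u x| ^ critExp α) = ENNReal.ofReal a → ∀ x,
        ENNReal.ofReal (|u x| ^ critExp α) ≤ ENNReal.ofReal (C * a ^ (2 * α / 3)) *
          ∫⁻ y, ENNReal.ofReal (diffQuot α u (x, y) ^ 2) := by
  set p := critExp α with hp
  have hp0 : 0 < p := critExp_pos hα
  set ω := (volume (Metric.ball (0 : R3) 1)).toReal with hω
  have hω0 : 0 < ω := ENNReal.toReal_pos (Metric.measure_ball_pos _ _ one_pos).ne'
    measure_ball_lt_top.ne
  have hωE : volume (Metric.ball (0 : R3) 1) = ENNReal.ofReal ω :=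
    (ENNReal.ofReal_toReal measure_ball_lt_top.ne).symm
  refine ⟨4 * 2 ^ (p * (2 * α / 3)) * (2 / ω) ^ (1 + 2 * α / 3), by positivity, ?_⟩
  intro u hu a ha hA x
  rcases eq_or_ne (u x) 0 with hx | hx
  · simp [hx, Real.zero_rpow hp0.ne']
  set l := |u x| with hl
  have hl0 : 0 < l := abs_pos.2 hx
  -- `M` is Chebyshev's bound for the volume of the set where `|u| ≥ l/2`. The radius `R` gives the
  -- ball volume `2M`, so a part of measure at least `M` remains where `|u| < l/2`.
  set M := (2 / l) ^ p * a with hM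
  have hM0 : 0 < M := by positivity
  set R := (2 * M / ω) ^ (1 / 3 : ℝ) with hR
  have hR0 : 0 < R := by positivity
  have hR3 : R ^ 3 = 2 * M / ω := by
    rw [hR, ← Real.rpow_natCast, ← Real.rpow_mul (by positivity)]; norm_num
  have hball : volume (Metric.ball x R) = ENNReal.ofReal (2 * M) := by
    rw [Measure.addHaar_ball_of_pos _ _ hR0, finrank_euclideanSpace_fin, hR3, hωE,
      ← ENNReal.ofReal_mul (by positivity)]
    congr 1; field_simp
  set S : Set R3 := {y | ENNReal.ofReal ((l / 2) ^ p) ≤ ENNReal.ofReal (|u y| ^ p)} with hS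
  have hum : AEMeasurable (fun y => ENNReal.ofReal (|u y| ^ p)) volume :=
    ((hu.norm.pow_const p)).ennreal_ofReal
  have hSle : volume S ≤ ENNReal.ofReal M := by
    have h := mul_meas_ge_le_lintegral₀ hum (ENNReal.ofReal ((l / 2) ^ p))
    rw [hA] at h
    have hc : 0 < (l / 2) ^ p := by positivity
    have : ENNReal.ofReal M = ENNReal.ofReal a / ENNReal.ofReal ((l / 2) ^ p) := by
      rw [← ENNReal.ofReal_div_of_pos hc, hM, show 2 / l = (l / 2)⁻¹ by rw [inv_div],
        Real.inv_rpow (by positivity)]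
      congr 1; field_simp
    rw [this, ENNReal.le_div_iff_mul_le (Or.inl (by simpa using hc))
      (Or.inl ENNReal.ofReal_ne_top), mul_comm]
    exact h
  -- On that part `|u x - u y| > l/2` and `‖x - y‖ ≤ R`, so `c` bounds the squared quotient from
  -- below.
  set c := l ^ 2 / 4 / R ^ (3 + 2 * α) with hc
  set T : Set R3 := {y | ENNReal.ofReal c ≤ ENNReal.ofReal (diffQuot α u (x, y) ^ 2)} with hT
  have hcover : Metric.ball x R ⊆ T ∪ S := by
    intro y hy
    by_cases hyS : y ∈ S
    · exact Or.inr hyS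
    refine Or.inl (ENNReal.ofReal_le_ofReal ?_)
    have hlt : |u y| < l / 2 := by
      by_contra! hcon
      exact hyS (ENNReal.ofReal_le_ofReal (Real.rpow_le_rpow (by positivity) hcon hp0.le))
    have hdiff : l / 2 < |u x - u y| := by
      have := abs_sub_abs_le_abs_sub (u x) (u y); linarith
    have hxy : x ≠ y := by rintro rfl; simp at hdiff; linarith
    have hn : 0 < ‖x - y‖ := norm_pos_iff.2 (sub_ne_zero.2 hxy)
    have hnR : ‖x - y‖ ≤ R := by
      rw [← dist_eq_norm, dist_comm]; exact (Metric.mem_ball.1 hy).le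
    rw [diffQuot_sq, hc]
    have h1 : l ^ 2 / 4 ≤ (u x - u y) ^ 2 := by
      rw [← sq_abs (u x - u y)]; nlinarith
    have h2 : ‖x - y‖ ^ (3 + 2 * α) ≤ R ^ (3 + 2 * α) :=
      Real.rpow_le_rpow hn.le hnR (by linarith [hα.1])
    exact div_le_div₀ (sq_nonneg _) h1 (by positivity) h2
  have hTM : ENNReal.ofReal M ≤ volume T := by
    have h := (measure_mono hcover).trans (measure_union_le (μ := volume) T S)
    rw [hball, two_mul, ENNReal.ofReal_add hM0.le hM0.le] at h
    exact (ENNReal.add_le_add_iff_right ENNReal.ofReal_ne_top).1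
      (h.trans (add_le_add_right hSle _))
  have hdm : AEMeasurable (fun y => ENNReal.ofReal (diffQuot α u (x, y) ^ 2)) volume := by
    exact ((aemeasurable_diffQuot_section α hu x).pow_const 2).ennreal_ofReal
  have hlow : ENNReal.ofReal (c * M) ≤ ∫⁻ y, ENNReal.ofReal (diffQuot α u (x, y) ^ 2) := by
    rw [ENNReal.ofReal_mul (by positivity)]
    exact (mul_le_mul_right hTM _).trans (mul_meas_ge_le_lintegral₀ hdm (ENNReal.ofReal c))
  refine le_trans ?_ (mul_le_mul_right hlow _)
  rw [← ENNReal.ofReal_mul (by positivity)]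
  refine ENNReal.ofReal_le_ofReal (le_of_eq ?_)
  -- As `R^(3+2α)` is a multiple of `M^(1+θ)`, the lower bound `c M` is a multiple of `l² M^(-θ)`,
  -- hence of `l^(2+pθ) a^(-θ) = l^p a^(-θ)`.
  set θ := 2 * α / 3 with hθ
  have hRθ : R ^ (3 + 2 * α) = (2 / ω) ^ (1 + θ) * M ^ (1 + θ) := by
    rw [hR, ← Real.rpow_mul (by positivity), ← Real.mul_rpow (by positivity) hM0.le]
    congr 1
    · ring
    · rw [hθ]; ring
  have hMθ : M ^ (1 + θ) = M * ((2 ^ (p * θ) / l ^ (p * θ)) * a ^ θ) := by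
    rw [Real.rpow_add hM0, Real.rpow_one]
    congr 1
    rw [hM, Real.mul_rpow (by positivity) ha.le, ← Real.rpow_mul (by positivity),
      Real.div_rpow (by norm_num) hl0.le]
  have hlp : l ^ p = l ^ 2 * l ^ (p * θ) := by
    conv_lhs => rw [hp, ← critExp_eq_two_add hα]
    rw [Real.rpow_add hl0]; norm_num [hp, hθ]
  rw [hc, hRθ, hMθ, hlp]
  have h1 : (0 : ℝ) < 2 ^ (p * θ) := by positivity
  have h2 : 0 < l ^ (p * θ) := by positivity
  have h3 : 0 < a ^ θ := by positivity
  have h4 : 0 < (2 / ω) ^ (1 + θ) := by positivity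
  field_simp

lemma MemG.lintegral_diffQuot {α : ℝ} {u : R3 → ℝ} (hu : MemG α u) :
    ∫⁻ x, ∫⁻ y, ENNReal.ofReal (diffQuot α u (x, y) ^ 2)
      = ENNReal.ofReal (∫ z, diffQuot α u z ^ 2) := by
  have hi : Integrable fun z => diffQuot α u z ^ 2 := by
    simpa only [sq] using hu.integrable_mul hu
  rw [ofReal_integral_eq_lintegral_ofReal hi (ae_of_all _ fun z => sq_nonneg _)]
  exact (lintegral_prod _ hi.aestronglyMeasurable.aemeasurable.ennreal_ofReal).symm

/-- Integrating the pointwise bound in `x` gives `a ≤ C' a^θ fracForm α u u` for `a = ∫ |u|^p`.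
Dividing by `a^θ` requires `a` to be finite, which is why integrability is assumed here;
`MemH.integrable_critExp` removes it by truncation. -/
lemma sobolev_inequality {α : ℝ} (hα : α ∈ Ioo (0 : ℝ) 1) :
    ∃ C : ℝ, 0 < C ∧ ∀ u : R3 → ℝ, MemG α u → Integrable (fun x => |u x| ^ critExp α) →
      ∫ x, |u x| ^ critExp α ≤ C * fracForm α u u ^ (critExp α / 2) := by
  obtain ⟨C, hC, h⟩ := rpow_le_lintegral_diffQuot hα
  have hk := fracConst_pos hα
  set p := critExp α with hp
  have hp0 : 0 < p := critExp_pos hα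
  refine ⟨(C * (2 / fracConst α)) ^ (p / 2), by positivity, fun u hu hi => ?_⟩
  have hN := fracForm_self_nonneg hα u
  rcases (integral_nonneg (f := fun x => |u x| ^ p)
    (fun x => by positivity)).eq_or_lt' with h0 | ha
  · rw [h0]; positivity
  set a := ∫ x, |u x| ^ p with hadef
  have hA : ∫⁻ x, ENNReal.ofReal (|u x| ^ p) = ENNReal.ofReal a :=
    (ofReal_integral_eq_lintegral_ofReal hi (ae_of_all _ fun z => by positivity)).symm
  have h1 := lintegral_mono (μ := volume) (h u hu.1.aemeasurable a ha hA)
  rw [lintegral_const_mul' _ _ ENNReal.ofReal_ne_top, hA, hu.lintegral_diffQuot,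
    ← ENNReal.ofReal_mul (by positivity)] at h1
  have hg0 : 0 ≤ ∫ z, diffQuot α u z ^ 2 := integral_nonneg fun z => sq_nonneg _
  have h2 := (ENNReal.ofReal_le_ofReal_iff (by positivity)).1 h1
  have hform : ∫ z, diffQuot α u z ^ 2 = 2 / fracConst α * fracForm α u u := by
    rw [fracForm_self_eq]; field_simp
  rw [hform] at h2
  set θ := 2 * α / 3 with hθ
  have h3 : a ^ (1 - θ) ≤ C * (2 / fracConst α) * fracForm α u u := by
    rw [Real.rpow_sub ha, Real.rpow_one, div_le_iff₀ (by positivity)]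
    linarith
  have hθp : (1 - θ) * (p / 2) = 1 := by
    have := critExp_eq_two_add hα
    rw [← hp, ← hθ] at this; linarith
  calc a = (a ^ (1 - θ)) ^ (p / 2) := by rw [← Real.rpow_mul ha.le, hθp, Real.rpow_one]
    _ ≤ (C * (2 / fracConst α) * fracForm α u u) ^ (p / 2) :=
        Real.rpow_le_rpow (by positivity) h3 (by positivity)
    _ = _ := Real.mul_rpow (by positivity) hN

lemma lipschitzWith_clip (k : ℝ) : LipschitzWith 1 fun x : ℝ => max (-k) (min k x) :=
  (LipschitzWith.id.const_min k).const_max (-k)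

lemma MemH.integrable_sq {α : ℝ} {u : R3 → ℝ} (hu : MemH α u) : Integrable fun x => u x ^ 2 :=
  hu.1.integrable_sq

/-- The Sobolev embedding `H^α ⊂ L^{2_α^*}`. -/
lemma MemH.integrable_critExp {α : ℝ} (hα : α ∈ Ioo (0 : ℝ) 1) {u : R3 → ℝ} (hu : MemH α u) :
    Integrable fun x => |u x| ^ critExp α := by
  obtain ⟨C, hC, h⟩ := sobolev_inequality hα
  set p := critExp α with hp
  have hp2 : 2 < p := two_lt_critExp hα
  have hG := hu.memG
  have hN := fracForm_self_nonneg hα u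
  -- Truncations at height `k` are bounded and square integrable, hence in `L^p`, and truncating
  -- does not increase the form. The Sobolev bound is therefore uniform in `k`, and Fatou's lemma
  -- carries it to `u`.
  let v : ℕ → R3 → ℝ := fun k => (fun x : ℝ => max (-(k : ℝ)) (min (k : ℝ) x)) ∘ u
  have hvk : ∀ k x, |v k x| ≤ k ∧ |v k x| ≤ |u x| := by
    intro k x
    have hk : (0 : ℝ) ≤ k := k.cast_nonneg
    refine ⟨abs_le.2 ⟨le_max_left _ _, max_le (by linarith) (min_le_left _ _)⟩, ?_⟩
    have := (lipschitzWith_clip k).dist_le_mul (u x) 0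
    simpa [Real.dist_eq, hk, v] using this
  have hvG : ∀ k, MemG α (v k) := fun k => hG.comp_contraction (lipschitzWith_clip k)
  have hvi : ∀ k, Integrable fun x => |v k x| ^ p := by
    intro k
    refine (hu.integrable_sq.const_mul ((k : ℝ) ^ (p - 2))).mono'
      ((hvG k).1.aemeasurable.norm.pow_const p).aestronglyMeasurable (ae_of_all _ fun x => ?_)
    rw [Real.norm_of_nonneg (by positivity)]
    have e : |v k x| ^ p = |v k x| ^ (p - 2) * |v k x| ^ 2 := by
      rcases eq_or_lt_of_le (abs_nonneg (v k x)) with h0 | h0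
      · rw [← h0, Real.zero_rpow (by linarith)]; simp
      · rw [← Real.rpow_natCast, ← Real.rpow_add h0]; norm_num
    rw [e, ← sq_abs (u x)]
    exact mul_le_mul (Real.rpow_le_rpow (abs_nonneg _) (hvk k x).1 (by linarith))
      (pow_le_pow_left₀ (abs_nonneg _) (hvk k x).2 2) (by positivity) (by positivity)
  have hbound : ∀ k, ∫⁻ x, ENNReal.ofReal (|v k x| ^ p)
      ≤ ENNReal.ofReal (C * fracForm α u u ^ (p / 2)) := by
    intro k
    rw [← ofReal_integral_eq_lintegral_ofReal (hvi k) (ae_of_all _ fun z => by positivity)]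
    refine ENNReal.ofReal_le_ofReal ((h _ (hvG k) (hvi k)).trans ?_)
    have h0 := fracForm_self_nonneg hα (v k)
    have h1 := fracForm_comp_contraction_le hα hG (lipschitzWith_clip k)
    gcongr
  have hlim : ∀ x, liminf (fun k => ENNReal.ofReal (|v k x| ^ p)) atTop
      = ENNReal.ofReal (|u x| ^ p) := by
    intro x
    refine (tendsto_const_nhds.congr' ?_).liminf_eq
    filter_upwards [eventually_ge_atTop ⌈|u x|⌉₊] with k hk
    have hk' := abs_le.1 (Nat.ceil_le.1 hk)
    have : v k x = u x := by
      simp only [v, Function.comp_apply]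
      rw [min_eq_right hk'.2, max_eq_right hk'.1]
    rw [this]
  have hfin : ∫⁻ x, ENNReal.ofReal (|u x| ^ p) ≤ ENNReal.ofReal (C * fracForm α u u ^ (p / 2)) := by
    simp_rw [← hlim]
    refine (lintegral_liminf_le' fun k =>
      ((hvG k).1.aemeasurable.norm.pow_const p).ennreal_ofReal).trans ?_
    refine (liminf_le_liminf (Eventually.of_forall hbound)).trans ?_
    rw [liminf_const]
  refine ⟨(hG.1.aemeasurable.norm.pow_const p).aestronglyMeasurable, ?_⟩
  rw [hasFiniteIntegral_iff_ofReal (ae_of_all _ fun z => by positivity)]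
  exact hfin.trans_lt ENNReal.ofReal_lt_top

lemma MemD.integrable_critExp {α : ℝ} (hα : α ∈ Ioo (0 : ℝ) 1) {u : R3 → ℝ} (hu : MemD α u) :
    Integrable fun x => |u x| ^ critExp α :=
  (integrable_abs_rpow_iff hu.1.1 (critExp_pos hα)).1 hu.1

/-! ### Cone functions -/

/-- The cone of height and radius `ρ` centred at `x₀`. -/
def cone (x₀ : R3) (ρ : ℝ) (x : R3) : ℝ := max 0 (ρ - ‖x - x₀‖)

lemma cone_nonneg (x₀ : R3) (ρ : ℝ) (x : R3) : 0 ≤ cone x₀ ρ x := le_max_left _ _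

lemma cone_pos {x₀ : R3} {ρ : ℝ} {x : R3} (hx : x ∈ Metric.ball x₀ ρ) : 0 < cone x₀ ρ x := by
  rw [Metric.mem_ball, dist_eq_norm] at hx
  exact lt_max_of_lt_right (by linarith)

lemma cone_eq_zero {x₀ : R3} {ρ : ℝ} {x : R3} (hx : x ∉ Metric.ball x₀ ρ) : cone x₀ ρ x = 0 := by
  rw [Metric.mem_ball, dist_eq_norm, not_lt] at hx
  exact max_eq_left (by linarith)

lemma continuous_cone (x₀ : R3) (ρ : ℝ) : Continuous (cone x₀ ρ) := by
  unfold cone; fun_prop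

lemma cone_le {x₀ : R3} {ρ : ℝ} (hρ : 0 ≤ ρ) (x : R3) : cone x₀ ρ x ≤ ρ :=
  max_le hρ (by linarith [norm_nonneg (x - x₀)])

lemma abs_cone_sub_le (x₀ : R3) (ρ : ℝ) (x y : R3) :
    |cone x₀ ρ x - cone x₀ ρ y| ≤ ‖x - y‖ := by
  have h1 := abs_max_sub_max_le_abs (ρ - ‖x - x₀‖) (ρ - ‖y - x₀‖) 0
  rw [max_comm, max_comm _ (0 : ℝ)] at h1
  refine h1.trans ?_
  have := abs_norm_sub_norm_le (y - x₀) (x - x₀)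
  rw [sub_sub_sub_cancel_right] at this
  rw [sub_sub_sub_cancel_left, norm_sub_rev x y]
  exact this

/-- The increments are at most `min(ρ, |x - y|)` and vanish unless one of the two points lies in the
ball. Up to the factor `1 + ρ²` the integrand is thus bounded by `(χ(x) + χ(y)) k(x - y)`, with `χ`
the indicator of the ball and `k` the truncated kernel. -/
lemma memH_cone {α : ℝ} (hα : α ∈ Ioo (0 : ℝ) 1) (x₀ : R3) {ρ : ℝ} (hρ : 0 ≤ ρ) :
    MemH α (cone x₀ ρ) := by
  have hcont := continuous_cone x₀ ρ
  refine ⟨?_, ?_⟩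
  · refine hcont.memLp_of_hasCompactSupport (HasCompactSupport.of_support_subset_isCompact
      (isCompact_closedBall x₀ ρ) fun x hx => ?_)
    by_contra hxb
    exact hx (cone_eq_zero fun h => hxb (Metric.ball_subset_closedBall h))
  · set k : R3 → ℝ := fun h => min 1 (‖h‖ ^ 2) / ‖h‖ ^ (3 + 2 * α) with hk
    have hkn : ∀ h, 0 ≤ k h := fun h => div_nonneg (le_min zero_le_one (sq_nonneg _)) (by positivity)
    set χ : R3 → ℝ := (Metric.ball x₀ ρ).indicator fun _ => (1 : ℝ) with hχ
    have hχi : Integrable χ := (integrable_indicator_iff measurableSet_ball).2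
      (integrableOn_const measure_ball_lt_top.ne)
    have h1 : Integrable (fun z : R3 × R3 => χ z.2 * k (z.1 - z.2)) volume :=
      hχi.convolution_integrand (ContinuousLinearMap.mul ℝ ℝ) (integrable_truncated_kernel hα)
    have h2 : Integrable (fun z : R3 × R3 => χ z.1 * k (z.2 - z.1)) volume := h1.swap
    refine ((h1.add h2).const_mul (1 + ρ ^ 2)).mono' ?_ (ae_of_all _ fun z => ?_)
    · have h3 : Measurable fun z : R3 × R3 => ‖z.1 - z.2‖ ^ (3 + 2 * α) :=
        ((measurable_fst.sub measurable_snd).norm).pow_const _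
      refine (Measurable.div ?_ h3).aestronglyMeasurable
      exact (Continuous.pow ((hcont.comp continuous_fst).sub
        (hcont.comp continuous_snd)) 2).measurable
    · rw [Real.norm_of_nonneg (by positivity)]
      have hsymm : k (z.2 - z.1) = k (z.1 - z.2) := by simp only [hk, norm_sub_rev z.2 z.1]
      simp only [Pi.add_apply, hsymm, ← add_mul]
      have hχ1 : ∀ x ∈ Metric.ball x₀ ρ, χ x = 1 := fun x hx => indicator_of_mem hx _
      have hχ0 : ∀ x, 0 ≤ χ x := fun x => indicator_nonneg (fun _ _ => zero_le_one) _
      by_cases hz : z.1 ∈ Metric.ball x₀ ρ ∨ z.2 ∈ Metric.ball x₀ ρ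
      · have hge : 1 ≤ χ z.2 + χ z.1 := by
          rcases hz with h | h
          · linarith [hχ1 _ h, hχ0 z.2]
          · linarith [hχ1 _ h, hχ0 z.1]
        have hb : (cone x₀ ρ z.1 - cone x₀ ρ z.2) ^ 2
            ≤ (1 + ρ ^ 2) * min 1 (‖z.1 - z.2‖ ^ 2) := by
          have e1 : (cone x₀ ρ z.1 - cone x₀ ρ z.2) ^ 2 ≤ ‖z.1 - z.2‖ ^ 2 := by
            rw [← sq_abs]
            exact pow_le_pow_left₀ (abs_nonneg _) (abs_cone_sub_le x₀ ρ _ _) 2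
          have e2 : (cone x₀ ρ z.1 - cone x₀ ρ z.2) ^ 2 ≤ ρ ^ 2 := by
            refine sq_le_sq' ?_ ?_ <;>
            linarith [cone_nonneg x₀ ρ z.1, cone_nonneg x₀ ρ z.2,
              cone_le (x₀ := x₀) hρ z.1, cone_le (x₀ := x₀) hρ z.2]
          rcases min_cases 1 (‖z.1 - z.2‖ ^ 2) with h | h <;> rw [h.1] <;>
            nlinarith [sq_nonneg ρ, sq_nonneg ‖z.1 - z.2‖]
        calc _ ≤ (1 + ρ ^ 2) * k (z.1 - z.2) := by
              rw [hk, ← mul_div_assoc]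
              exact div_le_div_of_nonneg_right hb (by positivity)
          _ ≤ _ := by
              refine mul_le_mul_of_nonneg_left ?_ (by positivity)
              exact le_mul_of_one_le_left (hkn _) hge
      · push Not at hz
        rw [cone_eq_zero hz.1, cone_eq_zero hz.2]
        simp only [sub_zero, zero_pow two_ne_zero, zero_div]
        have := hkn (z.1 - z.2)
        have := hχ0 z.1
        have := hχ0 z.2
        positivity

/-! ### The fractional Poisson equation -/

lemma MemD.add {t : ℝ} {u v : R3 → ℝ} (hu : MemD t u) (hv : MemD t v) : MemD t (u + v) :=
  ⟨hu.1.add hv.1, (hu.memG.add hv.memG).finiteSeminorm⟩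

lemma MemD.smul {t : ℝ} {u : R3 → ℝ} (hu : MemD t u) (c : ℝ) : MemD t (c • u) :=
  ⟨hu.1.const_smul c, (hu.memG.smul c).finiteSeminorm⟩

lemma MemD.sub {t : ℝ} {u v : R3 → ℝ} (hu : MemD t u) (hv : MemD t v) : MemD t (u - v) :=
  ⟨hu.1.sub hv.1, (hu.memG.sub hv.memG).finiteSeminorm⟩

lemma memD_zero (t : ℝ) : MemD t 0 := by
  refine ⟨MemLp.zero, ?_⟩
  simp [FiniteSeminorm]

lemma MemD.translate {t : ℝ} {u : R3 → ℝ} (hu : MemD t u) (a : R3) : MemD t (translate a u) :=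
  ⟨hu.1.comp_measurePreserving (measurePreserving_translate a),
    (hu.memG.translate a).finiteSeminorm⟩

lemma MemD.dilate {t ε : ℝ} (hε : 0 < ε) {u : R3 → ℝ} (hu : MemD t u) :
    MemD t (FracSP.dilate ε u) :=
  ⟨MemLp.dilate hε hu.1, (hu.memG.dilate hε).finiteSeminorm⟩

/-- The exponent dual to `2_t^*`. -/
def dualExp (t : ℝ) : ℝ := 6 / (3 + 2 * t)

lemma dualExp_pos {t : ℝ} (ht : t ∈ Ioo (0 : ℝ) 1) : 0 < dualExp t :=
  div_pos (by norm_num) (by linarith [ht.1])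

lemma holderConjugate_dualExp {t : ℝ} (ht : t ∈ Ioo (0 : ℝ) 1) :
    (dualExp t).HolderConjugate (critExp t) := by
  have h1 : 0 < 3 + 2 * t := by linarith [ht.1]
  have h2 : 0 < 3 - 2 * t := by linarith [ht.2]
  refine Real.holderConjugate_iff.2 ⟨?_, ?_⟩
  · rw [dualExp, lt_div_iff₀ h1]; linarith [ht.2]
  · rw [dualExp, critExp]; field_simp; ring

/-- Densities in the dual Lebesgue space act boundedly on `D^{t,2}`. -/
lemma abs_integral_mul_le {t : ℝ} (ht : t ∈ Ioo (0 : ℝ) 1) :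
    ∃ C : ℝ, 0 < C ∧ ∀ g ψ : R3 → ℝ, AEStronglyMeasurable g volume →
      Integrable (fun x => |g x| ^ dualExp t) → MemD t ψ →
      Integrable (fun x => g x * ψ x) ∧
      |∫ x, g x * ψ x| ≤ C * (∫ x, |g x| ^ dualExp t) ^ (1 / dualExp t) *
        Real.sqrt (fracForm t ψ ψ) := by
  obtain ⟨C, hC, h⟩ := sobolev_inequality ht
  have hpq := holderConjugate_dualExp ht
  have hp0 := critExp_pos ht
  refine ⟨C ^ (1 / critExp t), by positivity, fun g ψ hg hgi hψ => ?_⟩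
  have hN := fracForm_self_nonneg ht ψ
  have hψi := hψ.integrable_critExp ht
  have hgL : MemLp g (ENNReal.ofReal (dualExp t)) volume :=
    (integrable_abs_rpow_iff hg (dualExp_pos ht)).2 hgi
  have hhold := hpq.ennrealOfReal
  refine ⟨hgL.integrable_mul hψ.1, ?_⟩
  have h1 := integral_mul_le_Lp_mul_Lq_of_nonneg hpq (μ := (volume : Measure R3))
    (f := fun x => |g x|) (g := fun x => |ψ x|) (ae_of_all _ fun x => abs_nonneg _)
    (ae_of_all _ fun x => abs_nonneg _) hgL.norm hψ.1.norm
  calc |∫ x, g x * ψ x| ≤ ∫ x, |g x| * |ψ x| := by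
        simpa only [abs_mul] using abs_integral_le_integral_abs (f := fun x => g x * ψ x)
    _ ≤ (∫ x, |g x| ^ dualExp t) ^ (1 / dualExp t) *
          (∫ x, |ψ x| ^ critExp t) ^ (1 / critExp t) := h1
    _ ≤ (∫ x, |g x| ^ dualExp t) ^ (1 / dualExp t) *
          (C * fracForm t ψ ψ ^ (critExp t / 2)) ^ (1 / critExp t) := by
        refine mul_le_mul_of_nonneg_left ?_ (Real.rpow_nonneg
          (integral_nonneg fun x => by positivity) _)
        exact Real.rpow_le_rpow (integral_nonneg fun x => by positivity) (h ψ hψ.memG hψi)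
          (by positivity)
    _ = _ := by
        rw [Real.mul_rpow hC.le (by positivity), ← Real.rpow_mul hN, Real.sqrt_eq_rpow]
        have : critExp t / 2 * (1 / critExp t) = 1 / 2 := by field_simp
        rw [this]; ring

lemma MemD.ae_eq_zero {t : ℝ} (ht : t ∈ Ioo (0 : ℝ) 1) {u : R3 → ℝ} (hu : MemD t u)
    (h : fracForm t u u = 0) : u =ᵐ[volume] 0 := by
  obtain ⟨C, hC, hS⟩ := sobolev_inequality ht
  have hp0 := critExp_pos ht
  have hi := hu.integrable_critExp ht
  have h1 := hS u hu.memG hi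
  rw [h, Real.zero_rpow (by positivity), mul_zero] at h1
  have h2 := (integral_eq_zero_iff_of_nonneg (fun x => by positivity) hi).1
    (le_antisymm h1 (integral_nonneg fun x => by positivity))
  filter_upwards [h2] with x hx
  simpa using ((Real.rpow_eq_zero_iff_of_nonneg (abs_nonneg _)).1 hx).1

/-- The space of difference quotients of functions in `D^{t,2}`, inside `L²(ℝ³ × ℝ³)`. -/
def diffQuotSpace (t : ℝ) : Submodule ℝ (Lp ℝ 2 (volume : Measure (R3 × R3))) where
  carrier := {U | ∃ u, MemD t u ∧ U =ᵐ[volume] diffQuot t u}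
  add_mem' := by
    rintro U V ⟨u, hu, hU⟩ ⟨v, hv, hV⟩
    refine ⟨u + v, hu.add hv, (Lp.coeFn_add U V).trans ?_⟩
    rw [diffQuot_add]; exact hU.add hV
  zero_mem' := by
    refine ⟨0, memD_zero t, (Lp.coeFn_zero _ _ _).trans ?_⟩
    refine ae_of_all _ fun z => ?_
    simp [diffQuot]
  smul_mem' := by
    rintro c U ⟨u, hu, hU⟩
    refine ⟨c • u, hu.smul c, (Lp.coeFn_smul c U).trans ?_⟩
    rw [diffQuot_smul]; exact hU.const_smul c

lemma fracForm_eq_inner {t : ℝ} {u v : R3 → ℝ} {U V : Lp ℝ 2 (volume : Measure (R3 × R3))}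
    (hU : U =ᵐ[volume] diffQuot t u) (hV : V =ᵐ[volume] diffQuot t v) :
    fracForm t u v = fracConst t / 2 * inner ℝ U V := by
  rw [fracForm_eq, L2.inner_def]
  congr 1
  refine integral_congr_ae ?_
  filter_upwards [hU, hV] with z h1 h2
  rw [h1, h2]
  simp [mul_comm]

/-- By the Sobolev inequality, convergence of the quotients in `L²` makes the functions themselves
Cauchy in `L^(2_t^*)`. Along a common subsequence both converge almost everywhere, which identifies
the limit as the quotient of the limit function. The resulting completeness is what the Riesz
representation needs. -/
lemma isClosed_diffQuotSpace {t : ℝ} (ht : t ∈ Ioo (0 : ℝ) 1) :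
    IsClosed (diffQuotSpace t : Set (Lp ℝ 2 (volume : Measure (R3 × R3)))) := by
  obtain ⟨C, hC, hS⟩ := sobolev_inequality ht
  have hp0 := critExp_pos ht
  have hp2 := two_lt_critExp ht
  have hk := fracConst_pos ht
  have hfact : Fact (1 ≤ ENNReal.ofReal (critExp t)) :=
    ⟨by rw [← ENNReal.ofReal_one]; exact ENNReal.ofReal_le_ofReal (by linarith)⟩
  refine IsSeqClosed.isClosed fun U U₀ hU hlim => ?_
  choose u hu hUu using hU
  let v : ℕ → Lp ℝ (ENNReal.ofReal (critExp t)) (volume : Measure R3) :=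
    fun n => (hu n).1.toLp (u n)
  have hdist : ∀ m n, dist (v m) (v n)
      ≤ (C ^ (1 / critExp t) * (fracConst t / 2) ^ (1 / 2 : ℝ)) * dist (U m) (U n) := by
    intro m n
    have hd := (hu m).sub (hu n)
    have hi := hd.integrable_critExp ht
    have e1 : dist (v m) (v n)
        = (∫ x, |(u m - u n) x| ^ critExp t) ^ (1 / critExp t) := by
      rw [dist_eq_norm, ← MemLp.toLp_sub, Lp.norm_toLp,
        hd.1.eLpNorm_eq_integral_rpow_norm (by simpa using hp0) ENNReal.ofReal_ne_top,
        ENNReal.toReal_ofReal hp0.le, ENNReal.toReal_ofReal (Real.rpow_nonneg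
          (integral_nonneg fun x => by positivity) _), one_div]
      rfl
    have hUd : (U m - U n : Lp ℝ 2 (volume : Measure (R3 × R3)))
        =ᵐ[volume] diffQuot t (u m - u n) := by
      rw [diffQuot_sub]
      exact (Lp.coeFn_sub _ _).trans ((hUu m).sub (hUu n))
    have e2 : fracForm t (u m - u n) (u m - u n) = fracConst t / 2 * dist (U m) (U n) ^ 2 := by
      rw [fracForm_eq_inner hUd hUd, real_inner_self_eq_norm_sq, dist_eq_norm]
    have h3 := hS _ hd.memG hi
    rw [e2] at h3
    rw [e1]
    have hd0 : 0 ≤ dist (U m) (U n) := dist_nonneg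
    calc _ ≤ (C * (fracConst t / 2 * dist (U m) (U n) ^ 2) ^ (critExp t / 2))
            ^ (1 / critExp t) :=
          Real.rpow_le_rpow (integral_nonneg fun x => by positivity) h3 (by positivity)
      _ = _ := by
          rw [Real.mul_rpow hC.le (by positivity), ← Real.rpow_mul (by positivity),
            show critExp t / 2 * (1 / critExp t) = 1 / 2 by field_simp,
            Real.mul_rpow (by positivity) (by positivity), ← Real.sqrt_eq_rpow (_ ^ 2),
            Real.sqrt_sq hd0, mul_assoc]
  have hcauchy : CauchySeq v := by
    have hc := hlim.cauchySeq
    refine Metric.cauchySeq_iff'.2 fun δ hδ => ?_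
    set B := C ^ (1 / critExp t) * (fracConst t / 2) ^ (1 / 2 : ℝ) with hB
    have hB0 : 0 < B := by positivity
    obtain ⟨N, hN⟩ := Metric.cauchySeq_iff'.1 hc (δ / B) (by positivity)
    refine ⟨N, fun n hn => (hdist n N).trans_lt ?_⟩
    have := hN n hn
    rwa [lt_div_iff₀ hB0, mul_comm] at this
  obtain ⟨v₀, hv₀⟩ := cauchySeq_tendsto_of_complete hcauchy
  obtain ⟨σ, hσ, hσlim⟩ := (tendstoInMeasure_of_tendsto_Lp hv₀).exists_seq_tendsto_ae
  obtain ⟨σ', hσ', hσ'lim⟩ := (tendstoInMeasure_of_tendsto_Lp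
    (hlim.comp hσ.tendsto_atTop)).exists_seq_tendsto_ae
  have hu_lim : ∀ᵐ x, Tendsto (fun n => u (σ (σ' n)) x) atTop (𝓝 (v₀ x)) := by
    have hv : ∀ᵐ x, ∀ n, v n x = u n x := ae_all_iff.2 fun n => MemLp.coeFn_toLp _
    filter_upwards [hσlim, hv] with x hx hxv
    simp only [hxv] at hx
    exact hx.comp hσ'.tendsto_atTop
  have hU_lim : U₀ =ᵐ[volume] diffQuot t v₀ := by
    have hU' : ∀ᵐ z, ∀ n, U n z = diffQuot t (u n) z := ae_all_iff.2 hUu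
    filter_upwards [ae_prod_of_ae hu_lim, hσ'lim, hU'] with z hz hz' hzU
    refine tendsto_nhds_unique hz' ?_
    simp only [Function.comp_apply, hzU]
    exact (hz.1.sub hz.2).div_const _
  refine ⟨v₀, ⟨Lp.memLp v₀, ?_⟩, hU_lim⟩
  rw [finiteSeminorm_iff (Lp.memLp v₀).1]
  exact (memLp_congr_ae hU_lim).1 (Lp.memLp U₀)

/-- Solvability of `(-Δ)^t φ = g` for `g` in the dual Lebesgue space. -/
lemma exists_weak_solution {t : ℝ} (ht : t ∈ Ioo (0 : ℝ) 1) {g : R3 → ℝ}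
    (hg : AEStronglyMeasurable g volume) (hgi : Integrable fun x => |g x| ^ dualExp t) :
    ∃ φ, MemD t φ ∧ ∀ ψ, MemD t ψ → fracForm t φ ψ = ∫ x, g x * ψ x := by
  obtain ⟨C, hC, hb⟩ := abs_integral_mul_le ht
  have hk := fracConst_pos ht
  have : CompleteSpace (diffQuotSpace t) := (isClosed_diffQuotSpace ht).completeSpace_coe
  have hrep : ∀ U : diffQuotSpace t, ∃ u, MemD t u ∧ U.1 =ᵐ[volume] diffQuot t u := fun U => U.2
  choose rep hrepD hrepU using hrep
  -- The functional does not depend on the chosen representative: two functions in `D^{t,2}` with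
  -- the same quotient agree almost everywhere.
  have hval : ∀ (U : diffQuotSpace t) (u : R3 → ℝ), MemD t u → U.1 =ᵐ[volume] diffQuot t u →
      ∫ x, g x * rep U x = ∫ x, g x * u x := by
    intro U u hu hU
    have hd := (hrepD U).sub hu
    have h0 : fracForm t (rep U - u) (rep U - u) = 0 := by
      have : (0 : Lp ℝ 2 (volume : Measure (R3 × R3))) =ᵐ[volume] diffQuot t (rep U - u) := by
        rw [diffQuot_sub]
        filter_upwards [Lp.coeFn_zero ℝ 2 (volume : Measure (R3 × R3)), hrepU U, hU] with z h1 h2 h3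
        rw [h1, Pi.sub_apply, ← h2, ← h3]; simp
      rw [fracForm_eq_inner this this]; simp
    refine integral_congr_ae ?_
    filter_upwards [hd.ae_eq_zero ht h0] with x hx
    have : rep U x = u x := by simpa [sub_eq_zero] using hx
    rw [this]
  let ℓ : diffQuotSpace t →ₗ[ℝ] ℝ :=
    { toFun := fun U => ∫ x, g x * rep U x
      map_add' := by
        intro U V
        rw [hval (U + V) (rep U + rep V) ((hrepD U).add (hrepD V)) (by
          rw [diffQuot_add]
          exact (Lp.coeFn_add _ _).trans ((hrepU U).add (hrepU V)))]
        simp only [Pi.add_apply, mul_add]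
        exact integral_add (hb g _ hg hgi (hrepD U)).1 (hb g _ hg hgi (hrepD V)).1
      map_smul' := by
        intro c U
        rw [hval (c • U) (c • rep U) ((hrepD U).smul c) (by
          rw [diffQuot_smul]
          exact (Lp.coeFn_smul _ _).trans ((hrepU U).const_smul c))]
        simp only [Pi.smul_apply, smul_eq_mul, RingHom.id_apply, mul_left_comm _ c]
        exact integral_const_mul _ _ }
  set A := C * (∫ x, |g x| ^ dualExp t) ^ (1 / dualExp t) * Real.sqrt (fracConst t / 2) with hA
  let L : diffQuotSpace t →L[ℝ] ℝ := ℓ.mkContinuous A (by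
    intro U
    refine ((hb g _ hg hgi (hrepD U)).2).trans (le_of_eq ?_)
    rw [fracForm_eq_inner (hrepU U) (hrepU U), real_inner_self_eq_norm_sq,
      Real.sqrt_mul (by positivity), Real.sqrt_sq (norm_nonneg _), hA, mul_assoc _ _ ‖U‖]
    rfl)
  set U₀ := (InnerProductSpace.toDual ℝ (diffQuotSpace t)).symm L with hU₀
  -- The factor undoes the normalization `fracConst t / 2` between the form and the `L²` inner
  -- product.
  refine ⟨(2 / fracConst t) • rep U₀, (hrepD U₀).smul _, fun ψ hψ => ?_⟩
  let Ψ : diffQuotSpace t := ⟨hψ.memG.2.toLp _, ψ, hψ, MemLp.coeFn_toLp _⟩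
  have h1 : inner ℝ U₀ Ψ = L Ψ := InnerProductSpace.toDual_symm_apply
  have hΨ : Ψ.1 =ᵐ[volume] diffQuot t ψ := MemLp.coeFn_toLp hψ.memG.2
  have h2 : inner ℝ U₀.1 Ψ.1 = ∫ x, g x * ψ x :=
    h1.trans (hval Ψ ψ hψ hΨ)
  rw [fracForm_smul_left, fracForm_eq_inner (hrepU U₀) hΨ, h2]
  field_simp

/-! ### The Coulomb energy -/

/-- Functions whose square lies in the dual Lebesgue space of `D^{t,2}`. -/
def IsSource (t : ℝ) (u : R3 → ℝ) : Prop :=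
  AEStronglyMeasurable u volume ∧ Integrable fun x => |u x ^ 2| ^ dualExp t

/-- The Coulomb energy `∫ φ_u u²`. -/
def coulomb (t : ℝ) (u : R3 → ℝ) : ℝ := ∫ x, phi t u x * u x ^ 2

lemma IsSource.aestronglyMeasurable_sq {t : ℝ} {u : R3 → ℝ} (hu : IsSource t u) :
    AEStronglyMeasurable (fun x => u x ^ 2) volume := hu.1.pow 2

lemma IsSource.isPoissonSolution_phi {t : ℝ} (ht : t ∈ Ioo (0 : ℝ) 1) {u : R3 → ℝ}
    (hu : IsSource t u) : IsPoissonSolution t 1 u (phi t u) := by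
  have h : ∃ φ, IsPoissonSolution t 1 u φ := by
    obtain ⟨φ, hφ, h⟩ := exists_weak_solution ht hu.aestronglyMeasurable_sq hu.2
    exact ⟨φ, hφ, fun ψ hψ => by rw [one_mul]; exact h ψ hψ⟩
  rw [phi, dif_pos h]
  exact h.choose_spec

lemma IsPoissonSolution.fracForm_eq {t : ℝ} {u φ ψ : R3 → ℝ} (h : IsPoissonSolution t 1 u φ)
    (hψ : MemD t ψ) : fracForm t φ ψ = ∫ x, u x ^ 2 * ψ x := by
  have := h.2 ψ hψ
  rwa [one_mul] at this

/-- The Coulomb energy may be computed with any weak solution of the Poisson equation. -/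
lemma IsPoissonSolution.coulomb_eq {t : ℝ} {u φ : R3 → ℝ} (h : IsPoissonSolution t 1 u φ) :
    coulomb t u = fracForm t φ φ := by
  have hex : ∃ φ, IsPoissonSolution t 1 u φ := ⟨φ, h⟩
  have h' : IsPoissonSolution t 1 u (phi t u) := by
    rw [phi, dif_pos hex]; exact hex.choose_spec
  -- Each solution is tested with the other one; symmetry of the form then replaces uniqueness of
  -- the solution.
  have h1 := h.fracForm_eq h'.1
  have h2 := h'.fracForm_eq h.1
  have h3 := h.fracForm_eq h.1
  rw [fracForm_comm, h1] at h2
  rw [coulomb, h3, ← h2]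
  simp only [mul_comm]

lemma IsPoissonSolution.coulomb_eq_integral {t : ℝ} {u φ : R3 → ℝ}
    (h : IsPoissonSolution t 1 u φ) : coulomb t u = ∫ x, φ x * u x ^ 2 := by
  rw [h.coulomb_eq, h.fracForm_eq h.1]; simp only [mul_comm]

lemma coulomb_nonneg {t : ℝ} (ht : t ∈ Ioo (0 : ℝ) 1) {u : R3 → ℝ} (hu : IsSource t u) :
    0 ≤ coulomb t u := by
  rw [(hu.isPoissonSolution_phi ht).coulomb_eq]; exact fracForm_self_nonneg ht _

lemma IsPoissonSolution.congr_sq {t b : ℝ} {u v φ : R3 → ℝ} (h : IsPoissonSolution t b u φ)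
    (huv : ∀ᵐ x, u x ^ 2 = v x ^ 2) : IsPoissonSolution t b v φ := by
  refine ⟨h.1, fun ψ hψ => (h.2 ψ hψ).trans (integral_congr_ae ?_)⟩
  filter_upwards [huv] with x hx
  rw [hx]

lemma coulomb_congr_sq {t : ℝ} (ht : t ∈ Ioo (0 : ℝ) 1) {u v : R3 → ℝ} (hu : IsSource t u)
    (huv : ∀ᵐ x, u x ^ 2 = v x ^ 2) : coulomb t u = coulomb t v := by
  have h := hu.isPoissonSolution_phi ht
  rw [h.coulomb_eq, (h.congr_sq huv).coulomb_eq]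

/-- The potential is quadratic in `u`, so `c ^ 2 • phi t u` solves the scaled equation. This quartic
homogeneity makes `4` the threshold exponent for the nonlinearity. -/
lemma coulomb_smul {t : ℝ} (ht : t ∈ Ioo (0 : ℝ) 1) {u : R3 → ℝ} (hu : IsSource t u) (c : ℝ) :
    coulomb t (c • u) = c ^ 4 * coulomb t u := by
  have h := hu.isPoissonSolution_phi ht
  have h' : IsPoissonSolution t 1 (c • u) (c ^ 2 • phi t u) := by
    refine ⟨h.1.smul _, fun ψ hψ => ?_⟩
    rw [one_mul, fracForm_smul_left, h.fracForm_eq hψ, ← integral_const_mul]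
    simp only [Pi.smul_apply, smul_eq_mul, mul_pow, mul_assoc]
  rw [h.coulomb_eq, h'.coulomb_eq, fracForm_smul_self]; ring

lemma coulomb_translate {t : ℝ} (ht : t ∈ Ioo (0 : ℝ) 1) {u : R3 → ℝ} (hu : IsSource t u)
    (a : R3) : coulomb t (translate a u) = coulomb t u := by
  have h := hu.isPoissonSolution_phi ht
  have h' : IsPoissonSolution t 1 (translate a u) (translate a (phi t u)) := by
    refine ⟨h.1.translate a, fun ψ hψ => ?_⟩
    have e : ψ = translate a (translate (-a) ψ) := by ext x; simp [translate]
    have e2 := h.fracForm_eq (hψ.translate (-a))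
    rw [one_mul, e, fracForm_translate, e2, ← integral_translate a]
    rfl
  rw [h.coulomb_eq, h'.coulomb_eq, fracForm_translate]

/-- Test functions are dilated back by `ε⁻¹`. The coefficient `ε^(2t)` is the factor that
`fracForm_dilate` produces besides the Jacobian. -/
lemma IsPoissonSolution.dilate {t ε : ℝ} (hε : 0 < ε) {u φ : R3 → ℝ}
    (h : IsPoissonSolution t (ε ^ (2 * t)) u φ) :
    IsPoissonSolution t 1 (FracSP.dilate ε u) (FracSP.dilate ε φ) := by
  refine ⟨h.1.dilate hε, fun ψ hψ => ?_⟩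
  have e : ψ = FracSP.dilate ε (FracSP.dilate ε⁻¹ ψ) := by
    ext x; simp [FracSP.dilate, smul_smul, hε.ne']
  have e2 := h.2 _ (hψ.dilate (inv_pos.2 hε))
  rw [one_mul, e, fracForm_dilate t hε, mul_right_comm, e2, mul_comm, ← integral_dilate hε]
  rfl

/-- Expansion of the Coulomb energy along a perturbation with disjoint support. -/
lemma coulomb_add_smul_of_mul_eq_zero {t : ℝ} (ht : t ∈ Ioo (0 : ℝ) 1) {u v : R3 → ℝ}
    (hu : IsSource t u) (hv : IsSource t v) (huv : ∀ᵐ x, u x * v x = 0) :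
    ∃ b : ℝ, ∀ δ : ℝ,
      coulomb t (u + δ • v) = coulomb t u + δ ^ 2 * b + δ ^ 4 * coulomb t v := by
  have h := hu.isPoissonSolution_phi ht
  have h' := hv.isPoissonSolution_phi ht
  obtain ⟨C, -, hb⟩ := abs_integral_mul_le ht
  refine ⟨2 * fracForm t (phi t u) (phi t v), fun δ => ?_⟩
  -- Disjointness gives `(u + δ v)² = u² + δ² v²`, so the potentials superpose and no odd power of
  -- `δ` appears.
  have hsol : IsPoissonSolution t 1 (u + δ • v) (phi t u + δ ^ 2 • phi t v) := by
    refine ⟨h.1.add (h'.1.smul _), fun ψ hψ => ?_⟩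
    rw [one_mul, fracForm_add_left h.1.memG (h'.1.smul _).memG hψ.memG, fracForm_smul_left,
      h.fracForm_eq hψ, h'.fracForm_eq hψ, ← integral_const_mul, ← integral_add
        (hb _ ψ hu.aestronglyMeasurable_sq hu.2 hψ).1
        ((hb _ ψ hv.aestronglyMeasurable_sq hv.2 hψ).1.const_mul _)]
    refine integral_congr_ae ?_
    filter_upwards [huv] with x hx
    simp only [Pi.add_apply, Pi.smul_apply, smul_eq_mul]
    linear_combination (-2 * δ * ψ x) * hx
  rw [hsol.coulomb_eq, h.coulomb_eq, h'.coulomb_eq,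
    fracForm_add_smul_self h.1.memG h'.1.memG]
  ring

/-- Continuity of the Coulomb energy. -/
lemma tendsto_coulomb {t : ℝ} (ht : t ∈ Ioo (0 : ℝ) 1) {ι : Type*} {l : Filter ι}
    {w : ι → R3 → ℝ} {u : R3 → ℝ} (hw : ∀ i, IsSource t (w i)) (hu : IsSource t u)
    (hi : ∀ i, Integrable fun x => |w i x ^ 2 - u x ^ 2| ^ dualExp t)
    (h : Tendsto (fun i => ∫ x, |w i x ^ 2 - u x ^ 2| ^ dualExp t) l (𝓝 0)) :
    Tendsto (fun i => coulomb t (w i)) l (𝓝 (coulomb t u)) := by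
  obtain ⟨C, hC, hb⟩ := abs_integral_mul_le ht
  have hq := dualExp_pos ht
  have hφ := hu.isPoissonSolution_phi ht
  have hφi := fun i => (hw i).isPoissonSolution_phi ht
  set d : ι → R3 → ℝ := fun i => phi t (w i) - phi t u with hd
  have hdD : ∀ i, MemD t (d i) := fun i => (hφi i).1.sub hφ.1
  set N : ι → ℝ := fun i => (∫ x, |w i x ^ 2 - u x ^ 2| ^ dualExp t) ^ (1 / dualExp t) with hN
  have hN0 : Tendsto N l (𝓝 0) := by
    have := h.rpow_const (p := 1 / dualExp t) (Or.inr (by positivity))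
    rwa [Real.zero_rpow (by positivity)] at this
  have hNn : ∀ i, 0 ≤ N i := fun i =>
    Real.rpow_nonneg (integral_nonneg fun x => by positivity) _
  -- The equation for the difference `d i` of the potentials is tested with `d i` itself. The dual
  -- estimate bounds its energy by `C N` times the square root of that energy, which is divided out.
  have hsq : ∀ i, Real.sqrt (fracForm t (d i) (d i)) ≤ C * N i := by
    intro i
    have e : fracForm t (d i) (d i) = ∫ x, (w i x ^ 2 - u x ^ 2) * d i x := by
      conv_lhs => rw [hd]
      rw [fracForm_sub_left (hφi i).1.memG hφ.1.memG (hdD i).memG, (hφi i).fracForm_eq (hdD i),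
        hφ.fracForm_eq (hdD i), ← integral_sub
          (hb _ _ (hw i).aestronglyMeasurable_sq (hw i).2 (hdD i)).1
          (hb _ _ hu.aestronglyMeasurable_sq hu.2 (hdD i)).1]
      simp only [sub_mul]
    have h1 := (hb _ _ ((hw i).aestronglyMeasurable_sq.sub hu.aestronglyMeasurable_sq)
      (hi i) (hdD i)).2
    have h2 := (le_abs_self _).trans h1
    simp only [Pi.sub_apply] at h2
    rw [← e] at h2
    rcases (Real.sqrt_nonneg (fracForm t (d i) (d i))).eq_or_lt' with h0 | h0
    · rw [h0]; exact mul_nonneg hC.le (hNn i)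
    · refine le_of_mul_le_mul_right ?_ h0
      rw [Real.mul_self_sqrt (fracForm_self_nonneg ht _)]
      exact h2
  have hs0 : Tendsto (fun i => Real.sqrt (fracForm t (d i) (d i))) l (𝓝 0) :=
    squeeze_zero (fun i => Real.sqrt_nonneg _) hsq (by simpa using hN0.const_mul C)
  have hcross : Tendsto (fun i => fracForm t (phi t u) (d i)) l (𝓝 0) := by
    rw [tendsto_zero_iff_abs_tendsto_zero]
    refine squeeze_zero (fun i => abs_nonneg _) (fun i => ?_)
      (by simpa only [mul_zero] using
        hs0.const_mul (C * (∫ x, |u x ^ 2| ^ dualExp t) ^ (1 / dualExp t)))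
    simp only [Function.comp_apply]
    rw [hφ.fracForm_eq (hdD i)]
    exact (hb _ _ hu.aestronglyMeasurable_sq hu.2 (hdD i)).2
  have hexp : ∀ i, coulomb t (w i) = coulomb t u + 2 * fracForm t (phi t u) (d i)
      + Real.sqrt (fracForm t (d i) (d i)) ^ 2 := by
    intro i
    rw [Real.sq_sqrt (fracForm_self_nonneg ht _), (hφi i).coulomb_eq, hφ.coulomb_eq]
    have e : phi t (w i) = phi t u + (1 : ℝ) • d i := by simp [hd]
    rw [e, fracForm_add_smul_self hφ.1.memG (hdD i).memG]; ring
  simp only [hexp]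
  simpa using (tendsto_const_nhds.add (hcross.const_mul 2)).add (hs0.pow 2)

/-! ### Functions of power growth -/

lemma rpow_le_sq_add_rpow {x r σ : ℝ} (hx : 0 ≤ x) (h2 : 2 ≤ σ) (hr : σ ≤ r) :
    x ^ σ ≤ x ^ 2 + x ^ r := by
  rw [← Real.rpow_two]
  rcases le_total x 1 with h | h
  · rcases hx.eq_or_lt with rfl | h0
    · rw [Real.zero_rpow (by linarith), Real.zero_rpow (by linarith)]; norm_num; positivity
    · have := Real.rpow_le_rpow_of_exponent_ge h0 h h2
      have := Real.rpow_nonneg hx r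
      linarith
  · have := Real.rpow_le_rpow_of_exponent_le h hr
    have := Real.rpow_nonneg hx 2
    linarith

lemma mul_rpow_sub_one {x r : ℝ} (hx : 0 ≤ x) (hr : 0 < r) : x ^ (r - 1) * x = x ^ r := by
  rcases hx.eq_or_lt with rfl | h0
  · rw [Real.zero_rpow hr.ne', mul_zero]
  · rw [← Real.rpow_add_one h0.ne']; congr 1; ring

/-- `Φ` vanishes at the origin and is Lipschitz on `[-m, m]` with a constant of order
`m + m^(r-1)`. -/
def IsGrowthLipschitz (r : ℝ) (Φ : ℝ → ℝ) : Prop :=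
  Φ 0 = 0 ∧ ∃ C : ℝ, 0 < C ∧ ∀ a b m : ℝ, |a| ≤ m → |b| ≤ m →
    |Φ a - Φ b| ≤ C * (m + m ^ (r - 1)) * |a - b|

lemma isGrowthLipschitz_of_hasDerivAt {r : ℝ} (hr : 2 ≤ r) {Φ Φ' : ℝ → ℝ} (h0 : Φ 0 = 0)
    (hd : ∀ x, HasDerivAt Φ (Φ' x) x) {C : ℝ} (hC : 0 < C)
    (hb : ∀ x, |Φ' x| ≤ C * (|x| + |x| ^ (r - 1))) : IsGrowthLipschitz r Φ := by
  refine ⟨h0, C, hC, fun a b m ha hb' => ?_⟩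
  have hs : Convex ℝ (Icc (-m) m) := convex_Icc _ _
  have := hs.norm_image_sub_le_of_norm_hasDerivWithin_le (f := Φ) (f' := Φ')
    (C := C * (m + m ^ (r - 1))) (fun x _ => (hd x).hasDerivWithinAt) (fun x hx => by
      have hxm : |x| ≤ m := abs_le.2 hx
      refine (hb x).trans ?_
      have := Real.rpow_le_rpow (abs_nonneg x) hxm (by linarith : 0 ≤ r - 1)
      gcongr) (abs_le.1 hb') (abs_le.1 ha)
  simpa using this

lemma IsGrowthLipschitz.continuous {r : ℝ} {Φ : ℝ → ℝ} (h : IsGrowthLipschitz r Φ) :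
    Continuous Φ := by
  obtain ⟨-, C, hC, h⟩ := h
  refine continuous_iff_continuousAt.2 fun b => ?_
  set m := |b| + 1 with hm
  set D := C * (m + m ^ (r - 1)) with hD
  rw [ContinuousAt, tendsto_iff_dist_tendsto_zero]
  have hlim : Tendsto (fun a => D * |a - b|) (𝓝 b) (𝓝 0) := by
    have : Continuous fun a => D * |a - b| := by fun_prop
    simpa using this.tendsto b
  refine squeeze_zero' (Eventually.of_forall fun a => dist_nonneg) ?_ hlim
  filter_upwards [Metric.ball_mem_nhds b one_pos] with a ha
  rw [Metric.mem_ball, Real.dist_eq] at ha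
  refine h a b m ?_ (by linarith)
  have := abs_add_le (a - b) b
  rw [sub_add_cancel] at this; linarith

lemma IsGrowthLipschitz.abs_le {r : ℝ} (hr : 2 ≤ r) {Φ : ℝ → ℝ} (h : IsGrowthLipschitz r Φ) :
    ∃ C : ℝ, 0 < C ∧ ∀ a, |Φ a| ≤ C * (a ^ 2 + |a| ^ r) := by
  obtain ⟨h0, C, hC, h⟩ := h
  refine ⟨C, hC, fun a => ?_⟩
  have := h a 0 |a| le_rfl (by simp)
  rw [h0, sub_zero, sub_zero] at this
  refine this.trans (le_of_eq ?_)
  rw [mul_assoc, add_mul, mul_rpow_sub_one (abs_nonneg a) (by linarith), ← sq, sq_abs]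

/-- If `|a - b| ≤ κ |b|`, the Lipschitz bound at scale `|b|` gains the factor `κ`; otherwise `b` is
controlled by `a - b` and the growth of `a - b` bounds everything. After integration in `x` this
yields continuity of superposition operators in `L² ∩ L^r`. -/
lemma IsGrowthLipschitz.two_scale {r : ℝ} (hr : 2 ≤ r) {Φ : ℝ → ℝ} (h : IsGrowthLipschitz r Φ)
    {η : ℝ} (hη : 0 < η) : ∃ C : ℝ, 0 ≤ C ∧ ∀ a b,
      |Φ a - Φ b| ≤ η * (b ^ 2 + |b| ^ r) + C * ((a - b) ^ 2 + |a - b| ^ r) := by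
  obtain ⟨-, C, hC, h⟩ := h
  set κ := min 1 (η / (C * 2 ^ (r - 1))) with hκ
  have hκ0 : 0 < κ := lt_min one_pos (by positivity)
  have hκ1 : κ ≤ 1 := min_le_left _ _
  have hκη : C * 2 ^ (r - 1) * κ ≤ η := by
    have := min_le_right 1 (η / (C * 2 ^ (r - 1)))
    rw [← hκ, le_div_iff₀ (by positivity)] at this
    linarith
  have hgrow : ∀ L x y : ℝ, 1 ≤ L → 0 ≤ x → 0 ≤ y →
      C * (L * x + (L * x) ^ (r - 1)) * y ≤ C * L ^ (r - 1) * (x + x ^ (r - 1)) * y := by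
    intro L x y hL hx hy
    have h1 : L ≤ L ^ (r - 1) := by
      simpa using Real.rpow_le_rpow_of_exponent_le hL (by linarith : (1 : ℝ) ≤ r - 1)
    rw [Real.mul_rpow (by linarith) hx]
    have : L * x ≤ L ^ (r - 1) * x := mul_le_mul_of_nonneg_right h1 hx
    have : L * x + L ^ (r - 1) * x ^ (r - 1) ≤ L ^ (r - 1) * (x + x ^ (r - 1)) := by linarith
    rw [mul_assoc C (L ^ (r - 1))]
    gcongr
  have hfin : ∀ x : ℝ, 0 ≤ x → (x + x ^ (r - 1)) * x = x ^ 2 + x ^ r := by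
    intro x hx
    rw [add_mul, mul_rpow_sub_one hx (by linarith), sq]
  refine ⟨C * (2 / κ) ^ (r - 1), by positivity, fun a b => ?_⟩
  have habs := abs_add_le (a - b) b
  rw [sub_add_cancel] at habs
  have hp1 : 0 ≤ b ^ 2 + |b| ^ r := by positivity
  have hp2 : 0 ≤ (a - b) ^ 2 + |a - b| ^ r := by positivity
  rcases le_or_gt |a - b| (κ * |b|) with hc | hc
  · have hm : |a - b| ≤ |b| := hc.trans (mul_le_of_le_one_left (abs_nonneg b) hκ1)
    have h1 := h a b (2 * |b|) (by linarith) (by linarith [abs_nonneg b])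
    calc _ ≤ C * (2 * |b| + (2 * |b|) ^ (r - 1)) * |a - b| := h1
      _ ≤ C * 2 ^ (r - 1) * (|b| + |b| ^ (r - 1)) * |a - b| :=
          hgrow 2 _ _ (by norm_num) (abs_nonneg b) (abs_nonneg _)
      _ ≤ C * 2 ^ (r - 1) * (|b| + |b| ^ (r - 1)) * (κ * |b|) := by gcongr
      _ = C * 2 ^ (r - 1) * κ * (b ^ 2 + |b| ^ r) := by
          rw [← sq_abs b, ← hfin _ (abs_nonneg b)]; ring
      _ ≤ η * (b ^ 2 + |b| ^ r) := by gcongr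
      _ ≤ _ := le_add_of_nonneg_right (by positivity)
  · have hb : |b| ≤ |a - b| / κ := by rw [le_div_iff₀ hκ0]; linarith
    have hk : |a - b| ≤ |a - b| / κ := le_div_self (abs_nonneg _) hκ0 hκ1
    have e : |a - b| / κ + |a - b| / κ = 2 / κ * |a - b| := by ring
    have h1 := h a b (2 / κ * |a - b|) (by linarith)
      (by linarith [div_nonneg (abs_nonneg (a - b)) hκ0.le])
    have hL : 1 ≤ 2 / κ := by rw [le_div_iff₀ hκ0]; linarith
    calc _ ≤ _ := h1
      _ ≤ _ := hgrow (2 / κ) _ _ hL (abs_nonneg _) (abs_nonneg _)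
      _ = C * (2 / κ) ^ (r - 1) * ((a - b) ^ 2 + |a - b| ^ r) := by
          rw [← sq_abs (a - b), ← hfin _ (abs_nonneg _)]; ring
      _ ≤ _ := le_add_of_nonneg_left (by positivity)

/-- The analogue of `IsGrowthLipschitz.two_scale` for powers of differences of squares. -/
lemma abs_sq_sub_sq_rpow_le {r σ : ℝ} (hσ : 1 ≤ σ) (hr : 2 * σ ≤ r) {η : ℝ} (hη : 0 < η) :
    ∃ C : ℝ, 0 ≤ C ∧ ∀ a b : ℝ,
      |a ^ 2 - b ^ 2| ^ σ ≤ η * (b ^ 2 + |b| ^ r) + C * ((a - b) ^ 2 + |a - b| ^ r) := by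
  -- For `|a - b| ≤ κ |b|` the difference of squares is at most `3 κ b²`, and `(3κ)^σ ≤ η`.
  set κ := min 1 (η ^ (1 / σ) / 3) with hκ
  have hκ0 : 0 < κ := lt_min one_pos (by positivity)
  have hκ1 : κ ≤ 1 := min_le_left _ _
  have hκη : (3 * κ) ^ σ ≤ η := by
    have : 3 * κ ≤ η ^ (1 / σ) := by
      have := min_le_right 1 (η ^ (1 / σ) / 3); linarith
    calc (3 * κ) ^ σ ≤ (η ^ (1 / σ)) ^ σ :=
          Real.rpow_le_rpow (by positivity) this (by linarith)
      _ = η := by rw [← Real.rpow_mul hη.le]; rw [one_div_mul_cancel (by linarith), Real.rpow_one]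
  have hpow : ∀ L x : ℝ, 0 ≤ L → 0 ≤ x → (L * x ^ 2) ^ σ ≤ L ^ σ * (x ^ 2 + x ^ r) := by
    intro L x hL hx
    rw [Real.mul_rpow hL (by positivity)]
    refine mul_le_mul_of_nonneg_left ?_ (by positivity)
    rw [← Real.rpow_natCast x 2, ← Real.rpow_mul hx, Real.rpow_natCast]
    exact rpow_le_sq_add_rpow hx (by push_cast; linarith) (by push_cast; linarith)
  have hsplit : ∀ a b : ℝ, |a ^ 2 - b ^ 2| ≤ (|a - b| + 2 * |b|) * |a - b| := by
    intro a b
    have e : a ^ 2 - b ^ 2 = ((a - b) + 2 * b) * (a - b) := by ring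
    rw [e, abs_mul]
    refine mul_le_mul_of_nonneg_right ((abs_add_le _ _).trans ?_) (abs_nonneg _)
    rw [abs_mul, abs_two]
  refine ⟨(1 + 2 / κ) ^ σ, by positivity, fun a b => ?_⟩
  have hp1 : 0 ≤ b ^ 2 + |b| ^ r := by positivity
  have hp2 : 0 ≤ (a - b) ^ 2 + |a - b| ^ r := by positivity
  rcases le_or_gt |a - b| (κ * |b|) with hc | hc
  · have hm : |a - b| ≤ |b| := hc.trans (mul_le_of_le_one_left (abs_nonneg b) hκ1)
    have h1 : |a ^ 2 - b ^ 2| ≤ 3 * κ * |b| ^ 2 := by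
      refine (hsplit a b).trans ?_
      calc _ ≤ (|b| + 2 * |b|) * (κ * |b|) := by gcongr
        _ = _ := by ring
    calc _ ≤ (3 * κ * |b| ^ 2) ^ σ := Real.rpow_le_rpow (abs_nonneg _) h1 (by linarith)
      _ ≤ (3 * κ) ^ σ * (|b| ^ 2 + |b| ^ r) := hpow _ _ (by positivity) (abs_nonneg b)
      _ ≤ η * (b ^ 2 + |b| ^ r) := by rw [sq_abs]; gcongr
      _ ≤ _ := le_add_of_nonneg_right (by positivity)
  · have hb : |b| ≤ |a - b| / κ := by rw [le_div_iff₀ hκ0]; linarith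
    have h1 : |a ^ 2 - b ^ 2| ≤ (1 + 2 / κ) * |a - b| ^ 2 := by
      refine (hsplit a b).trans ?_
      calc _ ≤ (|a - b| + 2 * (|a - b| / κ)) * |a - b| := by gcongr
        _ = _ := by ring
    calc _ ≤ ((1 + 2 / κ) * |a - b| ^ 2) ^ σ := Real.rpow_le_rpow (abs_nonneg _) h1 (by linarith)
      _ ≤ (1 + 2 / κ) ^ σ * (|a - b| ^ 2 + |a - b| ^ r) := hpow _ _ (by positivity) (abs_nonneg _)
      _ = (1 + 2 / κ) ^ σ * ((a - b) ^ 2 + |a - b| ^ r) := by rw [sq_abs]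
      _ ≤ _ := le_add_of_nonneg_left (by positivity)

lemma isGrowthLipschitz_sq {r : ℝ} (hr : 2 ≤ r) : IsGrowthLipschitz r fun x => x ^ 2 := by
  refine isGrowthLipschitz_of_hasDerivAt hr (Φ' := fun x => 2 * x) (by norm_num) (fun x => ?_)
    two_pos fun x => ?_
  · simpa using hasDerivAt_pow 2 x
  · rw [abs_mul, abs_two]
    have := Real.rpow_nonneg (abs_nonneg x) (r - 1)
    linarith

lemma isGrowthLipschitz_abs_rpow {r : ℝ} (hr : 2 ≤ r) :
    IsGrowthLipschitz r fun x => |x| ^ r := by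
  refine isGrowthLipschitz_of_hasDerivAt hr (Φ' := fun x => r * |x| ^ (r - 2) * x)
    (by simp [Real.zero_rpow (by linarith : r ≠ 0)])
    (fun x => hasDerivAt_abs_rpow x (by linarith)) (C := r) (by linarith) fun x => ?_
  rw [abs_mul, abs_mul, abs_of_pos (by linarith : 0 < r),
    abs_of_nonneg (Real.rpow_nonneg (abs_nonneg x) _), mul_assoc]
  refine mul_le_mul_of_nonneg_left ?_ (by linarith)
  rcases (abs_nonneg x).eq_or_lt with h0 | h0
  · rw [← h0, mul_zero]; positivity
  · rw [← Real.rpow_add_one h0.ne', show r - 2 + 1 = r - 1 by ring]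
    linarith

/-! ### The nonlinearity -/

lemma mem_Ioo_zero_one {s : ℝ} (hs : s ∈ Ioo (3 / 4 : ℝ) 1) : s ∈ Ioo (0 : ℝ) 1 :=
  ⟨by linarith [hs.1], hs.2⟩

lemma four_lt_critExp {s : ℝ} (hs : s ∈ Ioo (3 / 4 : ℝ) 1) : 4 < critExp s := by
  rw [critExp, lt_div_iff₀ (by linarith [hs.2])]; linarith [hs.1]

namespace IsAdmissible

variable {s : ℝ} {f : ℝ → ℝ}

lemma continuous (hf : IsAdmissible s f) : Continuous f := hf.contDiff.continuous

lemma hasDerivAt (hf : IsAdmissible s f) (x : ℝ) : HasDerivAt f (deriv f x) x :=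
  (hf.contDiff.differentiable one_ne_zero x).hasDerivAt

lemma apply_pos (hf : IsAdmissible s f) {x : ℝ} (hx : 0 < x) : 0 < f x :=
  pos_of_mul_pos_left (hf.pos x hx) hx.le

lemma nonneg (hf : IsAdmissible s f) (x : ℝ) : 0 ≤ f x := by
  rcases le_or_gt x 0 with h | h
  · rw [hf.zero x h]
  · exact (hf.apply_pos h).le

lemma mul_self_nonneg (hf : IsAdmissible s f) (x : ℝ) : 0 ≤ f x * x := by
  rcases le_or_gt x 0 with h | h
  · rw [hf.zero x h, zero_mul]
  · exact (hf.pos x h).le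

/-- Passing from `p` to the critical exponent lets the single class `IsGrowthLipschitz (critExp s)`
cover every local term of the functional. -/
lemma abs_deriv_le (hf : IsAdmissible s f) :
    ∃ C : ℝ, 0 < C ∧ ∀ x, |deriv f x| ≤ C * (1 + |x| ^ (critExp s - 2)) := by
  obtain ⟨c₀, c₁, p, q, -, hc₁, hq, hqp, hp, -, h⟩ := hf.growth
  refine ⟨2 * c₁, by linarith, fun x => (h x).trans ?_⟩
  have : |x| ^ (p - 2) ≤ 1 + |x| ^ (critExp s - 2) := by
    rcases le_total |x| 1 with hx | hx
    · have := Real.rpow_le_one (abs_nonneg x) hx (by linarith : 0 ≤ p - 2)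
      have := Real.rpow_nonneg (abs_nonneg x) (critExp s - 2)
      linarith
    · have := Real.rpow_le_rpow_of_exponent_le hx (by linarith : p - 2 ≤ critExp s - 2)
      linarith
  have := Real.rpow_nonneg (abs_nonneg x) (critExp s - 2)
  nlinarith

lemma abs_le (hs : s ∈ Ioo (3 / 4 : ℝ) 1) (hf : IsAdmissible s f) :
    ∃ C : ℝ, 0 < C ∧ ∀ x, |f x| ≤ C * (|x| + |x| ^ (critExp s - 1)) := by
  obtain ⟨C, hC, h⟩ := hf.abs_deriv_le
  have hr := four_lt_critExp hs
  refine ⟨C, hC, fun x => ?_⟩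
  have hb := (convex_Icc (-|x|) |x|).norm_image_sub_le_of_norm_hasDerivWithin_le (f := f)
    (f' := deriv f) (C := C * (1 + |x| ^ (critExp s - 2)))
    (fun y _ => (hf.hasDerivAt y).hasDerivWithinAt) (fun y hy => by
      have hym : |y| ≤ |x| := _root_.abs_le.2 hy
      refine (h y).trans ?_
      have := Real.rpow_le_rpow (abs_nonneg y) hym (by linarith : 0 ≤ critExp s - 2)
      gcongr) (x := 0) (y := x) (by simp) (_root_.abs_le.1 le_rfl)
  rw [hf.zero 0 le_rfl, sub_zero, sub_zero, Real.norm_eq_abs, Real.norm_eq_abs] at hb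
  refine hb.trans (le_of_eq ?_)
  rw [mul_assoc, add_mul, one_mul]
  congr 2
  have := mul_rpow_sub_one (abs_nonneg x) (by linarith : 0 < critExp s - 1)
  rw [← this]; congr 2; ring

lemma isGrowthLipschitz_mul_self (hs : s ∈ Ioo (3 / 4 : ℝ) 1) (hf : IsAdmissible s f) :
    IsGrowthLipschitz (critExp s) fun x => f x * x := by
  obtain ⟨C, hC, h⟩ := hf.abs_deriv_le
  obtain ⟨C', hC', h'⟩ := hf.abs_le hs
  have hr := four_lt_critExp hs
  refine isGrowthLipschitz_of_hasDerivAt (by linarith) (Φ' := fun x => deriv f x * x + f x * 1)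
    (by simp) (fun x => (hf.hasDerivAt x).mul (hasDerivAt_id x)) (C := C + C') (by linarith)
    fun x => ?_
  refine (abs_add_le _ _).trans ?_
  rw [abs_mul, mul_one, add_mul]
  refine add_le_add ?_ (h' x)
  calc |deriv f x| * |x| ≤ C * (1 + |x| ^ (critExp s - 2)) * |x| := by gcongr; exact h x
    _ = C * (|x| + |x| ^ (critExp s - 1 - 1) * |x|) := by
        rw [show critExp s - 1 - 1 = critExp s - 2 by ring]; ring
    _ = _ := by rw [mul_rpow_sub_one (abs_nonneg x) (by linarith)]

lemma hasDerivAt_primitive (hf : IsAdmissible s f) (x : ℝ) :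
    HasDerivAt (primitive f) (f x) x :=
  intervalIntegral.integral_hasDerivAt_right (hf.continuous.intervalIntegrable _ _)
    hf.continuous.aestronglyMeasurable.stronglyMeasurableAtFilter hf.continuous.continuousAt

lemma isGrowthLipschitz_primitive (hs : s ∈ Ioo (3 / 4 : ℝ) 1) (hf : IsAdmissible s f) :
    IsGrowthLipschitz (critExp s) (primitive f) := by
  obtain ⟨C, hC, h⟩ := hf.abs_le hs
  exact isGrowthLipschitz_of_hasDerivAt (by linarith [four_lt_critExp hs])
    (by simp [primitive]) hf.hasDerivAt_primitive hC h

lemma primitive_mono (hf : IsAdmissible s f) : Monotone (primitive f) :=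
  monotone_of_deriv_nonneg (fun x => (hf.hasDerivAt_primitive x).differentiableAt)
    fun x => by rw [(hf.hasDerivAt_primitive x).deriv]; exact hf.nonneg x

lemma primitive_of_nonpos (hf : IsAdmissible s f) {x : ℝ} (hx : x ≤ 0) : primitive f x = 0 := by
  rw [primitive, intervalIntegral.integral_congr (g := fun _ => 0), intervalIntegral.integral_zero]
  intro y hy
  rw [uIcc_of_ge hx] at hy
  exact hf.zero y hy.2

lemma primitive_nonneg (hf : IsAdmissible s f) (x : ℝ) : 0 ≤ primitive f x := by
  rcases le_total x 0 with h | h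
  · rw [hf.primitive_of_nonpos h]
  · rw [← hf.primitive_of_nonpos le_rfl]; exact hf.primitive_mono h

lemma primitive_pos (hf : IsAdmissible s f) {x : ℝ} (hx : 0 < x) : 0 < primitive f x :=
  intervalIntegral.intervalIntegral_pos_of_pos_on (hf.continuous.intervalIntegrable _ _)
    (fun _ hy => hf.apply_pos hy.1) hx

/-- The primitive along a ray is controlled by the quartic with the same slope at the end point. -/
lemma primitive_sub_primitive_le (hf : IsAdmissible s f) {τ : ℝ} (hτ : 0 ≤ τ) (a : ℝ) :
    primitive f a - primitive f (τ * a) ≤ (1 - τ ^ 4) / 4 * (f a * a) := by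
  rcases le_or_gt a 0 with ha | ha
  · rw [hf.primitive_of_nonpos ha, hf.primitive_of_nonpos (mul_nonpos_of_nonneg_of_nonpos hτ ha),
      hf.zero a ha]; simp
  -- By monotonicity of `f(z)/z³`, the cubic `c z³` lies above `f` on `(0, a]` and below it on `[a,
  -- ∞)`. For `τ ≥ 1` the interval of integration is reversed, so both cases give the same
  -- inequality.
  set c := f a / a ^ 3 with hc
  have hI : ∀ x y, IntervalIntegrable f volume x y := fun x y =>
    hf.continuous.intervalIntegrable x y
  have hJ : ∀ x y, IntervalIntegrable (fun z => c * z ^ 3) volume x y := fun x y =>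
    (by fun_prop : Continuous fun z : ℝ => c * z ^ 3).intervalIntegrable x y
  have hquart : ∀ x y : ℝ, ∫ z in x..y, c * z ^ 3 = c * ((y ^ 4 - x ^ 4) / 4) := by
    intro x y
    rw [intervalIntegral.integral_const_mul, integral_pow]; norm_num
  have hfa : f a * a = c * a ^ 4 := by rw [hc]; field_simp
  have hdiff : primitive f a - primitive f (τ * a) = ∫ x in (τ * a)..a, f x :=
    intervalIntegral.integral_interval_sub_left (hI _ _) (hI _ _)
  have hmono : ∀ x y : ℝ, 0 < x → 0 < y → x ≤ y → f x / x ^ 3 ≤ f y / y ^ 3 := fun x y hx hy hxy =>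
    hf.strictMono.monotoneOn hx hy hxy
  rw [hdiff, hfa]
  rcases le_total τ 1 with h1 | h1
  · have hle : τ * a ≤ a := mul_le_of_le_one_left ha.le h1
    have := intervalIntegral.integral_mono_on hle (hI _ _) (hJ _ _) fun x hx => by
      have hx0 : 0 ≤ x := (mul_nonneg hτ ha.le).trans hx.1
      rcases hx0.eq_or_lt with rfl | hx0
      · rw [hf.zero 0 le_rfl]; simp
      · have := hmono x a hx0 ha hx.2
        rwa [div_le_iff₀ (by positivity)] at this
    rw [hquart] at this
    refine this.trans (le_of_eq (by ring))
  · have hle : a ≤ τ * a := le_mul_of_one_le_left ha.le h1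
    have := intervalIntegral.integral_mono_on hle (hJ _ _) (hI _ _) fun x hx => by
      have hx0 : 0 < x := ha.trans_le hx.1
      have := hmono a x ha hx0 hx.1
      rwa [le_div_iff₀ (by positivity)] at this
    rw [hquart] at this
    rw [intervalIntegral.integral_symm]
    have e : c * (((τ * a) ^ 4 - a ^ 4) / 4) = - ((1 - τ ^ 4) / 4 * (c * a ^ 4)) := by ring
    linarith

/-- The case `τ = 0` of the comparison along rays: an Ambrosetti–Rabinowitz inequality with exponent
`4`. -/
lemma four_mul_primitive_le (hf : IsAdmissible s f) (a : ℝ) : 4 * primitive f a ≤ f a * a := by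
  have h := hf.primitive_sub_primitive_le le_rfl a
  rw [zero_mul, hf.primitive_of_nonpos le_rfl] at h
  linarith

/-- The nonlinearity is superlinear at the origin and of critical growth at infinity. -/
lemma mul_self_le (hs : s ∈ Ioo (3 / 4 : ℝ) 1) (hf : IsAdmissible s f) {η : ℝ} (hη : 0 < η) :
    ∃ C : ℝ, 0 ≤ C ∧ ∀ x, f x * x ≤ η * x ^ 2 + C * |x| ^ critExp s := by
  obtain ⟨C, hC, h⟩ := hf.abs_le hs
  have hr := four_lt_critExp hs
  obtain ⟨δ, hδ, hsmall⟩ := Metric.eventually_nhds_iff.1 (hf.isLittleO.def hη)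
  set κ := min δ 1 with hκ
  have hκ0 : 0 < κ := lt_min hδ one_pos
  refine ⟨C * (1 / κ ^ (critExp s - 2) + 1), by positivity, fun x => ?_⟩
  have hp := Real.rpow_nonneg (abs_nonneg x) (critExp s)
  have hle : f x * x ≤ |f x| * |x| := by rw [← abs_mul]; exact le_abs_self _
  rcases lt_or_ge |x| κ with hx | hx
  · have h1 := hsmall (y := x) (by
      rw [Real.dist_eq, sub_zero]; exact hx.trans_le (min_le_left _ _))
    have hx1 : |x| ≤ 1 := (hx.trans_le (min_le_right _ _)).le
    rw [Real.norm_eq_abs, Real.norm_eq_abs, abs_pow] at h1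
    have h2 : |x| ^ 3 * |x| ≤ x ^ 2 := by
      rw [← sq_abs x]
      nlinarith [pow_le_one₀ (abs_nonneg x) hx1 (n := 2), sq_nonneg |x|]
    have h3 : |f x| * |x| ≤ η * x ^ 2 := by
      calc |f x| * |x| ≤ η * |x| ^ 3 * |x| := by gcongr
        _ = η * (|x| ^ 3 * |x|) := by ring
        _ ≤ _ := by gcongr
    have : 0 ≤ C * (1 / κ ^ (critExp s - 2) + 1) * |x| ^ critExp s := by positivity
    linarith
  · have hx0 : 0 < |x| := hκ0.trans_le hx
    have h1 : x ^ 2 ≤ 1 / κ ^ (critExp s - 2) * |x| ^ critExp s := by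
      have e : |x| ^ critExp s = |x| ^ (critExp s - 2) * x ^ 2 := by
        rw [← sq_abs x, ← Real.rpow_natCast |x| 2, ← Real.rpow_add hx0]; norm_num
      have := Real.rpow_le_rpow hκ0.le hx (by linarith : 0 ≤ critExp s - 2)
      rw [e, div_mul_eq_mul_div, one_mul, le_div_iff₀ (by positivity), mul_comm]
      gcongr
    have h2 : |f x| * |x| ≤ C * (x ^ 2 + |x| ^ critExp s) := by
      calc |f x| * |x| ≤ C * (|x| + |x| ^ (critExp s - 1)) * |x| := by gcongr; exact h x
        _ = _ := by
          rw [mul_assoc, add_mul, mul_rpow_sub_one (abs_nonneg x) (by linarith), ← sq, sq_abs]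
    have h3 : 0 ≤ η * x ^ 2 := by positivity
    have h4 : C * x ^ 2 ≤ C * (1 / κ ^ (critExp s - 2) * |x| ^ critExp s) := by gcongr
    calc f x * x ≤ C * (x ^ 2 + |x| ^ critExp s) := hle.trans h2
      _ ≤ C * (1 / κ ^ (critExp s - 2) * |x| ^ critExp s) + C * |x| ^ critExp s := by linarith
      _ ≤ _ := by linarith

end IsAdmissible

/-! ### The space `H^s` -/

lemma MemH.add {α : ℝ} {u v : R3 → ℝ} (hu : MemH α u) (hv : MemH α v) : MemH α (u + v) :=
  ⟨hu.1.add hv.1, (hu.memG.add hv.memG).finiteSeminorm⟩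

lemma MemH.sub {α : ℝ} {u v : R3 → ℝ} (hu : MemH α u) (hv : MemH α v) : MemH α (u - v) :=
  ⟨hu.1.sub hv.1, (hu.memG.sub hv.memG).finiteSeminorm⟩

lemma MemH.smul {α : ℝ} {u : R3 → ℝ} (hu : MemH α u) (c : ℝ) : MemH α (c • u) :=
  ⟨hu.1.const_smul c, (hu.memG.smul c).finiteSeminorm⟩

lemma MemH.translate {α : ℝ} {u : R3 → ℝ} (hu : MemH α u) (a : R3) : MemH α (translate a u) :=
  ⟨hu.1.comp_measurePreserving (measurePreserving_translate a),
    (hu.memG.translate a).finiteSeminorm⟩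

lemma MemH.dilate {α ε : ℝ} (hε : 0 < ε) {u : R3 → ℝ} (hu : MemH α u) :
    MemH α (FracSP.dilate ε u) :=
  ⟨MemLp.dilate hε hu.1, (hu.memG.dilate hε).finiteSeminorm⟩

lemma MemH.abs {α : ℝ} {u : R3 → ℝ} (hu : MemH α u) : MemH α |u| :=
  ⟨hu.1.norm, (hu.memG.comp_contraction (g := fun x => |x|)
    (lipschitzWith_one_norm (E := ℝ))).finiteSeminorm⟩

lemma MemH.aemeasurable {α : ℝ} {u : R3 → ℝ} (hu : MemH α u) : AEMeasurable u volume :=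
  hu.1.1.aemeasurable

lemma fracForm_sq_le {α : ℝ} {u v : R3 → ℝ} (hu : MemG α u) (hv : MemG α v) :
    fracForm α u v ^ 2 ≤ fracForm α u u * fracForm α v v := by
  have hU := MemLp.coeFn_toLp hu.2
  have hV := MemLp.coeFn_toLp hv.2
  rw [fracForm_eq_inner hU hV, fracForm_eq_inner hU hU, fracForm_eq_inner hV hV]
  have h := real_inner_mul_inner_self_le (hu.2.toLp _) (hv.2.toLp _)
  have hc := sq_nonneg (fracConst α / 2)
  nlinarith

/-! ### Nemytskii operators -/

lemma MemH.integrable_growth {s : ℝ} (hs : s ∈ Ioo (0 : ℝ) 1) {u : R3 → ℝ} (hu : MemH s u) :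
    Integrable fun x => u x ^ 2 + |u x| ^ critExp s :=
  hu.integrable_sq.add (hu.integrable_critExp hs)

lemma integrable_mul_comp {s : ℝ} (hs : s ∈ Ioo (0 : ℝ) 1) {W : R3 → ℝ} (hW : Continuous W)
    {M : ℝ} (hM : ∀ x, |W x| ≤ M) {Φ : ℝ → ℝ} (hΦ : IsGrowthLipschitz (critExp s) Φ)
    {u : R3 → ℝ} (hu : MemH s u) : Integrable fun x => W x * Φ (u x) := by
  obtain ⟨C, hC, h⟩ := hΦ.abs_le (two_lt_critExp hs).le
  refine ((hu.integrable_growth hs).const_mul (M * C)).mono'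
    (hW.aestronglyMeasurable.mul (hΦ.continuous.comp_aestronglyMeasurable hu.1.1))
    (ae_of_all _ fun x => ?_)
  rw [Real.norm_eq_abs, abs_mul, mul_assoc]
  have hM0 : 0 ≤ M := (abs_nonneg _).trans (hM x)
  have := h (u x)
  gcongr
  exact hM x

/-- A superposition operator controlled at two scales is continuous along sequences that converge
in `L² ∩ L^r`. -/
lemma tendsto_integral_of_two_scale {s : ℝ} (hs : s ∈ Ioo (0 : ℝ) 1) {ι : Type*} {l : Filter ι}
    {Ψ : ℝ → ℝ → ℝ} (hc : Continuous fun z : ℝ × ℝ => Ψ z.1 z.2) (h0 : ∀ a b, 0 ≤ Ψ a b)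
    (hΨ : ∀ η : ℝ, 0 < η → ∃ C : ℝ, 0 ≤ C ∧ ∀ a b, Ψ a b ≤ η * (b ^ 2 + |b| ^ critExp s)
      + C * ((a - b) ^ 2 + |a - b| ^ critExp s))
    {w : ι → R3 → ℝ} {u : R3 → ℝ} (hw : ∀ i, MemH s (w i)) (hu : MemH s u)
    (h : Tendsto (fun i => ∫ x, ((w i x - u x) ^ 2 + |w i x - u x| ^ critExp s)) l (𝓝 0)) :
    (∀ i, Integrable fun x => Ψ (w i x) (u x)) ∧
      Tendsto (fun i => ∫ x, Ψ (w i x) (u x)) l (𝓝 0) := by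
  have hd : ∀ i, Integrable fun x => ((w i x - u x) ^ 2 + |w i x - u x| ^ critExp s) := fun i =>
    ((hw i).sub hu).integrable_growth hs
  have hG := hu.integrable_growth hs
  have hi : ∀ i, Integrable fun x => Ψ (w i x) (u x) := by
    intro i
    obtain ⟨C, hC, hb⟩ := hΨ 1 one_pos
    refine ((hG.const_mul 1).add ((hd i).const_mul C)).mono'
      (hc.comp_aestronglyMeasurable ((hw i).1.1.prodMk hu.1.1)) (ae_of_all _ fun x => ?_)
    rw [Real.norm_of_nonneg (h0 _ _)]
    exact hb _ _
  refine ⟨hi, ?_⟩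
  set G := ∫ x, (u x ^ 2 + |u x| ^ critExp s) with hGdef
  have hG0 : 0 ≤ G := integral_nonneg fun x => by positivity
  rw [Metric.tendsto_nhds]
  intro e he
  -- The `η`-term then stays below `e/2` for all indices, and convergence is only needed for the
  -- other term.
  set η := e / (2 * (G + 1)) with hη
  obtain ⟨C, hC, hb⟩ := hΨ η (by positivity)
  filter_upwards [h.eventually (gt_mem_nhds (show 0 < e / (2 * (C + 1)) by positivity))] with i hi'
  rw [Real.dist_eq, sub_zero, abs_of_nonneg (integral_nonneg fun x => h0 _ _)]
  have h1 : ∫ x, Ψ (w i x) (u x) ≤ η * G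
      + C * ∫ x, ((w i x - u x) ^ 2 + |w i x - u x| ^ critExp s) := by
    rw [hGdef, ← integral_const_mul, ← integral_const_mul,
      ← integral_add (hG.const_mul _) ((hd i).const_mul _)]
    exact integral_mono (hi i) ((hG.const_mul _).add ((hd i).const_mul _)) fun x => hb _ _
  have h2 : η * G < e / 2 := by
    rw [hη, div_mul_eq_mul_div, div_lt_div_iff₀ (by positivity) two_pos]
    nlinarith
  have h3 : C * (∫ x, ((w i x - u x) ^ 2 + |w i x - u x| ^ critExp s)) ≤ e / 2 := by
    rw [lt_div_iff₀ (by positivity)] at hi'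
    have : 0 ≤ ∫ x, ((w i x - u x) ^ 2 + |w i x - u x| ^ critExp s) :=
      integral_nonneg fun x => by positivity
    nlinarith
  linarith

lemma tendsto_integral_mul_comp {s : ℝ} (hs : s ∈ Ioo (0 : ℝ) 1) {ι : Type*} {l : Filter ι}
    {W : R3 → ℝ} (hW : Continuous W) {M : ℝ} (hM : ∀ x, |W x| ≤ M)
    {Φ : ℝ → ℝ} (hΦ : IsGrowthLipschitz (critExp s) Φ)
    {w : ι → R3 → ℝ} {u : R3 → ℝ} (hw : ∀ i, MemH s (w i)) (hu : MemH s u)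
    (h : Tendsto (fun i => ∫ x, ((w i x - u x) ^ 2 + |w i x - u x| ^ critExp s)) l (𝓝 0)) :
    Tendsto (fun i => ∫ x, W x * Φ (w i x)) l (𝓝 (∫ x, W x * Φ (u x))) := by
  have hcont := hΦ.continuous
  obtain ⟨hi, hlim⟩ := tendsto_integral_of_two_scale hs (Ψ := fun a b => |Φ a - Φ b|)
    (by fun_prop) (fun _ _ => abs_nonneg _)
    (fun η hη => hΦ.two_scale (two_lt_critExp hs).le hη) hw hu h
  rw [tendsto_iff_dist_tendsto_zero]
  refine squeeze_zero (fun i => dist_nonneg) (fun i => ?_) (by simpa using hlim.const_mul M)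
  rw [Real.dist_eq, ← integral_sub (integrable_mul_comp hs hW hM hΦ (hw i))
    (integrable_mul_comp hs hW hM hΦ hu), ← integral_const_mul]
  refine (abs_integral_le_integral_abs).trans (integral_mono_of_nonneg
    (ae_of_all _ fun x => abs_nonneg _) ((hi i).const_mul M) (ae_of_all _ fun x => ?_))
  simp only [← mul_sub, abs_mul]
  gcongr
  exact hM x

/-! ### Square-integrable densities -/

/-- Since `dualExp t ≤ 2` and `s > 3/4` gives `critExp s > 4`, the exponent `2 * dualExp t` lies
between `2` and `critExp s`. Squares of functions in `H^s` are therefore admissible sources for the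
Poisson equation. -/
lemma two_mul_dualExp_le {s t : ℝ} (hs : s ∈ Ioo (3 / 4 : ℝ) 1) (ht : t ∈ Ioo (0 : ℝ) 1) :
    1 ≤ dualExp t ∧ 2 * dualExp t ≤ critExp s := by
  have h4 := four_lt_critExp hs
  have h1 : 0 < 3 + 2 * t := by linarith [ht.1]
  constructor
  · rw [dualExp, le_div_iff₀ h1]; linarith [ht.2]
  · have : dualExp t ≤ 2 := by rw [dualExp, div_le_iff₀ h1]; linarith [ht.1]
    linarith

lemma MemH.isSource {s t : ℝ} (hs : s ∈ Ioo (3 / 4 : ℝ) 1) (ht : t ∈ Ioo (0 : ℝ) 1)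
    {u : R3 → ℝ} (hu : MemH s u) : IsSource t u := by
  obtain ⟨h1, h2⟩ := two_mul_dualExp_le hs ht
  refine ⟨hu.1.1, (hu.integrable_growth (mem_Ioo_zero_one hs)).mono'
    (((hu.aemeasurable.pow_const 2).norm).pow_const _).aestronglyMeasurable
    (ae_of_all _ fun x => ?_)⟩
  have e : |u x ^ 2| ^ dualExp t = |u x| ^ (2 * dualExp t) := by
    rw [abs_pow, ← Real.rpow_natCast, ← Real.rpow_mul (abs_nonneg _)]; norm_num
  rw [Real.norm_of_nonneg (by positivity), e, ← sq_abs (u x)]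
  exact rpow_le_sq_add_rpow (abs_nonneg _) (by linarith) h2

lemma tendsto_coulomb_of_memH {s t : ℝ} (hs : s ∈ Ioo (3 / 4 : ℝ) 1) (ht : t ∈ Ioo (0 : ℝ) 1)
    {ι : Type*} {l : Filter ι} {w : ι → R3 → ℝ} {u : R3 → ℝ} (hw : ∀ i, MemH s (w i))
    (hu : MemH s u)
    (h : Tendsto (fun i => ∫ x, ((w i x - u x) ^ 2 + |w i x - u x| ^ critExp s)) l (𝓝 0)) :
    Tendsto (fun i => coulomb t (w i)) l (𝓝 (coulomb t u)) := by
  obtain ⟨h1, h2⟩ := two_mul_dualExp_le hs ht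
  obtain ⟨hi, hlim⟩ := tendsto_integral_of_two_scale (mem_Ioo_zero_one hs)
    (Ψ := fun a b => |a ^ 2 - b ^ 2| ^ dualExp t)
    (Continuous.rpow_const (by fun_prop) fun _ => Or.inr (dualExp_pos ht).le)
    (fun _ _ => by positivity) (fun η hη => abs_sq_sub_sq_rpow_le h1 h2 hη) hw hu h
  exact tendsto_coulomb ht (fun i => (hw i).isSource hs ht) (hu.isSource hs ht) hi hlim

/-! ### Coefficients and the functionals -/

/-- Continuous, positive and bounded coefficients, the potential being bounded away from `0`. -/
structure IsCoeffs (V K Q : R3 → ℝ) : Prop where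
  contV : Continuous V
  contK : Continuous K
  contQ : Continuous Q
  V_lower : ∃ v₀ : ℝ, 0 < v₀ ∧ ∀ x, v₀ ≤ V x
  K_pos : ∀ x, 0 < K x
  Q_pos : ∀ x, 0 < Q x
  bounded : ∃ M : ℝ, 0 < M ∧ ∀ x, |V x| ≤ M ∧ |K x| ≤ M ∧ |Q x| ≤ M

/-- The square of the weighted norm. -/
def quad (s : ℝ) (V u : R3 → ℝ) : ℝ := fracForm s u u + ∫ x, V x * u x ^ 2

section

variable {s t : ℝ} {V K Q : R3 → ℝ} {f : ℝ → ℝ}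

lemma energy_eq (s t : ℝ) (V K Q : R3 → ℝ) (f : ℝ → ℝ) (u : R3 → ℝ) :
    energy s t V K Q f u = 1 / 2 * quad s V u + 1 / 4 * coulomb t u
      - (∫ x, K x * primitive f (u x)) - 1 / critExp s * ∫ x, Q x * |u x| ^ critExp s := rfl

lemma nehariFunctional_eq (s t : ℝ) (V K Q : R3 → ℝ) (f : ℝ → ℝ) (u : R3 → ℝ) :
    nehariFunctional s t V K Q f u = quad s V u + coulomb t u
      - (∫ x, K x * (f (u x) * u x)) - ∫ x, Q x * |u x| ^ critExp s := rfl

namespace IsCoeffs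

lemma V_pos (hc : IsCoeffs V K Q) (x : R3) : 0 < V x := by
  obtain ⟨v₀, h0, h⟩ := hc.V_lower
  exact h0.trans_le (h x)

lemma integrable_V (hc : IsCoeffs V K Q) (hs : s ∈ Ioo (0 : ℝ) 1) {u : R3 → ℝ} (hu : MemH s u) :
    Integrable fun x => V x * u x ^ 2 := by
  obtain ⟨M, -, hM⟩ := hc.bounded
  exact integrable_mul_comp hs hc.contV (fun x => (hM x).1)
    (isGrowthLipschitz_sq (two_lt_critExp hs).le) hu

lemma integrable_K (hc : IsCoeffs V K Q) (hs : s ∈ Ioo (0 : ℝ) 1) {Φ : ℝ → ℝ}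
    (hΦ : IsGrowthLipschitz (critExp s) Φ) {u : R3 → ℝ} (hu : MemH s u) :
    Integrable fun x => K x * Φ (u x) := by
  obtain ⟨M, -, hM⟩ := hc.bounded
  exact integrable_mul_comp hs hc.contK (fun x => (hM x).2.1) hΦ hu

lemma integrable_Q (hc : IsCoeffs V K Q) (hs : s ∈ Ioo (0 : ℝ) 1) {u : R3 → ℝ} (hu : MemH s u) :
    Integrable fun x => Q x * |u x| ^ critExp s := by
  obtain ⟨M, -, hM⟩ := hc.bounded
  exact integrable_mul_comp hs hc.contQ (fun x => (hM x).2.2)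
    (isGrowthLipschitz_abs_rpow (two_lt_critExp hs).le) hu

lemma memHV (hc : IsCoeffs V K Q) (hs : s ∈ Ioo (0 : ℝ) 1) {u : R3 → ℝ} (hu : MemH s u) :
    MemHV s V u := ⟨hu, hc.integrable_V hs hu⟩

lemma integral_V_nonneg (hc : IsCoeffs V K Q) (u : R3 → ℝ) : 0 ≤ ∫ x, V x * u x ^ 2 :=
  integral_nonneg fun x => mul_nonneg (hc.V_pos x).le (sq_nonneg _)

lemma quad_nonneg (hc : IsCoeffs V K Q) (hs : s ∈ Ioo (0 : ℝ) 1) (u : R3 → ℝ) :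
    0 ≤ quad s V u :=
  add_nonneg (fracForm_self_nonneg hs u) (hc.integral_V_nonneg u)

lemma integral_Q_nonneg (hc : IsCoeffs V K Q) (u : R3 → ℝ) :
    0 ≤ ∫ x, Q x * |u x| ^ critExp s :=
  integral_nonneg fun x => mul_nonneg (hc.Q_pos x).le (by positivity)

lemma integral_Q_pos (hc : IsCoeffs V K Q) (hs : s ∈ Ioo (0 : ℝ) 1) {u : R3 → ℝ} (hu : MemH s u)
    (h0 : ¬ u =ᵐ[volume] 0) : 0 < ∫ x, Q x * |u x| ^ critExp s := by
  refine (hc.integral_Q_nonneg u).lt_of_ne' fun h => h0 ?_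
  have := (integral_eq_zero_iff_of_nonneg
    (fun x => mul_nonneg (hc.Q_pos x).le (by positivity)) (hc.integrable_Q hs hu)).1 h
  filter_upwards [this] with x hx
  have hx' : |u x| ^ critExp s = 0 := by simpa [(hc.Q_pos x).ne'] using hx
  simpa using ((Real.rpow_eq_zero_iff_of_nonneg (abs_nonneg _)).1 hx').1

end IsCoeffs

lemma quad_smul (s : ℝ) (V : R3 → ℝ) (c : ℝ) (u : R3 → ℝ) :
    quad s V (c • u) = c ^ 2 * quad s V u := by
  rw [quad, quad, fracForm_smul_self, mul_add, ← integral_const_mul]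
  simp only [Pi.smul_apply, smul_eq_mul, mul_pow, mul_left_comm]

lemma integral_Q_smul (Q : R3 → ℝ) (r : ℝ) {c : ℝ} (hc : 0 ≤ c) (u : R3 → ℝ) :
    ∫ x, Q x * |(c • u) x| ^ r = c ^ r * ∫ x, Q x * |u x| ^ r := by
  rw [← integral_const_mul]
  simp only [Pi.smul_apply, smul_eq_mul, abs_mul, abs_of_nonneg hc,
    Real.mul_rpow hc (abs_nonneg _), mul_left_comm]

lemma energy_smul (hs : s ∈ Ioo (3 / 4 : ℝ) 1) (ht : t ∈ Ioo (0 : ℝ) 1) {u : R3 → ℝ}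
    (hu : MemH s u) {c : ℝ} (hc : 0 ≤ c) :
    energy s t V K Q f (c • u) = c ^ 2 / 2 * quad s V u + c ^ 4 / 4 * coulomb t u
      - (∫ x, K x * primitive f (c * u x))
      - c ^ critExp s / critExp s * ∫ x, Q x * |u x| ^ critExp s := by
  rw [energy_eq, quad_smul, coulomb_smul ht (hu.isSource hs ht), integral_Q_smul _ _ hc]
  simp only [Pi.smul_apply, smul_eq_mul]
  ring

/-- On the whole space the energy dominates a quarter of the Nehari functional. -/
lemma nehariFunctional_le_four_mul_energy (hs : s ∈ Ioo (3 / 4 : ℝ) 1)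
    (hf : IsAdmissible s f) (hc : IsCoeffs V K Q) {u : R3 → ℝ} (hu : MemH s u) :
    nehariFunctional s t V K Q f u ≤ 4 * energy s t V K Q f u := by
  have hs' := mem_Ioo_zero_one hs
  have hr := four_lt_critExp hs
  have h1 := hc.quad_nonneg hs' u
  have h2 := hc.integral_Q_nonneg (s := s) u
  have h3 : 4 * ∫ x, K x * primitive f (u x) ≤ ∫ x, K x * (f (u x) * u x) := by
    rw [← integral_const_mul]
    refine integral_mono ((hc.integrable_K hs' (hf.isGrowthLipschitz_primitive hs) hu).const_mul _)
      (hc.integrable_K hs' (hf.isGrowthLipschitz_mul_self hs) hu) fun x => ?_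
    have := hf.four_mul_primitive_le (u x)
    have := hc.K_pos x
    simp only
    nlinarith
  have h4 : 4 * (1 / critExp s * ∫ x, Q x * |u x| ^ critExp s)
      ≤ ∫ x, Q x * |u x| ^ critExp s := by
    rw [← mul_assoc]
    refine mul_le_of_le_one_left h2 ?_
    rw [mul_one_div, div_le_one (by linarith)]; exact hr.le
  rw [energy_eq, nehariFunctional_eq]
  linarith

/-- Along the ray through a point of the Nehari manifold the energy is maximal at that point. -/
lemma energy_smul_le_of_mem_nehari (hs : s ∈ Ioo (3 / 4 : ℝ) 1) (ht : t ∈ Ioo (0 : ℝ) 1)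
    (hf : IsAdmissible s f) (hc : IsCoeffs V K Q) {u : R3 → ℝ} (hu : u ∈ nehari s t V K Q f)
    {τ : ℝ} (hτ : 0 ≤ τ) : energy s t V K Q f (τ • u) ≤ energy s t V K Q f u := by
  obtain ⟨⟨huH, -⟩, -, hN⟩ := hu
  have hs' := mem_Ioo_zero_one hs
  have hr := four_lt_critExp hs
  have h1 := hc.quad_nonneg hs' u
  have h2 := hc.integral_Q_nonneg (s := s) u
  have hF := hf.isGrowthLipschitz_primitive hs
  have hfi := hc.integrable_K hs' (hf.isGrowthLipschitz_mul_self hs) huH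
  have hFi := hc.integrable_K hs' hF huH
  have hFτ : Integrable fun x => K x * primitive f (τ * u x) :=
    hc.integrable_K hs' hF (huH.smul τ)
  have h3 : (∫ x, K x * primitive f (u x)) - ∫ x, K x * primitive f (τ * u x)
      ≤ (1 - τ ^ 4) / 4 * ∫ x, K x * (f (u x) * u x) := by
    rw [← integral_sub hFi hFτ, ← integral_const_mul]
    refine integral_mono (hFi.sub hFτ) (hfi.const_mul _) fun x => ?_
    have := hf.primitive_sub_primitive_le hτ (u x)
    have := mul_le_mul_of_nonneg_left this (hc.K_pos x).le
    simp only
    linarith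
  -- Bernoulli's inequality for `τ^4` with exponent `critExp s / 4 ≥ 1`.
  have h4 : 0 ≤ (1 - τ ^ 4) / 4 - (1 - τ ^ critExp s) / critExp s := by
    set ρ := critExp s / 4 with hρ
    have hρ1 : 1 ≤ ρ := by rw [hρ]; linarith
    have hb := one_add_mul_self_le_rpow_one_add (s := τ ^ 4 - 1) (by linarith [pow_nonneg hτ 4]) hρ1
    have e : (1 + (τ ^ 4 - 1)) ^ ρ = τ ^ critExp s := by
      rw [add_sub_cancel, ← Real.rpow_natCast, ← Real.rpow_mul hτ]
      congr 1; rw [hρ]; push_cast; ring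
    rw [e, hρ] at hb
    have : (1 - τ ^ critExp s) / critExp s ≤ (1 - τ ^ 4) / 4 := by
      rw [div_le_div_iff₀ (by linarith) (by norm_num)]
      linarith
    linarith
  rw [energy_smul hs ht huH hτ, energy_eq]
  rw [nehariFunctional_eq] at hN
  have h5 : (∫ x, K x * (f (u x) * u x))
      = quad s V u + coulomb t u - ∫ x, Q x * |u x| ^ critExp s := by linarith
  rw [h5] at h3
  -- After the Nehari identity has eliminated the integral of `f(u) u`, the Coulomb terms cancel.
  -- The energy gap is at least `(1 - τ²)²/4` times the quadratic part plus the product in `h6`.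
  have h6 := mul_nonneg h4 h2
  have h7 := mul_nonneg (sq_nonneg (1 - τ ^ 2)) h1
  set A := quad s V u
  set B := coulomb t u
  set D := ∫ x, Q x * |u x| ^ critExp s
  have e1 : 1 / critExp s * D - τ ^ critExp s / critExp s * D
      = (1 - τ ^ critExp s) / critExp s * D := by ring
  nlinarith

/-! ### Continuity of the Nehari functional -/

lemma IsCoeffs.tendsto_growth (hc : IsCoeffs V K Q) (hs : s ∈ Ioo (0 : ℝ) 1) {ι : Type*}
    {l : Filter ι} {w : ι → R3 → ℝ} {u : R3 → ℝ} (hw : ∀ i, MemH s (w i)) (hu : MemH s u)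
    (h : Tendsto (fun i => quad s V (w i - u)) l (𝓝 0)) :
    Tendsto (fun i => ∫ x, ((w i x - u x) ^ 2 + |w i x - u x| ^ critExp s)) l (𝓝 0) := by
  obtain ⟨C, hC, hS⟩ := sobolev_inequality hs
  obtain ⟨v₀, hv₀, hv⟩ := hc.V_lower
  have hp := critExp_pos hs
  have hlim : Tendsto (fun i => v₀⁻¹ * quad s V (w i - u)
      + C * quad s V (w i - u) ^ (critExp s / 2)) l (𝓝 0) := by
    have h2 := h.rpow_const (p := critExp s / 2) (Or.inr (by positivity))
    rw [Real.zero_rpow (by positivity)] at h2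
    simpa using (h.const_mul v₀⁻¹).add (h2.const_mul C)
  refine squeeze_zero (fun i => integral_nonneg fun x => by positivity) (fun i => ?_) hlim
  have hd := (hw i).sub hu
  have e1 := fracForm_self_nonneg hs (w i - u)
  have e2 := hc.integral_V_nonneg (w i - u)
  have hsq := hd.integrable_sq
  have hcr := hd.integrable_critExp hs
  have h1 : ∫ x, (w i - u) x ^ 2 ≤ v₀⁻¹ * quad s V (w i - u) := by
    rw [inv_mul_eq_div, le_div_iff₀ hv₀, mul_comm, ← integral_const_mul]
    refine le_trans ?_ (le_add_of_nonneg_left e1)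
    exact integral_mono (hsq.const_mul _) (hc.integrable_V hs hd) fun x =>
      mul_le_mul_of_nonneg_right (hv x) (sq_nonneg _)
  have h2 : ∫ x, |(w i - u) x| ^ critExp s ≤ C * quad s V (w i - u) ^ (critExp s / 2) := by
    refine (hS _ hd.memG hcr).trans ?_
    have : fracForm s (w i - u) (w i - u) ≤ quad s V (w i - u) := le_add_of_nonneg_right e2
    gcongr
  have e : ∫ x, ((w i x - u x) ^ 2 + |w i x - u x| ^ critExp s)
      = (∫ x, (w i - u) x ^ 2) + ∫ x, |(w i - u) x| ^ critExp s := integral_add hsq hcr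
  rw [e]
  exact add_le_add h1 h2

lemma IsCoeffs.tendsto_quad (hc : IsCoeffs V K Q) (hs : s ∈ Ioo (0 : ℝ) 1) {ι : Type*}
    {l : Filter ι} {w : ι → R3 → ℝ} {u : R3 → ℝ} (hw : ∀ i, MemH s (w i)) (hu : MemH s u)
    (h : Tendsto (fun i => quad s V (w i - u)) l (𝓝 0)) :
    Tendsto (fun i => quad s V (w i)) l (𝓝 (quad s V u)) := by
  obtain ⟨M, -, hM⟩ := hc.bounded
  refine Tendsto.add ?_ (tendsto_integral_mul_comp hs hc.contV (fun x => (hM x).1)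
    (isGrowthLipschitz_sq (two_lt_critExp hs).le) hw hu (hc.tendsto_growth hs hw hu h))
  have hd : Tendsto (fun i => fracForm s (w i - u) (w i - u)) l (𝓝 0) :=
    squeeze_zero (fun i => fracForm_self_nonneg hs _)
      (fun i => le_add_of_nonneg_right (hc.integral_V_nonneg _)) h
  have hcross : Tendsto (fun i => fracForm s u (w i - u)) l (𝓝 0) := by
    rw [tendsto_zero_iff_abs_tendsto_zero]
    refine squeeze_zero (fun i => abs_nonneg _) (fun i => Real.abs_le_sqrt
      (fracForm_sq_le hu.memG ((hw i).sub hu).memG)) ?_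
    simpa using (hd.const_mul (fracForm s u u)).sqrt
  have e : ∀ i, fracForm s (w i) (w i) = fracForm s u u + 2 * fracForm s u (w i - u)
      + fracForm s (w i - u) (w i - u) := by
    intro i
    have e' : w i = u + (1 : ℝ) • (w i - u) := by simp
    conv_lhs => rw [e']
    rw [fracForm_add_smul_self hu.memG ((hw i).sub hu).memG]; ring
  simp only [e]
  simpa using (tendsto_const_nhds.add (hcross.const_mul 2)).add hd

lemma IsCoeffs.tendsto_nehariFunctional (hc : IsCoeffs V K Q) (hs : s ∈ Ioo (3 / 4 : ℝ) 1)
    (ht : t ∈ Ioo (0 : ℝ) 1) (hf : IsAdmissible s f) {ι : Type*}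
    {l : Filter ι} {w : ι → R3 → ℝ} {u : R3 → ℝ} (hw : ∀ i, MemH s (w i)) (hu : MemH s u)
    (h : Tendsto (fun i => quad s V (w i - u)) l (𝓝 0)) :
    Tendsto (fun i => nehariFunctional s t V K Q f (w i)) l
      (𝓝 (nehariFunctional s t V K Q f u)) := by
  have hs' := mem_Ioo_zero_one hs
  obtain ⟨M, -, hM⟩ := hc.bounded
  have hg := hc.tendsto_growth hs' hw hu h
  exact (((hc.tendsto_quad hs' hw hu h).add (tendsto_coulomb_of_memH hs ht hw hu hg)).sub
    (tendsto_integral_mul_comp hs' hc.contK (fun x => (hM x).2.1)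
      (hf.isGrowthLipschitz_mul_self hs) hw hu hg)).sub
    (tendsto_integral_mul_comp hs' hc.contQ (fun x => (hM x).2.2)
      (isGrowthLipschitz_abs_rpow (two_lt_critExp hs').le) hw hu hg)

/-- The Nehari functional is positive on a punctured ball. -/
lemma IsCoeffs.exists_nehariFunctional_pos (hc : IsCoeffs V K Q) (hs : s ∈ Ioo (3 / 4 : ℝ) 1)
    (ht : t ∈ Ioo (0 : ℝ) 1) (hf : IsAdmissible s f) :
    ∃ ρ : ℝ, 0 < ρ ∧ ∀ u, MemH s u → quad s V u ≤ ρ →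
      quad s V u / 4 ≤ nehariFunctional s t V K Q f u := by
  have hs' := mem_Ioo_zero_one hs
  have hr := four_lt_critExp hs
  obtain ⟨C, hC, hS⟩ := sobolev_inequality hs'
  obtain ⟨v₀, hv₀, hv⟩ := hc.V_lower
  obtain ⟨M, hM0, hM⟩ := hc.bounded
  -- With this `η` the quadratic part of `K f(u) u` is absorbed by half of the potential term.
  obtain ⟨D, hD, hfD⟩ := hf.mul_self_le hs (η := v₀ / (2 * M)) (by positivity)
  set E := (M * D + M) * C with hE
  have hE0 : 0 < E := by positivity
  set κ := critExp s / 2 - 1 with hκ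
  have hκ0 : 0 < κ := by rw [hκ]; linarith
  -- Below this radius the critical terms cost at most a quarter of `quad s V u`. Together with the
  -- half already spent, a quarter remains.
  refine ⟨(1 / (4 * E)) ^ (1 / κ), by positivity, fun u hu hρ => ?_⟩
  have hA := hc.quad_nonneg hs' u
  have hN := fracForm_self_nonneg hs' u
  have hVn := hc.integral_V_nonneg u
  have hB := coulomb_nonneg ht (hu.isSource hs ht)
  have hcr := hu.integrable_critExp hs'
  have hsq := hu.integrable_sq
  have hK : ∫ x, K x * (f (u x) * u x)
      ≤ 1 / 2 * (∫ x, V x * u x ^ 2) + M * D * ∫ x, |u x| ^ critExp s := by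
    rw [← integral_const_mul, ← integral_const_mul,
      ← integral_add ((hc.integrable_V hs' hu).const_mul _) (hcr.const_mul _)]
    refine integral_mono (hc.integrable_K hs' (hf.isGrowthLipschitz_mul_self hs) hu)
      (((hc.integrable_V hs' hu).const_mul _).add (hcr.const_mul _)) fun x => ?_
    have h1 : K x ≤ M := (le_abs_self _).trans (hM x).2.1
    calc K x * (f (u x) * u x) ≤ M * (f (u x) * u x) :=
          mul_le_mul_of_nonneg_right h1 (hf.mul_self_nonneg _)
      _ ≤ M * (v₀ / (2 * M) * u x ^ 2 + D * |u x| ^ critExp s) := by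
          gcongr; exact hfD _
      _ = 1 / 2 * (v₀ * u x ^ 2) + M * D * |u x| ^ critExp s := by field_simp
      _ ≤ 1 / 2 * (V x * u x ^ 2) + M * D * |u x| ^ critExp s := by
          gcongr; exact hv x
  have hQ : ∫ x, Q x * |u x| ^ critExp s ≤ M * ∫ x, |u x| ^ critExp s := by
    rw [← integral_const_mul]
    refine integral_mono (hc.integrable_Q hs' hu) (hcr.const_mul _) fun x => ?_
    exact mul_le_mul_of_nonneg_right ((le_abs_self _).trans (hM x).2.2) (by positivity)
  have hSu : ∫ x, |u x| ^ critExp s ≤ C * quad s V u ^ (critExp s / 2) := by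
    refine (hS u hu.memG hcr).trans ?_
    have : fracForm s u u ≤ quad s V u := le_add_of_nonneg_right hVn
    gcongr
  have hsmall : E * quad s V u ^ (critExp s / 2) ≤ 1 / 4 * quad s V u := by
    rcases hA.eq_or_lt with h0 | h0
    · rw [← h0, Real.zero_rpow (by linarith)]; simp
    have e : quad s V u ^ (critExp s / 2) = quad s V u ^ κ * quad s V u := by
      rw [← Real.rpow_add_one h0.ne']; congr 1; rw [hκ]; ring
    have h1 : quad s V u ^ κ ≤ 1 / (4 * E) := by
      calc quad s V u ^ κ ≤ ((1 / (4 * E)) ^ (1 / κ)) ^ κ := Real.rpow_le_rpow hA hρ hκ0.le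
        _ = _ := by rw [← Real.rpow_mul (by positivity), one_div_mul_cancel hκ0.ne', Real.rpow_one]
    rw [e, ← mul_assoc]
    refine mul_le_mul_of_nonneg_right ?_ hA
    calc E * quad s V u ^ κ ≤ E * (1 / (4 * E)) := by gcongr
      _ = 1 / 4 := by field_simp
  have hsum : (M * D + M) * ∫ x, |u x| ^ critExp s ≤ E * quad s V u ^ (critExp s / 2) := by
    rw [hE, mul_assoc]
    gcongr
  rw [nehariFunctional_eq]
  have : quad s V u = fracForm s u u + ∫ x, V x * u x ^ 2 := rfl
  linarith

end

variable {s t : ℝ} {V K Q : R3 → ℝ} {f : ℝ → ℝ}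

/-! ### Mountain pass paths and the Nehari manifold -/

lemma quad_eq_zero_of_ae (s : ℝ) (V : R3 → ℝ) {u : R3 → ℝ} (hu : u =ᵐ[volume] 0) :
    quad s V u = 0 := by
  have h1 : fracForm s u u = 0 := by
    rw [fracForm_congr_ae s hu hu]; simp [fracForm]
  have h2 : ∫ x, V x * u x ^ 2 = 0 := by
    rw [integral_eq_zero_of_ae]
    filter_upwards [hu] with x hx
    simp [hx]
  rw [quad, h1, h2, add_zero]

lemma IsCoeffs.normHV_sq (hc : IsCoeffs V K Q) (hs : s ∈ Ioo (0 : ℝ) 1) (u : R3 → ℝ) :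
    normHV s V u ^ 2 = quad s V u :=
  Real.sq_sqrt (hc.quad_nonneg hs u)

/-- Every mountain pass path meets the Nehari manifold. -/
lemma exists_mem_nehari_of_mountainPath (hs : s ∈ Ioo (3 / 4 : ℝ) 1) (ht : t ∈ Ioo (0 : ℝ) 1)
    (hf : IsAdmissible s f) (hc : IsCoeffs V K Q) {γ : ℝ → R3 → ℝ}
    (hγ : γ ∈ mountainPaths s t V K Q f) :
    ∃ τ ∈ Icc (0 : ℝ) 1, γ τ ∈ nehari s t V K Q f := by
  obtain ⟨hmem, hcont, h0, h1⟩ := hγ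
  have hs' := mem_Ioo_zero_one hs
  obtain ⟨ρ, hρ, hpos⟩ := hc.exists_nehariFunctional_pos hs ht hf
  have hH : ∀ i : Icc (0 : ℝ) 1, MemH s (γ i) := fun i => (hmem i i.2).1
  have hq : ∀ j : Icc (0 : ℝ) 1,
      Tendsto (fun i : Icc (0 : ℝ) 1 => quad s V (γ i - γ j)) (𝓝 j) (𝓝 0) := by
    intro j
    have h := (tendsto_nhdsWithin_iff_subtype j.2 (fun r => normHV s V (γ r - γ j)) _).1
      (hcont j j.2)
    have h2 := h.pow 2
    simp only [domRestrict_apply, hc.normHV_sq hs'] at h2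
    simpa using h2
  have hG : Continuous fun i : Icc (0 : ℝ) 1 => nehariFunctional s t V K Q f (γ i) :=
    continuous_iff_continuousAt.2 fun j => hc.tendsto_nehariFunctional hs ht hf hH (hH j) (hq j)
  have hA : Continuous fun i : Icc (0 : ℝ) 1 => quad s V (γ i) :=
    continuous_iff_continuousAt.2 fun j => hc.tendsto_quad hs' hH (hH j) (hq j)
  have hnn : ∀ i : Icc (0 : ℝ) 1, quad s V (γ i) ≤ ρ →
      0 ≤ nehariFunctional s t V K Q f (γ i) := fun i hi => by
    have := hpos _ (hH i) hi
    have := hc.quad_nonneg hs' (γ i)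
    linarith
  have hconn : PreconnectedSpace (Icc (0 : ℝ) 1) :=
    Subtype.preconnectedSpace isPreconnected_Icc
  -- The Nehari functional already vanishes at `γ 0`, so the intermediate value theorem is applied
  -- to it with `max 0 (ρ - quad)` added. This sum is positive wherever `quad < ρ`, hence its zero
  -- lies off the small ball, where the correction vanishes and the function is nontrivial.
  obtain ⟨i, hi⟩ := mem_range_of_exists_le_of_exists_ge (c := (0 : ℝ))
    (hG.add (continuous_const.max (continuous_const.sub hA) :
      Continuous fun i : Icc (0 : ℝ) 1 => max 0 (ρ - quad s V (γ i))))
    ⟨⟨1, right_mem_Icc.2 zero_le_one⟩, by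
      set i : Icc (0 : ℝ) 1 := ⟨1, right_mem_Icc.2 zero_le_one⟩
      have hneg : nehariFunctional s t V K Q f (γ i) < 0 := by
        have := nehariFunctional_le_four_mul_energy (t := t) hs hf hc (hH i)
        have h1' : energy s t V K Q f (γ i) < 0 := h1
        linarith
      have hlt : ρ < quad s V (γ i) := by
        by_contra! hle
        linarith [hnn i hle]
      simp only [Pi.add_apply]
      rw [max_eq_left (by linarith)]
      linarith⟩
    ⟨⟨0, left_mem_Icc.2 zero_le_one⟩, by
      set i : Icc (0 : ℝ) 1 := ⟨0, left_mem_Icc.2 zero_le_one⟩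
      have hq0 : quad s V (γ i) = 0 := quad_eq_zero_of_ae s V h0
      exact add_nonneg (hnn i (by rw [hq0]; exact hρ.le)) (le_max_left _ _)⟩
  simp only [Pi.add_apply] at hi
  have hge : ρ ≤ quad s V (γ i) := by
    by_contra! hlt
    have := hnn i hlt.le
    have := le_max_right 0 (ρ - quad s V (γ i))
    linarith
  rw [max_eq_left (by linarith), add_zero] at hi
  refine ⟨i, i.2, hmem i i.2, fun hz => ?_, hi⟩
  rw [quad_eq_zero_of_ae s V hz] at hge
  linarith

/-- The segment from `0` to a function of negative energy is a mountain pass path. -/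
lemma segment_mem_mountainPaths (hs : s ∈ Ioo (3 / 4 : ℝ) 1) (hc : IsCoeffs V K Q) {u : R3 → ℝ}
    (hu : MemH s u) (hneg : energy s t V K Q f u < 0) :
    (fun τ : ℝ => τ • u) ∈ mountainPaths s t V K Q f := by
  have hs' := mem_Ioo_zero_one hs
  refine ⟨fun τ _ => hc.memHV hs' (hu.smul τ), fun τ _ => ?_, by simp, by simpa using hneg⟩
  have e : ∀ r : ℝ, normHV s V (r • u - τ • u) = Real.sqrt ((r - τ) ^ 2 * quad s V u) := by
    intro r
    rw [← sub_smul, ← quad_smul]; rfl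
  simp only [e]
  have : Continuous fun r : ℝ => Real.sqrt ((r - τ) ^ 2 * quad s V u) := by fun_prop
  simpa using (this.tendsto τ).mono_left nhdsWithin_le_nhds

/-- The bound holds for every `T ≥ T₀`, not just for one `T`, because it also confines the
projection parameters in `not_ae_eq_zero_of_minimizer`. -/
lemma exists_forall_quartic_lt_rpow {r : ℝ} (hr : 4 < r) (A B : ℝ) {D : ℝ} (hD : 0 < D) :
    ∃ T₀ : ℝ, 0 < T₀ ∧ ∀ T, T₀ ≤ T → T ^ 2 * A + T ^ 4 * B < T ^ r * D := by
  set S := |A| + |B| + 1 with hS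
  have hS0 : 0 < S := by positivity
  refine ⟨max 1 ((S / D) ^ (1 / (r - 4))), by positivity, fun T hT => ?_⟩
  have hT1 : 1 ≤ T := (le_max_left _ _).trans hT
  have hT0 : 0 < T := by linarith
  have h1 : S / D ≤ T ^ (r - 4) := by
    have := Real.rpow_le_rpow (by positivity) ((le_max_right _ _).trans hT)
      (by linarith : 0 ≤ r - 4)
    rwa [← Real.rpow_mul (by positivity), one_div_mul_cancel (by linarith), Real.rpow_one] at this
  rw [div_le_iff₀ hD] at h1
  have e : T ^ r = T ^ 4 * T ^ (r - 4) := by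
    rw [← Real.rpow_natCast T 4, ← Real.rpow_add hT0]; congr 1; push_cast; ring
  have h2 : T ^ 2 ≤ T ^ 4 := pow_le_pow_right₀ hT1 (by norm_num)
  have h3 : T ^ 2 * A ≤ T ^ 4 * |A| := by
    calc T ^ 2 * A ≤ T ^ 2 * |A| := by gcongr; exact le_abs_self A
      _ ≤ _ := by gcongr
  have h4 : T ^ 4 * B ≤ T ^ 4 * |B| := by gcongr; exact le_abs_self B
  have h5 : 0 < T ^ 4 := by positivity
  have h6 := mul_le_mul_of_nonneg_left h1 h5.le
  rw [hS] at h6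
  rw [e]
  nlinarith

lemma exists_energy_smul_neg (hs : s ∈ Ioo (3 / 4 : ℝ) 1) (ht : t ∈ Ioo (0 : ℝ) 1)
    (hf : IsAdmissible s f) (hc : IsCoeffs V K Q) {u : R3 → ℝ} (hu : MemH s u)
    (h0 : ¬ u =ᵐ[volume] 0) : ∃ T : ℝ, 0 < T ∧ energy s t V K Q f (T • u) < 0 := by
  have hr := four_lt_critExp hs
  have hD := hc.integral_Q_pos (mem_Ioo_zero_one hs) hu h0
  obtain ⟨T, hT, h⟩ := exists_forall_quartic_lt_rpow hr (quad s V u / 2) (coulomb t u / 4)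
    (D := (∫ x, Q x * |u x| ^ critExp s) / critExp s) (by positivity)
  refine ⟨T, hT, ?_⟩
  rw [energy_smul hs ht hu hT.le]
  have h1 := h T le_rfl
  have h2 : 0 ≤ ∫ x, K x * primitive f (T * u x) :=
    integral_nonneg fun x => mul_nonneg (hc.K_pos x).le (hf.primitive_nonneg _)
  rw [mul_div_assoc', mul_div_assoc', mul_div_assoc'] at h1
  rw [div_mul_eq_mul_div, div_mul_eq_mul_div, div_mul_eq_mul_div]
  linarith

/-- Every ray meets the Nehari manifold. -/
lemma exists_smul_mem_nehari (hs : s ∈ Ioo (3 / 4 : ℝ) 1) (ht : t ∈ Ioo (0 : ℝ) 1)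
    (hf : IsAdmissible s f) (hc : IsCoeffs V K Q) {u : R3 → ℝ} (hu : MemH s u)
    (h0 : ¬ u =ᵐ[volume] 0) : ∃ τ : ℝ, 0 < τ ∧ τ • u ∈ nehari s t V K Q f := by
  obtain ⟨T, hT, hneg⟩ := exists_energy_smul_neg hs ht hf hc hu h0
  obtain ⟨τ, hτ, hN⟩ := exists_mem_nehari_of_mountainPath hs ht hf hc
    (segment_mem_mountainPaths hs hc (hu.smul T) hneg)
  simp only [smul_smul] at hN
  refine ⟨τ * T, lt_of_le_of_ne (mul_nonneg hτ.1 hT.le) fun h => hN.2.1 ?_, hN⟩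
  rw [← h, zero_smul]

/-! ### Comparison of the levels -/

lemma energy_mono (hs : s ∈ Ioo (3 / 4 : ℝ) 1) (hf : IsAdmissible s f) {V' K' Q' : R3 → ℝ}
    (hc : IsCoeffs V K Q) (hc' : IsCoeffs V' K' Q') (hV : ∀ x, V' x ≤ V x) (hK : ∀ x, K x ≤ K' x)
    (hQ : ∀ x, Q x ≤ Q' x) {u : R3 → ℝ} (hu : MemH s u) :
    energy s t V' K' Q' f u ≤ energy s t V K Q f u := by
  have hs' := mem_Ioo_zero_one hs
  have hr := critExp_pos hs'
  have hF := hf.isGrowthLipschitz_primitive hs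
  have h1 : ∫ x, V' x * u x ^ 2 ≤ ∫ x, V x * u x ^ 2 :=
    integral_mono (hc'.integrable_V hs' hu) (hc.integrable_V hs' hu) fun x =>
      mul_le_mul_of_nonneg_right (hV x) (sq_nonneg _)
  have h2 : ∫ x, K x * primitive f (u x) ≤ ∫ x, K' x * primitive f (u x) :=
    integral_mono (hc.integrable_K hs' hF hu) (hc'.integrable_K hs' hF hu) fun x =>
      mul_le_mul_of_nonneg_right (hK x) (hf.primitive_nonneg _)
  have h3 : ∫ x, Q x * |u x| ^ critExp s ≤ ∫ x, Q' x * |u x| ^ critExp s :=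
    integral_mono (hc.integrable_Q hs' hu) (hc'.integrable_Q hs' hu) fun x =>
      mul_le_mul_of_nonneg_right (hQ x) (by positivity)
  have h4 := mul_le_mul_of_nonneg_left h3 (by positivity : 0 ≤ 1 / critExp s)
  rw [energy_eq, energy_eq, quad, quad]
  linarith

lemma leastEnergy_le_mountainPassLevel (hs : s ∈ Ioo (3 / 4 : ℝ) 1) (ht : t ∈ Ioo (0 : ℝ) 1)
    (hf : IsAdmissible s f) (hc : IsCoeffs V K Q) :
    leastEnergy s t V K Q f ≤ mountainPassLevel s t V K Q f := by
  refine le_iInf₂ fun γ hγ => ?_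
  obtain ⟨τ, hτ, hN⟩ := exists_mem_nehari_of_mountainPath hs ht hf hc hγ
  exact (iInf₂_le (γ τ) hN).trans
    (le_iSup₂ (f := fun τ (_ : τ ∈ Icc (0 : ℝ) 1) => (energy s t V K Q f (γ τ) : EReal)) τ hτ)

/-- For `u` on the upper manifold, let `τ • u` be its projection to the lower one. The lower energy
of `τ • u` is at most its upper energy, which is at most that of `u` by maximality along the ray. -/
lemma leastEnergy_mono (hs : s ∈ Ioo (3 / 4 : ℝ) 1) (ht : t ∈ Ioo (0 : ℝ) 1)
    (hf : IsAdmissible s f) {V' K' Q' : R3 → ℝ}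
    (hc : IsCoeffs V K Q) (hc' : IsCoeffs V' K' Q') (hV : ∀ x, V' x ≤ V x) (hK : ∀ x, K x ≤ K' x)
    (hQ : ∀ x, Q x ≤ Q' x) : leastEnergy s t V' K' Q' f ≤ leastEnergy s t V K Q f := by
  refine le_iInf₂ fun u hu => ?_
  obtain ⟨τ, hτ, hN⟩ := exists_smul_mem_nehari hs ht hf hc' hu.1.1 hu.2.1
  refine (iInf₂_le (τ • u) hN).trans (EReal.coe_le_coe_iff.2 ?_)
  exact (energy_mono hs hf hc hc' hV hK hQ (hu.1.1.smul τ)).trans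
    (energy_smul_le_of_mem_nehari hs ht hf hc hu hτ.le)

lemma energy_translate (hs : s ∈ Ioo (3 / 4 : ℝ) 1) (ht : t ∈ Ioo (0 : ℝ) 1) (V K Q : R3 → ℝ)
    (f : ℝ → ℝ) {u : R3 → ℝ} (hu : MemH s u) (a : R3) :
    energy s t V K Q f (translate (-a) u)
      = energy s t (translate a V) (translate a K) (translate a Q) f u := by
  have key : ∀ (W : R3 → ℝ) (Φ : ℝ → ℝ),
      ∫ x, W x * Φ (translate (-a) u x) = ∫ x, translate a W x * Φ (u x) := by
    intro W Φ
    rw [← integral_translate a]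
    simp [translate]
  rw [energy_eq, energy_eq, quad, quad, fracForm_translate,
    coulomb_translate ht (hu.isSource hs ht), key V (fun y => y ^ 2), key K (primitive f),
    key Q (fun y => |y| ^ critExp s)]

/-- A coefficient with a limit at infinity may be replaced by its limit after a far translation. -/
lemma tendsto_integral_translate_sub {W : R3 → ℝ} (hW : Continuous W) {M : ℝ}
    (hM : ∀ x, |W x| ≤ M) {Winf : ℝ} (hlim : Tendsto W (cocompact R3) (𝓝 Winf)) {g : R3 → ℝ}
    (hg : Integrable g) :
    Tendsto (fun a => ∫ x, (translate a W x - Winf) * g x) (cocompact R3) (𝓝 0) := by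
  have : (cocompact R3).IsCountablyGenerated := by
    rw [← Metric.cobounded_eq_cocompact, ← comap_norm_atTop]; infer_instance
  have h := tendsto_integral_filter_of_dominated_convergence (l := cocompact R3)
    (F := fun a x => (translate a W x - Winf) * g x) (f := fun _ => (0 : ℝ))
    (μ := (volume : Measure R3)) (bound := fun x => (M + |Winf|) * |g x|)
    (Eventually.of_forall fun a => ?_) (Eventually.of_forall fun a => ae_of_all _ fun x => ?_)
    (hg.abs.const_mul _) (ae_of_all _ fun x => ?_)
  · simpa using h
  · have : Continuous fun x => translate a W x - Winf :=
      (hW.comp (continuous_add_const a)).sub continuous_const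
    exact this.aestronglyMeasurable.mul hg.1
  · rw [Real.norm_eq_abs, abs_mul]
    refine mul_le_mul_of_nonneg_right ((abs_sub _ _).trans ?_) (abs_nonneg _)
    exact add_le_add_left (hM _) _
  · have h1 : Tendsto (fun a : R3 => x + a) (cocompact R3) (cocompact R3) :=
      (Homeomorph.addLeft x).isClosedEmbedding.tendsto_cocompact
    have h2 := ((hlim.comp h1).sub_const Winf).mul_const (g x)
    simpa [translate] using h2

/-- For `u ∈ 𝒩_∞` and a far translation, the energy along the segment through the translate of `T •
u` is close to the limit energy along the ray of `u`, whose maximum is attained at `u`. -/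
lemma mountainPassLevel_le_leastEnergy (hs : s ∈ Ioo (3 / 4 : ℝ) 1) (ht : t ∈ Ioo (0 : ℝ) 1)
    (hf : IsAdmissible s f) {Vinf Kinf Qinf : ℝ} (hc : IsCoeffs V K Q)
    (hc' : IsCoeffs (fun _ => Vinf) (fun _ => Kinf) (fun _ => Qinf))
    (hVlim : Tendsto V (cocompact R3) (𝓝 Vinf)) (hKlim : Tendsto K (cocompact R3) (𝓝 Kinf))
    (hQlim : Tendsto Q (cocompact R3) (𝓝 Qinf)) (hV : ∀ x, Vinf ≤ V x) (hK : ∀ x, K x ≤ Kinf)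
    (hQ : ∀ x, Q x ≤ Qinf) :
    mountainPassLevel s t V K Q f
      ≤ leastEnergy s t (fun _ => Vinf) (fun _ => Kinf) (fun _ => Qinf) f := by
  have hs' := mem_Ioo_zero_one hs
  have hr := critExp_pos hs'
  have hF := hf.isGrowthLipschitz_primitive hs
  obtain ⟨M, -, hM⟩ := hc.bounded
  refine le_iInf₂ fun u hu => ?_
  have huH := hu.1.1
  set E := energy s t (fun _ => Vinf) (fun _ => Kinf) (fun _ => Qinf) f with hE
  obtain ⟨T, hT, hneg⟩ := exists_energy_smul_neg hs ht hf hc' huH hu.2.1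
  have hsq := huH.integrable_sq
  have hcr := huH.integrable_critExp hs'
  have hFT : Integrable fun x => primitive f (T * u x) := by
    simpa using integrable_mul_comp hs' (W := fun _ => 1) continuous_const (M := 1) (by simp) hF
      (huH.smul T)
  have hlim := (((tendsto_integral_translate_sub hc.contV (fun x => (hM x).1) hVlim hsq).const_mul
    (T ^ 2 / 2)).sub (tendsto_integral_translate_sub hc.contK (fun x => (hM x).2.1) hKlim hFT)).sub
    ((tendsto_integral_translate_sub hc.contQ (fun x => (hM x).2.2) hQlim hcr).const_mul
      (T ^ critExp s / critExp s))
  simp only [mul_zero, sub_zero] at hlim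
  refine EReal.le_of_forall_lt_iff_le.1 fun z hz => ?_
  have hz' : E u < z := EReal.coe_lt_coe_iff.1 hz
  -- The two entries of the minimum keep the path below `z` and its end point below `0`.
  obtain ⟨a, ha⟩ := (hlim.eventually (gt_mem_nhds (show 0 < min (z - E u) (-E (T • u)) from
    lt_min (by linarith) (by linarith)))).exists
  have hia : ∀ {W : R3 → ℝ} (_ : Continuous W) (_ : ∀ x, |W x| ≤ M) {Φ : ℝ → ℝ}
      (_ : IsGrowthLipschitz (critExp s) Φ) {w : R3 → ℝ} (_ : MemH s w),
      Integrable fun x => translate a W x * Φ (w x) := fun hW hWM _ hΦ _ hw =>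
    integrable_mul_comp hs' (hW.comp (continuous_add_const a)) (fun x => hWM _) hΦ hw
  -- The three discrepancies have a fixed sign and their sizes increase with `τ`, by the one-sided
  -- bounds on the coefficients and monotonicity of `primitive f`. The single estimate at `T`
  -- therefore covers the whole segment.
  have hgap : ∀ τ : ℝ, 0 ≤ τ → τ ≤ T → energy s t V K Q f (translate (-a) (τ • u))
      < E (τ • u) + min (z - E u) (-E (T • u)) := by
    intro τ hτ hτT
    refine lt_of_le_of_lt ?_ (add_lt_add_right ha _)
    have hτu := huH.smul τ
    rw [energy_translate hs ht V K Q f hτu a, energy_smul hs ht huH hτ, hE,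
      energy_smul hs ht huH hτ, quad, quad]
    have hV1 := hia hc.contV (fun x => (hM x).1) (isGrowthLipschitz_sq (two_lt_critExp hs').le) huH
    have hK1 : Integrable fun x => translate a K x * primitive f (τ * u x) :=
      hia hc.contK (fun x => (hM x).2.1) hF hτu
    have hK2 : Integrable fun x => translate a K x * primitive f (T * u x) :=
      hia hc.contK (fun x => (hM x).2.1) hF (huH.smul T)
    have hK3 : Integrable fun x => Kinf * primitive f (τ * u x) :=
      hc'.integrable_K hs' hF hτu
    have hQ1 := hia hc.contQ (fun x => (hM x).2.2)
      (isGrowthLipschitz_abs_rpow (two_lt_critExp hs').le) huH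
    have eV : ∫ x, (translate a V x - Vinf) * u x ^ 2
        = (∫ x, translate a V x * u x ^ 2) - ∫ x, Vinf * u x ^ 2 := by
      rw [← integral_sub hV1 (hc'.integrable_V hs' huH)]; simp only [sub_mul]
    have eQ : ∫ x, (translate a Q x - Qinf) * |u x| ^ critExp s
        = (∫ x, translate a Q x * |u x| ^ critExp s) - ∫ x, Qinf * |u x| ^ critExp s := by
      rw [← integral_sub hQ1 (hc'.integrable_Q hs' huH)]; simp only [sub_mul]
    have eK : ∫ x, (translate a K x - Kinf) * primitive f (T * u x)
        ≤ (∫ x, translate a K x * primitive f (τ * u x)) - ∫ x, Kinf * primitive f (τ * u x) := by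
      rw [← integral_sub hK1 hK3]
      refine integral_mono ?_ (hK1.sub hK3) fun x => ?_
      · simp only [sub_mul]
        exact hK2.sub (hc'.integrable_K hs' hF (huH.smul T))
      · have h1 : primitive f (τ * u x) ≤ primitive f (T * u x) := by
          rcases le_or_gt (u x) 0 with h | h
          · rw [hf.primitive_of_nonpos (mul_nonpos_of_nonneg_of_nonpos hτ h),
              hf.primitive_of_nonpos (mul_nonpos_of_nonneg_of_nonpos hT.le h)]
          · exact hf.primitive_mono (mul_le_mul_of_nonneg_right hτT h.le)
        have h2 : translate a K x ≤ Kinf := hK _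
        simp only
        nlinarith
    have hV0 : 0 ≤ ∫ x, (translate a V x - Vinf) * u x ^ 2 :=
      integral_nonneg fun x => mul_nonneg (sub_nonneg.2 (hV _)) (sq_nonneg _)
    have hQ0 : ∫ x, (translate a Q x - Qinf) * |u x| ^ critExp s ≤ 0 :=
      integral_nonpos fun x => mul_nonpos_of_nonpos_of_nonneg (sub_nonpos.2 (hQ _)) (by positivity)
    have hτ2 : τ ^ 2 / 2 ≤ T ^ 2 / 2 := by gcongr
    have hτr : τ ^ critExp s / critExp s ≤ T ^ critExp s / critExp s := by gcongr
    have m1 := mul_le_mul_of_nonneg_right hτ2 hV0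
    have m2 := mul_le_mul_of_nonpos_right hτr hQ0
    rw [eV] at m1
    rw [eQ] at m2
    rw [eV, eQ]
    linarith
  have hw : MemH s (translate (-a) (T • u)) := (huH.smul T).translate (-a)
  have hwneg : energy s t V K Q f (translate (-a) (T • u)) < 0 := by
    have := hgap T hT.le le_rfl
    have := min_le_right (z - E u) (-E (T • u))
    linarith
  refine (iInf₂_le _ (segment_mem_mountainPaths hs hc hw hwneg)).trans (iSup₂_le fun τ hτ => ?_)
  refine EReal.coe_le_coe_iff.2 ?_
  have e : τ • translate (-a) (T • u) = translate (-a) ((τ * T) • u) := by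
    rw [mul_smul]; rfl
  simp only [e]
  have h1 := hgap (τ * T) (mul_nonneg hτ.1 hT.le) (mul_le_of_le_one_left hT.le hτ.2)
  have h2 := energy_smul_le_of_mem_nehari hs ht hf hc' hu (mul_nonneg hτ.1 hT.le)
  have h3 := min_le_left (z - E u) (-E (T • u))
  linarith

/-! ### Minimizers on the Nehari manifold -/

/-- A minimizer of the energy on the Nehari manifold is nonnegative. -/
lemma nonneg_of_minimizer (hs : s ∈ Ioo (3 / 4 : ℝ) 1) (ht : t ∈ Ioo (0 : ℝ) 1)
    (hf : IsAdmissible s f) (hc : IsCoeffs V K Q) {w : R3 → ℝ} (hw : w ∈ nehari s t V K Q f)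
    (hmin : ∀ w' ∈ nehari s t V K Q f, energy s t V K Q f w ≤ energy s t V K Q f w') :
    ∀ᵐ x, 0 ≤ w x := by
  have hs' := mem_Ioo_zero_one hs
  have hF := hf.isGrowthLipschitz_primitive hs
  have hwH := hw.1.1
  have haH := hwH.abs
  have ha0 : ¬ |w| =ᵐ[volume] 0 := fun h => hw.2.1 <| by
    filter_upwards [h] with x hx
    simpa using hx
  obtain ⟨τ, hτ, hN⟩ := exists_smul_mem_nehari hs ht hf hc haH ha0
  -- The two bounds give `I(τ w) ≤ I(w) ≤ I(τ |w|)`. Passing to `|w|` does not raise the form,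
  -- preserves the other even terms and strictly raises the primitive where `w < 0`, so that set
  -- must be null.
  have h1 := hmin _ hN
  have h2 := energy_smul_le_of_mem_nehari hs ht hf hc hw hτ.le
  have hcoul : coulomb t |w| = coulomb t w :=
    coulomb_congr_sq ht (haH.isSource hs ht) (ae_of_all _ fun x => sq_abs _)
  have hquad : quad s V |w| ≤ quad s V w := by
    have e := fracForm_comp_contraction_le hs' hwH.memG (g := fun x => |x|)
      (lipschitzWith_one_norm (E := ℝ))
    have e' : ∫ x, V x * |w| x ^ 2 = ∫ x, V x * w x ^ 2 := by simp only [Pi.abs_apply, sq_abs]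
    rw [quad, quad, e']
    exact add_le_add_left e _
  rw [energy_smul hs ht haH hτ.le, hcoul] at h1
  rw [energy_smul hs ht hwH hτ.le] at h2
  simp only [Pi.abs_apply, abs_abs] at h1
  have hi1 : Integrable fun x => K x * primitive f (τ * |w x|) :=
    hc.integrable_K hs' hF (haH.smul τ)
  have hi2 : Integrable fun x => K x * primitive f (τ * w x) :=
    hc.integrable_K hs' hF (hwH.smul τ)
  have hnn : ∀ x, 0 ≤ K x * primitive f (τ * |w x|) - K x * primitive f (τ * w x) := fun x => by
    rw [← mul_sub]
    exact mul_nonneg (hc.K_pos x).le (sub_nonneg.2 (hf.primitive_mono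
      (mul_le_mul_of_nonneg_left (le_abs_self _) hτ.le)))
  have hle : ∫ x, (K x * primitive f (τ * |w x|) - K x * primitive f (τ * w x)) ≤ 0 := by
    rw [integral_sub hi1 hi2]
    have := mul_le_mul_of_nonneg_left hquad (by positivity : 0 ≤ τ ^ 2 / 2)
    linarith
  have hz := (integral_eq_zero_iff_of_nonneg hnn (hi1.sub hi2)).1
    (le_antisymm hle (integral_nonneg hnn))
  filter_upwards [hz] with x hx
  by_contra! hneg
  have h3 : primitive f (τ * w x) = 0 :=
    hf.primitive_of_nonpos (mul_nonpos_of_nonneg_of_nonpos hτ.le hneg.le)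
  have h4 : 0 < primitive f (τ * |w x|) := hf.primitive_pos (mul_pos hτ (abs_pos.2 hneg.ne))
  have hx' : K x * primitive f (τ * |w x|) - K x * primitive f (τ * w x) = 0 := hx
  rw [h3, mul_zero, sub_zero] at hx'
  exact (mul_pos (hc.K_pos x) h4).ne' hx'

/-- The form is negative on pairs of nonnegative functions with disjoint supports. -/
lemma fracForm_neg_of_disjoint {α : ℝ} (hα : α ∈ Ioo (0 : ℝ) 1) {u v : R3 → ℝ} (hu : MemG α u)
    (hv : MemG α v) (hu0 : ∀ᵐ x, 0 ≤ u x) (hv0 : ∀ᵐ x, 0 ≤ v x) (huv : ∀ᵐ x, u x * v x = 0)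
    (hune : ¬ u =ᵐ[volume] 0) (hvne : ¬ v =ᵐ[volume] 0) : fracForm α u v < 0 := by
  have hk := fracConst_pos hα
  -- Since `u v = 0` at both points, the numerator reduces to `-(u(x) v(y) + u(y) v(x))`.
  have hle : ∀ᵐ z : R3 × R3, 0 ≤ -(diffQuot α u z * diffQuot α v z) := by
    filter_upwards [ae_prod_of_ae hu0, ae_prod_of_ae hv0, ae_prod_of_ae huv] with z h1 h2 h3
    rw [diffQuot_mul, ← neg_div]
    refine div_nonneg ?_ (by positivity)
    nlinarith [mul_nonneg h1.1 h2.2, mul_nonneg h1.2 h2.1]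
  have hint := (hu.integrable_mul hv).neg
  have hI : 0 ≤ ∫ z, -(diffQuot α u z * diffQuot α v z) := integral_nonneg_of_ae hle
  rw [fracForm_eq]
  refine mul_neg_of_pos_of_neg (by linarith) ?_
  rcases hI.eq_or_lt' with h0 | h0
  · exfalso
    have hz := (integral_eq_zero_iff_of_nonneg_ae hle hint).1 h0
    -- On the diagonal the quotient is `0` by convention and carries no information, but there `u(x)
    -- v(y) = 0` follows from disjointness.
    have hne : ∀ᵐ z : R3 × R3, z.1 ≠ z.2 ∨ u z.1 * v z.2 = 0 := by
      filter_upwards [ae_prod_of_ae huv] with z h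
      rcases eq_or_ne z.1 z.2 with h' | h'
      · exact Or.inr (by rw [← h']; exact h.1)
      · exact Or.inl h'
    have hprod : ∀ᵐ z : R3 × R3, u z.1 * v z.2 = 0 := by
      filter_upwards [ae_prod_of_ae hu0, ae_prod_of_ae hv0, ae_prod_of_ae huv, hz, hne]
        with z h1 h2 h3 h4 h5
      rcases h5 with h5 | h5
      · have hpos : 0 < ‖z.1 - z.2‖ ^ (3 + 2 * α) :=
          Real.rpow_pos_of_pos (norm_pos_iff.2 (sub_ne_zero.2 h5)) _
        have h4' : -(diffQuot α u z * diffQuot α v z) = 0 := h4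
        rw [neg_eq_zero, diffQuot_mul, div_eq_zero_iff, or_iff_left hpos.ne'] at h4'
        nlinarith [mul_nonneg h1.1 h2.2, mul_nonneg h1.2 h2.1]
      · exact h5
    have hset : (volume : Measure (R3 × R3)) ({x | u x ≠ 0} ×ˢ {x | v x ≠ 0}) = 0 := by
      refine measure_mono_null (fun z hz' => ?_) (ae_iff.1 hprod)
      exact mul_ne_zero hz'.1 hz'.2
    rw [Measure.volume_eq_prod, Measure.prod_prod, mul_eq_zero] at hset
    rcases hset with h | h
    · exact hune (ae_iff.2 h)
    · exact hvne (ae_iff.2 h)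
  · rw [integral_neg] at h0
    linarith

/-- A minimizer of the energy on the Nehari manifold does not vanish on any ball. -/
lemma not_ae_eq_zero_of_minimizer (hs : s ∈ Ioo (3 / 4 : ℝ) 1) (ht : t ∈ Ioo (0 : ℝ) 1)
    (hf : IsAdmissible s f) (hc : IsCoeffs V K Q) {w : R3 → ℝ} (hw : w ∈ nehari s t V K Q f)
    (hmin : ∀ w' ∈ nehari s t V K Q f, energy s t V K Q f w ≤ energy s t V K Q f w')
    (x₀ : R3) {ρ : ℝ} (hρ : 0 < ρ) : ¬ ∀ᵐ x, x ∈ Metric.ball x₀ ρ → w x = 0 := by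
  intro hzero
  have hs' := mem_Ioo_zero_one hs
  have hr := four_lt_critExp hs
  have hF := hf.isGrowthLipschitz_primitive hs
  have hwH := hw.1.1
  have hw0 := nonneg_of_minimizer hs ht hf hc hw hmin
  set v := cone x₀ ρ with hv
  have hvH : MemH s v := memH_cone hs' x₀ hρ.le
  have hv0 : ∀ x, 0 ≤ v x := cone_nonneg x₀ ρ
  have hvne : ¬ v =ᵐ[volume] 0 := fun h => by
    have : volume (Metric.ball x₀ ρ) = 0 :=
      measure_mono_null (fun x hx => (cone_pos hx).ne') (ae_iff.1 h)
    exact (Metric.measure_ball_pos volume x₀ hρ).ne' this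
  have hwv : ∀ᵐ x, w x * v x = 0 := by
    filter_upwards [hzero] with x hx
    by_cases hxb : x ∈ Metric.ball x₀ ρ
    · rw [hx hxb, zero_mul]
    · rw [hv, cone_eq_zero hxb, mul_zero]
  have hneg : fracForm s w v < 0 :=
    fracForm_neg_of_disjoint hs' hwH.memG hvH.memG hw0 (ae_of_all _ hv0) hwv hw.2.1 hvne
  obtain ⟨b, hb⟩ := coulomb_add_smul_of_mul_eq_zero ht (hwH.isSource hs ht) (hvH.isSource hs ht) hwv
  set A := quad s V w with hA
  set A' := quad s V v with hA'
  set B := coulomb t w with hB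
  set B' := |b| + coulomb t v with hB'
  set D := ∫ x, Q x * |w x| ^ critExp s with hD
  have hA'0 : 0 ≤ A' := hc.quad_nonneg hs' v
  have hB'0 : 0 ≤ coulomb t v := coulomb_nonneg ht (hvH.isSource hs ht)
  have hD0 : 0 < D := hc.integral_Q_pos hs' hwH hw.2.1
  obtain ⟨T, hT, hTbound⟩ := exists_forall_quartic_lt_rpow hr ((A + A') / 2) ((B + B') / 4)
    (D := D / critExp s) (by positivity)
  set E := energy s t V K Q f with hE
  have hm0 : ∀ u ∈ nehari s t V K Q f, 0 ≤ E u := fun u hu => by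
    have := nehariFunctional_le_four_mul_energy (t := t) hs hf hc hu.1.1
    rw [hu.2.2] at this
    linarith
  -- Minimality of `w` is played against the projection of `w + δ v`. Only the cross term of the
  -- form is of order `δ`, so dividing by `τ² δ` bounds `-fracForm s w v` by a multiple of `δ`.
  have key : ∀ δ : ℝ, 0 < δ → δ ≤ 1 → -fracForm s w v ≤ δ * (A' / 2 + T ^ 2 / 4 * B') := by
    intro δ hδ hδ1
    set u := w + δ • v with hu
    have huH : MemH s u := hwH.add (hvH.smul δ)
    have hux : ∀ x, u x = w x + δ * v x := fun x => rfl
    have hu0 : ¬ u =ᵐ[volume] 0 := fun h => hw.2.1 <| by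
      filter_upwards [h, hw0] with x h1 h2
      have h3 : w x + δ * v x = 0 := h1
      have := mul_nonneg hδ.le (hv0 x)
      show w x = 0
      linarith
    obtain ⟨τ, hτ, hN⟩ := exists_smul_mem_nehari hs ht hf hc huH hu0
    have hquad : quad s V u = A + 2 * δ * fracForm s w v + δ ^ 2 * A' := by
      have e : ∫ x, V x * u x ^ 2 = (∫ x, V x * w x ^ 2) + δ ^ 2 * ∫ x, V x * v x ^ 2 := by
        rw [← integral_const_mul,
          ← integral_add (hc.integrable_V hs' hwH) ((hc.integrable_V hs' hvH).const_mul _)]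
        refine integral_congr_ae ?_
        filter_upwards [hwv] with x hx
        rw [hux]
        linear_combination (2 * δ * V x) * hx
      rw [hA, hA', quad, quad, quad, e, hu, fracForm_add_smul_self hwH.memG hvH.memG]
      ring
    have hFu : ∫ x, K x * primitive f (τ * w x) ≤ ∫ x, K x * primitive f (τ * u x) := by
      refine integral_mono (hc.integrable_K hs' hF (hwH.smul τ))
        (hc.integrable_K hs' hF (huH.smul τ)) fun x => ?_
      refine mul_le_mul_of_nonneg_left (hf.primitive_mono ?_) (hc.K_pos x).le
      refine mul_le_mul_of_nonneg_left ?_ hτ.le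
      simp only [hux]
      have := mul_nonneg hδ.le (hv0 x)
      linarith
    have hFu0 : 0 ≤ ∫ x, K x * primitive f (τ * w x) :=
      integral_nonneg fun x => mul_nonneg (hc.K_pos x).le (hf.primitive_nonneg _)
    have hQu : D ≤ ∫ x, Q x * |u x| ^ critExp s := by
      refine integral_mono_ae (hc.integrable_Q hs' hwH) (hc.integrable_Q hs' huH) ?_
      filter_upwards [hw0] with x hx
      refine mul_le_mul_of_nonneg_left ?_ (hc.Q_pos x).le
      have := mul_nonneg hδ.le (hv0 x)
      rw [hux, abs_of_nonneg hx, abs_of_nonneg (by linarith)]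
      exact Real.rpow_le_rpow hx (by linarith) (by linarith)
    have hcoul : coulomb t u ≤ B + δ ^ 2 * B' := by
      have hb' := hb δ
      have h1 : δ ^ 4 * coulomb t v ≤ δ ^ 2 * coulomb t v :=
        mul_le_mul_of_nonneg_right (pow_le_pow_of_le_one hδ.le hδ1 (by norm_num)) hB'0
      have h2 : δ ^ 2 * b ≤ δ ^ 2 * |b| := by gcongr; exact le_abs_self b
      rw [hu, hb', hB']
      linarith
    have hEu := energy_smul (f := f) (V := V) (K := K) (Q := Q) hs ht huH hτ.le
    have hEw := energy_smul (f := f) (V := V) (K := K) (Q := Q) hs ht hwH hτ.le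
    have hmu := hmin _ hN
    have hmw := energy_smul_le_of_mem_nehari hs ht hf hc hw hτ.le
    have hpos := hm0 _ hN
    rw [← hE] at hEu hEw hmw
    rw [← hA, ← hB, ← hD] at hEw
    rw [hquad] at hEu
    have hQu' := mul_le_mul_of_nonneg_left hQu (by positivity : 0 ≤ τ ^ critExp s / critExp s)
    have hcoul' := mul_le_mul_of_nonneg_left hcoul (by positivity : 0 ≤ τ ^ 4 / 4)
    have hδ2 : δ ^ 2 ≤ 1 := pow_le_one₀ hδ.le hδ1
    have hB'n : 0 ≤ B' := add_nonneg (abs_nonneg b) hB'0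
    -- The projection parameter is bounded independently of `δ`: beyond `T` the energy would be
    -- negative, whereas it is nonnegative on the Nehari manifold.
    have hτT : τ ≤ T := by
      by_contra! hlt
      have h1 := hTbound τ hlt.le
      have h2 : τ ^ 2 / 2 * (A + 2 * δ * fracForm s w v + δ ^ 2 * A') ≤ τ ^ 2 / 2 * (A + A') := by
        refine mul_le_mul_of_nonneg_left ?_ (by positivity)
        have := mul_neg_of_pos_of_neg hδ hneg
        have := mul_le_of_le_one_left hA'0 hδ2
        linarith
      have h3 : τ ^ 4 / 4 * (B + δ ^ 2 * B') ≤ τ ^ 4 / 4 * (B + B') := by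
        refine mul_le_mul_of_nonneg_left ?_ (by positivity)
        have := mul_le_of_le_one_left hB'n hδ2
        linarith
      have e1 : τ ^ critExp s * (D / critExp s) = τ ^ critExp s / critExp s * D := by ring
      rw [e1] at h1
      linarith
    have hmain : 0 ≤ τ ^ 2 * δ * (fracForm s w v + δ * (A' / 2 + τ ^ 2 / 4 * B')) := by
      have e : τ ^ 2 / 2 * (A + 2 * δ * fracForm s w v + δ ^ 2 * A') + τ ^ 4 / 4 * (B + δ ^ 2 * B')
          = τ ^ 2 / 2 * A + τ ^ 4 / 4 * B
            + τ ^ 2 * δ * (fracForm s w v + δ * (A' / 2 + τ ^ 2 / 4 * B')) := by ring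
      linarith
    have h1 := nonneg_of_mul_nonneg_right hmain (by positivity)
    have h2 : δ * (A' / 2 + τ ^ 2 / 4 * B') ≤ δ * (A' / 2 + T ^ 2 / 4 * B') := by gcongr
    linarith
  set K₀ := A' / 2 + T ^ 2 / 4 * B' with hK₀
  have hK₀0 : 0 ≤ K₀ := by
    have hB'n : 0 ≤ B' := add_nonneg (abs_nonneg b) hB'0
    positivity
  set c := -fracForm s w v with hcdef
  have hc0 : 0 < c := by rw [hcdef]; linarith
  -- For this `δ` the bound reads `c ≤ c / 2`.
  have h1 := key (min 1 (c / (2 * (K₀ + 1)))) (by positivity) (min_le_left _ _)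
  have h2 : min 1 (c / (2 * (K₀ + 1))) * K₀ ≤ c / (2 * (K₀ + 1)) * (K₀ + 1) := by
    have := min_le_right 1 (c / (2 * (K₀ + 1)))
    gcongr
    linarith
  have h3 : c / (2 * (K₀ + 1)) * (K₀ + 1) = c / 2 := by field_simp
  linarith

/-! ### Dilated coefficients and weak solutions -/

lemma exists_abs_le_of_tendsto_cocompact {W : R3 → ℝ} (hW : Continuous W) {Winf : ℝ}
    (hlim : Tendsto W (cocompact R3) (𝓝 Winf)) : ∃ M : ℝ, ∀ x, |W x| ≤ M := by
  have h1 : ∀ᶠ x in cocompact R3, |W x| ≤ |Winf| + 1 :=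
    (hlim.abs.eventually (gt_mem_nhds (lt_add_one |Winf|))).mono fun x hx => hx.le
  obtain ⟨S, hS, hsub⟩ := mem_cocompact.1 h1
  obtain ⟨M, hM⟩ := hS.exists_bound_of_continuousOn hW.continuousOn
  refine ⟨max M (|Winf| + 1), fun x => ?_⟩
  by_cases hx : x ∈ S
  · exact (hM x hx).trans (le_max_left _ _)
  · exact (hsub hx).trans (le_max_right _ _)

lemma isCoeffs_of_tendsto {Vinf Kinf Qinf : ℝ} (hVc : Continuous V) (hKc : Continuous K)
    (hQc : Continuous Q) (hKpos : ∀ x, 0 < K x) (hQpos : ∀ x, 0 < Q x) (hVinf : 0 < Vinf)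
    (hVlim : Tendsto V (cocompact R3) (𝓝 Vinf)) (hKlim : Tendsto K (cocompact R3) (𝓝 Kinf))
    (hQlim : Tendsto Q (cocompact R3) (𝓝 Qinf)) (hV : ∀ x, Vinf ≤ V x) : IsCoeffs V K Q := by
  obtain ⟨M₁, h₁⟩ := exists_abs_le_of_tendsto_cocompact hVc hVlim
  obtain ⟨M₂, h₂⟩ := exists_abs_le_of_tendsto_cocompact hKc hKlim
  obtain ⟨M₃, h₃⟩ := exists_abs_le_of_tendsto_cocompact hQc hQlim
  refine ⟨hVc, hKc, hQc, ⟨Vinf, hVinf, hV⟩, hKpos, hQpos, |M₁| + |M₂| + |M₃| + 1, by positivity,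
    fun x => ⟨?_, ?_, ?_⟩⟩
  · linarith [h₁ x, le_abs_self M₁, abs_nonneg M₂, abs_nonneg M₃]
  · linarith [h₂ x, le_abs_self M₂, abs_nonneg M₁, abs_nonneg M₃]
  · linarith [h₃ x, le_abs_self M₃, abs_nonneg M₁, abs_nonneg M₂]

lemma isCoeffs_const {Vinf Kinf Qinf : ℝ} (hV : 0 < Vinf) (hK : 0 < Kinf) (hQ : 0 < Qinf) :
    IsCoeffs (fun _ => Vinf) (fun _ => Kinf) (fun _ => Qinf) :=
  isCoeffs_of_tendsto continuous_const continuous_const continuous_const (fun _ => hK)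
    (fun _ => hQ) hV tendsto_const_nhds tendsto_const_nhds tendsto_const_nhds fun _ => le_rfl

lemma continuous_dilate (ε : ℝ) {W : R3 → ℝ} (hW : Continuous W) : Continuous (dilate ε W) :=
  hW.comp (continuous_const_smul ε)

lemma tendsto_dilate_cocompact {ε : ℝ} (hε : 0 < ε) {W : R3 → ℝ} {l : Filter ℝ}
    (hW : Tendsto W (cocompact R3) l) : Tendsto (dilate ε W) (cocompact R3) l :=
  hW.comp (Homeomorph.smulOfNeZero ε hε.ne').isClosedEmbedding.tendsto_cocompact

/-- The rescaled first component of a nontrivial weak solution lies on the Nehari manifold. -/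
lemma IsWeakSolution.dilate_mem_nehari (hs : s ∈ Ioo (3 / 4 : ℝ) 1) {ε : ℝ} (hε : 0 < ε)
    (hc : IsCoeffs (dilate ε V) (dilate ε K) (dilate ε Q)) {u φ : R3 → ℝ}
    (h : IsWeakSolution s t ε V K Q f u φ) (hu0 : ¬ u =ᵐ[volume] 0) :
    dilate ε u ∈ nehari s t (dilate ε V) (dilate ε K) (dilate ε Q) f := by
  obtain ⟨hu, hweak, hφ⟩ := h
  have hs' := mem_Ioo_zero_one hs
  have hr := critExp_pos hs'
  have hε3 : (ε ^ 3)⁻¹ ≠ 0 := by positivity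
  have hsq : ∫ x, dilate ε u x ^ 2 = (ε ^ 3)⁻¹ * ∫ x, u x ^ 2 :=
    integral_dilate hε fun x => u x ^ 2
  refine ⟨hc.memHV hs' (hu.1.dilate hε), fun hz => hu0 ?_, ?_⟩
  · have h0 : ∫ x, dilate ε u x ^ 2 = 0 := by
      rw [integral_eq_zero_of_ae]
      filter_upwards [hz] with x hx
      simp [hx]
    rw [hsq, mul_eq_zero, or_iff_right hε3] at h0
    filter_upwards [(integral_eq_zero_iff_of_nonneg (fun x => sq_nonneg (u x))
      hu.1.integrable_sq).1 h0] with x hx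
    simpa using hx
  · have hw := hweak u hu
    have e1 : ∫ x, dilate ε V x * dilate ε u x ^ 2 = (ε ^ 3)⁻¹ * ∫ x, V x * u x * u x := by
      rw [← integral_dilate hε]; simp only [dilate, sq, mul_assoc]
    -- The given `φ` need not be the potential chosen by `phi`; the Coulomb energy can be computed
    -- with any weak solution.
    have e2 : coulomb t (dilate ε u) = (ε ^ 3)⁻¹ * ∫ x, φ x * u x * u x := by
      rw [(hφ.dilate hε).coulomb_eq_integral, ← integral_dilate hε]
      simp only [dilate, sq, mul_assoc]
    have e3 : ∫ x, dilate ε K x * (f (dilate ε u x) * dilate ε u x)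
        = (ε ^ 3)⁻¹ * ∫ x, K x * f (u x) * u x := by
      rw [← integral_dilate hε]; simp only [dilate, mul_assoc]
    have e4 : ∫ x, dilate ε Q x * |dilate ε u x| ^ critExp s
        = (ε ^ 3)⁻¹ * ∫ x, Q x * (|u x| ^ (critExp s - 2) * u x) * u x := by
      have hpow : ∀ y : ℝ, |y| ^ critExp s = |y| ^ (critExp s - 2) * y * y := by
        intro y
        rcases eq_or_ne y 0 with rfl | hy
        · simp [Real.zero_rpow hr.ne']
        · have : |y| ^ critExp s = |y| ^ (critExp s - 2) * |y| ^ 2 := by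
            rw [← Real.rpow_natCast |y| 2, ← Real.rpow_add (abs_pos.2 hy)]; norm_num
          rw [this, sq_abs]; ring
      rw [← integral_dilate hε]
      simp only [dilate, hpow, mul_assoc]
    rw [nehariFunctional_eq, quad, fracForm_dilate s hε, e1, e2, e3, e4]
    linear_combination (ε ^ 3)⁻¹ * hw

/-! ### Non-attainment of the common level -/

/-- The least energy level of the limit problem is not attained when one of the coefficients
differs from its limit. -/
lemma not_exists_minimizer (hs : s ∈ Ioo (3 / 4 : ℝ) 1) (ht : t ∈ Ioo (0 : ℝ) 1)
    (hf : IsAdmissible s f) {Vinf Kinf Qinf : ℝ} (hc : IsCoeffs V K Q)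
    (hc' : IsCoeffs (fun _ => Vinf) (fun _ => Kinf) (fun _ => Qinf)) (hV : ∀ x, Vinf ≤ V x)
    (hK : ∀ x, K x ≤ Kinf) (hQ : ∀ x, Q x ≤ Qinf)
    (hstrict : (∃ x, Vinf < V x) ∨ (∃ x, K x < Kinf) ∨ ∃ x, Q x < Qinf) {u : R3 → ℝ}
    (hu : u ∈ nehari s t V K Q f) :
    (energy s t V K Q f u : EReal)
      ≠ leastEnergy s t (fun _ => Vinf) (fun _ => Kinf) (fun _ => Qinf) f := by
  intro heq
  have hs' := mem_Ioo_zero_one hs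
  have hr := critExp_pos hs'
  have hF := hf.isGrowthLipschitz_primitive hs
  obtain ⟨τ, hτ, hN⟩ := exists_smul_mem_nehari hs ht hf hc' hu.1.1 hu.2.1
  set w := τ • u with hw
  have hwH : MemH s w := hN.1.1
  have hlow : ∀ w' ∈ nehari s t (fun _ => Vinf) (fun _ => Kinf) (fun _ => Qinf) f,
      energy s t V K Q f u
        ≤ energy s t (fun _ => Vinf) (fun _ => Kinf) (fun _ => Qinf) f w' := fun w' hw' =>
    EReal.coe_le_coe_iff.1 (heq.le.trans (iInf₂_le w' hw'))
  have h1 := energy_mono (t := t) hs hf hc hc' hV hK hQ hwH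
  have h2 := energy_smul_le_of_mem_nehari hs ht hf hc hu hτ.le
  have h3 := hlow w hN
  -- The chain `I_∞(w) ≤ I(w) ≤ I(u) = m_∞` makes `w` a minimizer for the limit problem and all
  -- these values equal.
  have hmin : ∀ w' ∈ nehari s t (fun _ => Vinf) (fun _ => Kinf) (fun _ => Qinf) f,
      energy s t (fun _ => Vinf) (fun _ => Kinf) (fun _ => Qinf) f w
        ≤ energy s t (fun _ => Vinf) (fun _ => Kinf) (fun _ => Qinf) f w' := fun w' hw' =>
    (h1.trans h2).trans (hlow w' hw')
  have hw0 := nonneg_of_minimizer hs ht hf hc' hN hmin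
  have iV := (hc.integrable_V hs' hwH).sub (hc'.integrable_V hs' hwH)
  have iK := (hc'.integrable_K hs' hF hwH).sub (hc.integrable_K hs' hF hwH)
  have iQ := (hc'.integrable_Q hs' hwH).sub (hc.integrable_Q hs' hwH)
  have nV : ∀ x, 0 ≤ V x * w x ^ 2 - Vinf * w x ^ 2 := fun x => by
    rw [← sub_mul]; exact mul_nonneg (sub_nonneg.2 (hV x)) (sq_nonneg _)
  have nK : ∀ x, 0 ≤ Kinf * primitive f (w x) - K x * primitive f (w x) := fun x => by
    rw [← sub_mul]; exact mul_nonneg (sub_nonneg.2 (hK x)) (hf.primitive_nonneg _)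
  have nQ : ∀ x, 0 ≤ Qinf * |w x| ^ critExp s - Q x * |w x| ^ critExp s := fun x => by
    rw [← sub_mul]; exact mul_nonneg (sub_nonneg.2 (hQ x)) (by positivity)
  have pV : 0 ≤ ∫ x, (V x * w x ^ 2 - Vinf * w x ^ 2) := integral_nonneg nV
  have pK : 0 ≤ ∫ x, (Kinf * primitive f (w x) - K x * primitive f (w x)) := integral_nonneg nK
  have pQ : 0 ≤ ∫ x, (Qinf * |w x| ^ critExp s - Q x * |w x| ^ critExp s) := integral_nonneg nQ
  have hsum : energy s t V K Q f w
      - energy s t (fun _ => Vinf) (fun _ => Kinf) (fun _ => Qinf) f w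
      = 1 / 2 * (∫ x, (V x * w x ^ 2 - Vinf * w x ^ 2))
        + (∫ x, (Kinf * primitive f (w x) - K x * primitive f (w x)))
        + 1 / critExp s * ∫ x, (Qinf * |w x| ^ critExp s - Q x * |w x| ^ critExp s) := by
    rw [integral_sub (hc.integrable_V hs' hwH) (hc'.integrable_V hs' hwH),
      integral_sub (hc'.integrable_K hs' hF hwH) (hc.integrable_K hs' hF hwH),
      integral_sub (hc'.integrable_Q hs' hwH) (hc.integrable_Q hs' hwH),
      energy_eq, energy_eq, quad, quad]
    ring
  have hle : energy s t V K Q f w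
      - energy s t (fun _ => Vinf) (fun _ => Kinf) (fun _ => Qinf) f w ≤ 0 := by linarith
  have pQ' := mul_nonneg (by positivity : 0 ≤ 1 / critExp s) pQ
  rw [hsum] at hle
  -- Three nonnegative integrals with positive weights have a nonpositive sum, so each integrand
  -- vanishes almost everywhere.
  have zV := (integral_eq_zero_iff_of_nonneg nV iV).1 (by linarith)
  have zK := (integral_eq_zero_iff_of_nonneg nK iK).1 (by linarith)
  have zQ0 : ∫ x, (Qinf * |w x| ^ critExp s - Q x * |w x| ^ critExp s) = 0 := by
    have : 1 / critExp s * ∫ x, (Qinf * |w x| ^ critExp s - Q x * |w x| ^ critExp s) = 0 := by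
      linarith
    exact (mul_eq_zero.1 this).resolve_left (by positivity)
  have zQ := (integral_eq_zero_iff_of_nonneg nQ iQ).1 zQ0
  -- By continuity the set where a coefficient differs from its limit is open, so it contains a ball
  -- on which `w` would vanish.
  have hball : ∀ U : Set R3, IsOpen U → U.Nonempty → ¬ ∀ᵐ x, x ∈ U → w x = 0 := by
    rintro U hU ⟨x₀, hx₀⟩ hUw
    obtain ⟨ρ, hρ, hsub⟩ := Metric.isOpen_iff.1 hU x₀ hx₀
    refine not_ae_eq_zero_of_minimizer hs ht hf hc' hN hmin x₀ hρ ?_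
    filter_upwards [hUw] with x hx hxb
    exact hx (hsub hxb)
  rcases hstrict with hne | hne | hne
  · refine hball {x | Vinf < V x} (isOpen_lt continuous_const hc.contV) hne ?_
    filter_upwards [zV] with x hx hxU
    have hx' : V x * w x ^ 2 - Vinf * w x ^ 2 = 0 := hx
    rw [← sub_mul, mul_eq_zero, or_iff_right (sub_pos.2 hxU).ne'] at hx'
    simpa using hx'
  · refine hball {x | K x < Kinf} (isOpen_lt hc.contK continuous_const) hne ?_
    filter_upwards [zK, hw0] with x hx hx0 hxU
    have hx' : Kinf * primitive f (w x) - K x * primitive f (w x) = 0 := hx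
    rw [← sub_mul, mul_eq_zero, or_iff_right (sub_pos.2 hxU).ne'] at hx'
    by_contra hwx
    exact (hf.primitive_pos (lt_of_le_of_ne hx0 (Ne.symm hwx))).ne' hx'
  · refine hball {x | Q x < Qinf} (isOpen_lt hc.contQ continuous_const) hne ?_
    filter_upwards [zQ] with x hx hxU
    have hx' : Qinf * |w x| ^ critExp s - Q x * |w x| ^ critExp s = 0 := hx
    rw [← sub_mul, mul_eq_zero, or_iff_right (sub_pos.2 hxU).ne'] at hx'
    simpa using ((Real.rpow_eq_zero_iff_of_nonneg (abs_nonneg _)).1 hx').1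

lemma exists_dilate_of_measure_pos {ε : ℝ} (hε : 0 < ε) {P : R3 → Prop}
    (h : 0 < volume {x | P x}) : ∃ x : R3, P (ε • x) := by
  obtain ⟨x, hx⟩ := nonempty_of_measure_ne_zero h.ne'
  exact ⟨ε⁻¹ • x, by rwa [smul_inv_smul₀ hε.ne']⟩

end FracSP

end

/-! ### The cycle of inequalities between the levels, and the conclusion -/

theorem theorem1p2 (s t : ℝ) (hs : s ∈ Set.Ioo (3 / 4 : ℝ) 1) (ht : t ∈ Set.Ioo (0 : ℝ) 1)
    (f : ℝ → ℝ) (hf : FracSP.IsAdmissible s f)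
    (V K Q : FracSP.R3 → ℝ) (hVc : Continuous V) (hKc : Continuous K) (hQc : Continuous Q)
    (hKpos : ∀ x, 0 < K x) (hQpos : ∀ x, 0 < Q x)
    (Vinf Kinf Qinf : ℝ) (hVinf : 0 < Vinf)
    (hVlim : Filter.Tendsto V (Filter.cocompact FracSP.R3) (nhds Vinf))
    (hKlim : Filter.Tendsto K (Filter.cocompact FracSP.R3) (nhds Kinf))
    (hQlim : Filter.Tendsto Q (Filter.cocompact FracSP.R3) (nhds Qinf))
    (hV : ∀ x, Vinf ≤ V x) (hK : ∀ x, K x ≤ Kinf) (hQ : ∀ x, Q x ≤ Qinf)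
    (hstrict : 0 < MeasureTheory.volume {x | Vinf < V x} ∨
      0 < MeasureTheory.volume {x | K x < Kinf} ∨
      0 < MeasureTheory.volume {x | Q x < Qinf})
    (ε : ℝ) (hε : 0 < ε) :
    -- the ground energy, in both of its forms, equals `m_∞`
    FracSP.groundEnergy s t ε V K Q f
        = FracSP.leastEnergy s t (fun _ => Vinf) (fun _ => Kinf) (fun _ => Qinf) f ∧
    FracSP.leastEnergy s t (FracSP.dilate ε V) (FracSP.dilate ε K) (FracSP.dilate ε Q) f
        = FracSP.leastEnergy s t (fun _ => Vinf) (fun _ => Kinf) (fun _ => Qinf) f ∧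
    -- the ground energy is not attained on the Nehari manifold
    (¬ ∃ u ∈ FracSP.nehari s t (FracSP.dilate ε V) (FracSP.dilate ε K) (FracSP.dilate ε Q) f,
      (FracSP.energy s t (FracSP.dilate ε V) (FracSP.dilate ε K) (FracSP.dilate ε Q) f u : EReal)
        = FracSP.groundEnergy s t ε V K Q f) ∧
    -- the system has no ground state solution
    ¬ ∃ u φ : FracSP.R3 → ℝ, FracSP.IsGroundState s t ε V K Q f u φ := by
  have hc : FracSP.IsCoeffs (FracSP.dilate ε V) (FracSP.dilate ε K) (FracSP.dilate ε Q) :=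
    FracSP.isCoeffs_of_tendsto (FracSP.continuous_dilate ε hVc) (FracSP.continuous_dilate ε hKc)
      (FracSP.continuous_dilate ε hQc) (fun x => hKpos _) (fun x => hQpos _) hVinf
      (FracSP.tendsto_dilate_cocompact hε hVlim) (FracSP.tendsto_dilate_cocompact hε hKlim)
      (FracSP.tendsto_dilate_cocompact hε hQlim) (fun x => hV _)
  have hc' : FracSP.IsCoeffs (fun _ => Vinf) (fun _ => Kinf) (fun _ => Qinf) :=
    FracSP.isCoeffs_const hVinf ((hKpos 0).trans_le (hK 0)) ((hQpos 0).trans_le (hQ 0))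
  have hV' : ∀ x, Vinf ≤ FracSP.dilate ε V x := fun x => hV _
  have hK' : ∀ x, FracSP.dilate ε K x ≤ Kinf := fun x => hK _
  have hQ' : ∀ x, FracSP.dilate ε Q x ≤ Qinf := fun x => hQ _
  have h₁ := FracSP.leastEnergy_mono hs ht hf hc hc' hV' hK' hQ'
  have h₂ := FracSP.leastEnergy_le_mountainPassLevel hs ht hf hc
  have h₃ := FracSP.mountainPassLevel_le_leastEnergy hs ht hf hc hc'
    (FracSP.tendsto_dilate_cocompact hε hVlim) (FracSP.tendsto_dilate_cocompact hε hKlim)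
    (FracSP.tendsto_dilate_cocompact hε hQlim) hV' hK' hQ'
  have hground : FracSP.groundEnergy s t ε V K Q f
      = FracSP.leastEnergy s t (fun _ => Vinf) (fun _ => Kinf) (fun _ => Qinf) f :=
    le_antisymm h₃ (h₁.trans h₂)
  have hstrict' : (∃ x, Vinf < FracSP.dilate ε V x) ∨ (∃ x, FracSP.dilate ε K x < Kinf) ∨
      ∃ x, FracSP.dilate ε Q x < Qinf :=
    hstrict.imp (FracSP.exists_dilate_of_measure_pos hε)
      (Or.imp (FracSP.exists_dilate_of_measure_pos hε) (FracSP.exists_dilate_of_measure_pos hε))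
  have hnot : ¬ ∃ u ∈ FracSP.nehari s t (FracSP.dilate ε V) (FracSP.dilate ε K)
      (FracSP.dilate ε Q) f,
      (FracSP.energy s t (FracSP.dilate ε V) (FracSP.dilate ε K) (FracSP.dilate ε Q) f u : EReal)
        = FracSP.groundEnergy s t ε V K Q f := by
    rintro ⟨u, hu, he⟩
    exact FracSP.not_exists_minimizer hs ht hf hc hc' hV' hK' hQ' hstrict' hu (he.trans hground)
  refine ⟨hground, le_antisymm (h₂.trans h₃) h₁, hnot, ?_⟩
  rintro ⟨u, φ, hsol, hu0, he⟩
  exact hnot ⟨FracSP.dilate ε u, hsol.dilate_mem_nehari hs hε hc hu0, he⟩
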